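/- \textbf{Burling graphs.} Define graphs $B_1,B_2,\ldots$ together with families $\mathcal S_1,\mathcal S_2,\ldots$ of subsets of their vertex sets as follows. $B_1$ is the one-vertex graph and $\mathcal S_1=\{V(B_1)\}$. Given $(B_k,\mathcal S_k)$, the graph $B_{k+1}$ is the disjoint union of a base copy of $B_k$ and, for every $S\in\mathcal S_k$, a further copy $B_k^S$ of $B_k$, with an additional vertex $v_{S,Q}$ for all $S,Q\in\mathcal S_k$, whose neighbors are exactly the vertices of $Q$ in the copy $B_k^S$; the family $\mathcal S_{k+1}$ consists of the sets $S\cup Q$ and $S\cup\{v_{S,Q}\}$ for all $S,Q\in\mathcal S_k$, where $S$ is taken in the base copy and $Q$ in the copy $B_k^S$. A graph is a \emph{Burling graph} if it is isomorphic to an induced subgraph of $B_k$ for some $k\ge 1$. \textbf{Strict frame representations.} A \emph{frame} is a set $F(\ell,r,b,t)=(\{\ell,r\}\times[b,t])\cup([\ell,r]\times\{b,t\})$ in $\mathbb R^2$ with $\ell<r$ and $b<t$. A \emph{frame representation} of a graph $G$ is a family of frames $F_v=F(\ell_v,r_v,b_v,t_v)$, $v\in V(G)$, such that for all distinct vertices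 $u,v$ none of the four corners of $F_u$ lies on $F_v$, and $uv$ is an edge of $G$ if and only if $F_u\cap F_v\neq\emptyset$. It is \emph{strict} if (1) for all distinct $i,j$ with $F_i\cap F_j\ne\emptyset$ we have $\ell_i<\ell_j<r_i<r_j$ and $b_i<b_j<t_j<t_i$, or $\ell_j<\ell_i<r_j<r_i$ and $b_j<b_i<t_i<t_j$; and (2) there are no $i,j,k$ with $\ell_i<\ell_j<\ell_k<r_i<r_j$ and $b_i<b_j<b_k<t_k<t_j<t_i$. \textbf{Theorem.} There is a deterministic polynomial-time algorithm which, given the adjacency matrix of a finite graph $G$, decides whether $G$ is a Burling graph and, if it is, produces a strict frame representation of $G$ (with non-negative integer coordinates). Explicitly, there are a single program for a random-access machine (with addition, truncated subtraction and indirect addressing on natural numbers, at unit cost) and a polynomial $p$ such that on every graph with $n$ vertices the program halts within $p(n)$ steps with this output. -/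

import Mathlib

namespace BurlingRec

/-! ### Burling's construction -/

/-- A graph together with a distinguished family of sets of vertices. In Burling's construction
these sets are stable. -/
structure SetGraph where
  V : Type
  graph : SimpleGraph V
  sets : Set (Set V)

/-- The vertices of the next graph in Burling's construction: those of one base copy of `P`,
those of one further copy of `P` for each distinguished set `S`, and one new vertex for each
distinguished set `S` and each distinguished set `Q` of the copy that belongs to `S`. -/
inductive NextVertex (P : SetGraph) : Type
  | base (v : P.V) : NextVertex P
  | copy (S : P.sets) (v : P.V) : NextVertex P
  | apex (S Q : P.sets) : NextVertex P

/-- Adjacency in the next graph: inside each copy as in `P`; the new vertex of `(S, Q)` is joined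
exactly to the vertices of `Q` in the copy that belongs to `S`. -/
def NextVertex.Adj {P : SetGraph} : NextVertex P → NextVertex P → Prop
  | .base u, .base v => P.graph.Adj u v
  | .copy S u, .copy T v => S = T ∧ P.graph.Adj u v
  | .apex S Q, .copy T v => S = T ∧ v ∈ Q.1
  | .copy T v, .apex S Q => S = T ∧ v ∈ Q.1
  | _, _ => False

/-- One step of Burling's construction. The new distinguished sets are, for all `S` and `Q`,
the union of `S` (in the base copy) with `Q` (in the copy that belongs to `S`), and the union of
`S` with the singleton of the new vertex of `(S, Q)`. -/
def SetGraph.next (P : SetGraph) : SetGraph where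
  V := NextVertex P
  graph :=
    { Adj := NextVertex.Adj
      symm := ⟨by
        rintro (u | ⟨S, u⟩ | ⟨S, Q⟩) (v | ⟨T, v⟩ | ⟨T, R⟩) h
        all_goals first
          | exact h
          | exact SimpleGraph.Adj.symm (G := P.graph) h
          | exact And.intro h.1.symm (SimpleGraph.Adj.symm (G := P.graph) h.2)⟩
      loopless := ⟨by
        rintro (u | ⟨S, u⟩ | ⟨S, Q⟩) h
        · exact P.graph.loopless.irrefl u h
        · exact P.graph.loopless.irrefl u h.2
        · exact h⟩ }
  sets := {A | ∃ S Q : P.sets,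
    A = NextVertex.base '' S.1 ∪ NextVertex.copy S '' Q.1 ∨
    A = NextVertex.base '' S.1 ∪ {NextVertex.apex S Q}}

/-- The Burling sequence; `burlingSeq k` is the graph usually called `B_{k+1}`. It starts with the
one-vertex graph, whose only distinguished set is its vertex set. -/
def burlingSeq : ℕ → SetGraph
  | 0 => { V := Unit, graph := ⊥, sets := {Set.univ} }
  | k + 1 => (burlingSeq k).next

/-- A Burling graph is (isomorphic to) an induced subgraph of a graph in the Burling sequence. -/
def IsBurlingGraph {V : Type*} (G : SimpleGraph V) : Prop :=
  ∃ k : ℕ, Nonempty (G ↪g (burlingSeq k).graph)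

/-! ### Strict frame representations -/

/-- The boundary of the rectangle `[l, r] × [b, t]`. -/
def frame (l r b t : ℝ) : Set (ℝ × ℝ) :=
  ({l, r} ×ˢ Set.Icc b t) ∪ (Set.Icc l r ×ˢ {b, t})

/-- `l`, `r`, `b`, `t` describe a frame representation of `G`. -/
structure IsFrameRep {V : Type*} (G : SimpleGraph V) (l r b t : V → ℝ) : Prop where
  left_lt_right : ∀ v, l v < r v
  bottom_lt_top : ∀ v, b v < t v
  corners : ∀ u v, u ≠ v →
    (l u, b u) ∉ frame (l v) (r v) (b v) (t v) ∧
    (l u, t u) ∉ frame (l v) (r v) (b v) (t v) ∧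
    (r u, b u) ∉ frame (l v) (r v) (b v) (t v) ∧
    (r u, t u) ∉ frame (l v) (r v) (b v) (t v)
  adj_iff : ∀ u v, u ≠ v → (G.Adj u v ↔
    (frame (l u) (r u) (b u) (t u) ∩ frame (l v) (r v) (b v) (t v)).Nonempty)

/-- Strictness of an indexed family of frames. -/
structure IsStrictFamily {I : Type*} (l r b t : I → ℝ) : Prop where
  pair : ∀ i j, i ≠ j →
    (frame (l i) (r i) (b i) (t i) ∩ frame (l j) (r j) (b j) (t j)).Nonempty →
    (l i < l j ∧ l j < r i ∧ r i < r j ∧ b i < b j ∧ b j < t j ∧ t j < t i) ∨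
    (l j < l i ∧ l i < r j ∧ r j < r i ∧ b j < b i ∧ b i < t i ∧ t i < t j)
  triple : ¬ ∃ i j k,
    (l i < l j ∧ l j < l k ∧ l k < r i ∧ r i < r j) ∧
    (b i < b j ∧ b j < b k ∧ b k < t k ∧ t k < t j ∧ t j < t i)

/-- A strict frame representation of `G`. -/
def IsStrictFrameRep {V : Type*} (G : SimpleGraph V) (l r b t : V → ℝ) : Prop :=
  IsFrameRep G l r b t ∧ IsStrictFamily l r b t

/-! ### A random-access machine with a step count

Programs work on registers and on unbounded arrays with indirect addressing, all holding natural
numbers. The only arithmetic is addition and truncated subtraction, so the unit-cost measure below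
is polynomially equivalent to running time on a Turing machine. A program mentions only finitely
many registers and arrays. -/

/-- The memory: register `i` holds `reg i`, cell `j` of array `a` holds `arr a j`. -/
structure Memory where
  reg : ℕ → ℕ
  arr : ℕ → ℕ → ℕ

/-- Expressions. -/
inductive Expr : Type
  | const (k : ℕ) : Expr
  | reg (i : ℕ) : Expr
  | arr (a : ℕ) (index : Expr) : Expr
  | add (e f : Expr) : Expr
  | sub (e f : Expr) : Expr

/-- The value of an expression. -/
def Expr.eval (s : Memory) : Expr → ℕ
  | .const k => k
  | .reg i => s.reg i
  | .arr a e => s.arr a (e.eval s)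
  | .add e f => e.eval s + f.eval s
  | .sub e f => e.eval s - f.eval s

/-- The number of elementary operations in the evaluation of an expression. -/
def Expr.cost : Expr → ℕ
  | .const _ => 1
  | .reg _ => 1
  | .arr _ e => e.cost + 1
  | .add e f => e.cost + f.cost + 1
  | .sub e f => e.cost + f.cost + 1

/-- Programs. A test succeeds if the value of its expression is nonzero. -/
inductive Program : Type
  | skip : Program
  | setReg (i : ℕ) (e : Expr) : Program
  | setArr (a : ℕ) (index e : Expr) : Program
  | seq (c d : Program) : Program
  | ite (test : Expr) (c d : Program) : Program
  | loop (test : Expr) (c : Program) : Program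

/-- `Runs c s s' T`: program `c` started in memory `s` halts in memory `s'` after `T` steps. -/
inductive Runs : Program → Memory → Memory → ℕ → Prop
  | skip (s : Memory) : Runs .skip s s 1
  | setReg (s : Memory) (i : ℕ) (e : Expr) :
      Runs (.setReg i e) s { s with reg := Function.update s.reg i (e.eval s) } (e.cost + 1)
  | setArr (s : Memory) (a : ℕ) (index e : Expr) :
      Runs (.setArr a index e) s
        { s with
          arr := Function.update s.arr a
            (Function.update (s.arr a) (index.eval s) (e.eval s)) }
        (index.cost + e.cost + 1)
  | seq {c d : Program} {s s' s'' : Memory} {T T' : ℕ} :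
      Runs c s s' T → Runs d s' s'' T' → Runs (.seq c d) s s'' (T + T')
  | ite_true {e : Expr} {c d : Program} {s s' : Memory} {T : ℕ} :
      e.eval s ≠ 0 → Runs c s s' T → Runs (.ite e c d) s s' (e.cost + 1 + T)
  | ite_false {e : Expr} {c d : Program} {s s' : Memory} {T : ℕ} :
      e.eval s = 0 → Runs d s s' T → Runs (.ite e c d) s s' (e.cost + 1 + T)
  | loop_stop {e : Expr} {c : Program} {s : Memory} :
      e.eval s = 0 → Runs (.loop e c) s s (e.cost + 1)
  | loop_step {e : Expr} {c : Program} {s s' s'' : Memory} {T T' : ℕ} :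
      e.eval s ≠ 0 → Runs c s s' T → Runs (.loop e c) s' s'' T' →
      Runs (.loop e c) s s'' (e.cost + 1 + T + T')

open Classical in
/-- The initial memory for the input graph `G` on the vertices `0, …, n - 1`: register `0` holds
`n`, array `0` holds the adjacency matrix of `G` row by row (the entry for `u`, `v` in cell
`u * n + v`), and everything else is zero. -/
noncomputable def inputMemory {n : ℕ} (G : SimpleGraph (Fin n)) : Memory where
  reg i := if i = 0 then n else 0
  arr a j :=
    if a = 0 ∧ ∃ u v : Fin n, j = u.1 * n + v.1 ∧ G.Adj u v then 1 else 0

end BurlingRec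

namespace BurlingRec

/-! ### Bounded programs on a random-access machine -/

/-! A finite graph is a Burling graph exactly if it carries two relations as in `BurlingRel`: a
nesting `lt` and an acyclic orientation `arr` of the edges. The vertices enclosing a given vertex
form a chain, so do its out-neighbours, and two mixed axioms say how an arrow behaves with respect
to what encloses its ends. In Burling's construction such relations extend from one graph to the
next because the distinguished sets are upper chains (`SetGraph.Layered.next`). Conversely, an
outermost vertex that no arrow enters can be split off, and the graph is rebuilt inside the sequence
(`BurlingRel.exists_hosts`).

The same relations yield frames: `lt u v` places the frame of `u` inside that of `v`, and `arr u v`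
makes the frame of `u` cross the right side of that of `v`. Vertical coordinates come from a
traversal of the forest order generated by `lt` and `arr`, horizontal ones from counting
predecessors in an acyclic system of constraints (`BurlingRel.isStrictFrameRep`).

It remains to find the relations. Let `x` be a vertex and `C` a component of the graph without `x`
and its neighbours, to be nested in `x`. The neighbours of `C` outside `C` have to be probes:
outermost, containing nothing, receiving no arrow. In every solution some `z` in `C` is outermost
and emits no arrow. Removing `z` and its neighbours leaves parts of two kinds. A part nested in `z`
is itself a component of the graph without `z` and its neighbours, which is the same problem with
`z` in the role of `x`. Any other part hangs at a single neighbour `w` of `z`, and `w` takes the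
role of `z` for it. Parts with a common attachment must moreover be nestable one in the other. These
conditions are necessary (`admissible_of_burlingRel`) and, in triangle-free graphs, sufficient:
arbitrary solutions of the parts can be glued (`Pieces.solves_comb`). No backtracking is needed,
since a subproblem is described by the four vertices `x`, `c`, `z`, `l`.

An additional isolated vertex serves as the first `x`. All notions are first-order formulas or least
fixed points of arity at most six, and a program with bounded loops tabulates these in polynomial
time (`exists_program`). -/

/-- Numerical terms with bounded summation over `0, …, N - 1`. -/
inductive Tm : Type
  | const (k : ℕ) : Tm
  | var (i : ℕ) : Tm
  | size : Tm
  | tab (a : ℕ) (t : Tm) : Tm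
  | add (t u : Tm) : Tm
  | sub (t u : Tm) : Tm
  | sum (i : ℕ) (t : Tm) : Tm

/-- The value of a term for the bound `N`, the variables `env` and the tables `A`. -/
def Tm.eval (N : ℕ) (A : ℕ → ℕ → ℕ) : Tm → (ℕ → ℕ) → ℕ
  | .const k, _ => k
  | .var i, env => env i
  | .size, _ => N
  | .tab a t, env => A a (t.eval N A env)
  | .add t u, env => t.eval N A env + u.eval N A env
  | .sub t u, env => t.eval N A env - u.eval N A env
  | .sum i t, env => ∑ k ∈ Finset.range N, t.eval N A (Function.update env i k)

/-- A program that evaluates a term into register `2 * d + 2`. Variable `i` lives in register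
`2 * i + 1`, and the registers `2 * j + 2` with `j < d` are preserved. -/
def Tm.comp : Tm → ℕ → Program
  | .const k, d => .setReg (2 * d + 2) (.const k)
  | .var i, d => .setReg (2 * d + 2) (.reg (2 * i + 1))
  | .size, d => .setReg (2 * d + 2) (.reg 0)
  | .tab a t, d => .seq (t.comp d) (.setReg (2 * d + 2) (.arr a (.reg (2 * d + 2))))
  | .add t u, d => .seq (t.comp d) (.seq (u.comp (d + 1))
      (.setReg (2 * d + 2) (.add (.reg (2 * d + 2)) (.reg (2 * (d + 1) + 2)))))
  | .sub t u, d => .seq (t.comp d) (.seq (u.comp (d + 1))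
      (.setReg (2 * d + 2) (.sub (.reg (2 * d + 2)) (.reg (2 * (d + 1) + 2)))))
  | .sum i t, d =>
      .seq (.setReg (2 * d + 2) (.const 0)) <|
      .seq (.setReg (2 * (d + 1) + 2) (.reg (2 * i + 1))) <|
      .seq (.setReg (2 * i + 1) (.const 0)) <|
      .seq (.loop (.sub (.reg 0) (.reg (2 * i + 1)))
        (.seq (t.comp (d + 2))
          (.seq (.setReg (2 * d + 2) (.add (.reg (2 * d + 2)) (.reg (2 * (d + 2) + 2))))
            (.setReg (2 * i + 1) (.add (.reg (2 * i + 1)) (.const 1)))))) <|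
      .setReg (2 * i + 1) (.reg (2 * (d + 1) + 2))

/-- The invariant is indexed by the number of completed rounds, and the test has to evaluate to the
number of remaining ones. Every loop produced by `Tm.comp` and `St.comp` is of this kind. -/
theorem Runs.counting_loop {c : Program} {e : Expr} (I : ℕ → Memory → Prop) (N B : ℕ)
    (htest : ∀ k s, k ≤ N → I k s → e.eval s = N - k)
    (hbody : ∀ k s, k < N → I k s → ∃ s' T, Runs c s s' T ∧ T ≤ B ∧ I (k + 1) s') :
    ∀ j k s, j + k = N → I k s →
      ∃ s' T, Runs (.loop e c) s s' T ∧ T ≤ (j + 1) * (e.cost + 1 + B) ∧ I N s' := by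
  intro j
  induction j with
  | zero =>
    intro k s hk hI
    have hk' : k = N := by omega
    subst hk'
    refine ⟨s, _, Runs.loop_stop (by rw [htest k s le_rfl hI]; omega), by simp, hI⟩
  | succ j ih =>
    intro k s hk hI
    obtain ⟨s', T, h1, hT, hI'⟩ := hbody k s (by omega) hI
    obtain ⟨s'', T', h2, hT', hI''⟩ := ih (k + 1) s' (by omega) hI'
    refine ⟨s'', _, Runs.loop_step (by rw [htest k s (by omega) hI]; omega) h1 h2, ?_, hI''⟩
    have : (j + 1 + 1) * (e.cost + 1 + B) = (j + 1) * (e.cost + 1 + B) + (e.cost + 1 + B) := by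
      ring
    omega

/-- The running time depends on the memory only through register `0`, which holds the bound `N`, so
one polynomial serves for all depths and memories. Subterms are compiled at greater depth and
therefore cannot destroy variables or intermediate values. -/
theorem Tm.comp_spec (t : Tm) : ∃ p : Polynomial ℕ, ∀ (d : ℕ) (s : Memory), ∃ s' T,
    Runs (t.comp d) s s' T ∧ T ≤ p.eval (s.reg 0) ∧ s'.arr = s.arr ∧
    s'.reg (2 * d + 2) = t.eval (s.reg 0) s.arr (fun i => s.reg (2 * i + 1)) ∧
    ∀ j, (j % 2 = 1 ∨ j < 2 * d + 2) → s'.reg j = s.reg j := by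
  induction t with
  | const k =>
    refine ⟨2, fun d s => ⟨_, _, Runs.setReg _ _ _, by simp [Expr.cost], rfl, ?_, ?_⟩⟩
    · simp [Expr.eval, Tm.eval]
    · intro j hj
      exact Function.update_of_ne (by omega) _ _
  | var k =>
    refine ⟨2, fun d s => ⟨_, _, Runs.setReg _ _ _, by simp [Expr.cost], rfl, ?_, ?_⟩⟩
    · simp [Expr.eval, Tm.eval]
    · intro j hj
      exact Function.update_of_ne (by omega) _ _
  | size =>
    refine ⟨2, fun d s => ⟨_, _, Runs.setReg _ _ _, by simp [Expr.cost], rfl, ?_, ?_⟩⟩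
    · simp [Expr.eval, Tm.eval]
    · intro j hj
      exact Function.update_of_ne (by omega) _ _
  | tab a t ih =>
    obtain ⟨p, hp⟩ := ih
    refine ⟨p + 3, fun d s => ?_⟩
    obtain ⟨s', T, h, hT, harr, hval, hreg⟩ := hp d s
    refine ⟨_, _, Runs.seq h (Runs.setReg _ _ _), by simpa [Expr.cost] using hT, harr, ?_, ?_⟩
    · simp [Expr.eval, Tm.eval, hval, harr]
    · intro j hj
      rw [← hreg j hj]
      exact Function.update_of_ne (by omega) _ _
  | add t u iht ihu =>
    obtain ⟨p, hp⟩ := iht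
    obtain ⟨q, hq⟩ := ihu
    refine ⟨p + (q + 4), fun d s => ?_⟩
    obtain ⟨s', T, h, hT, harr, hval, hreg⟩ := hp d s
    obtain ⟨s'', T', h', hT', harr', hval', hreg'⟩ := hq (d + 1) s'
    have e0 : s'.reg 0 = s.reg 0 := hreg 0 (by omega)
    have e1 : (fun i => s'.reg (2 * i + 1)) = fun i => s.reg (2 * i + 1) := by
      funext i
      exact hreg _ (by omega)
    rw [e0] at hT' hval'
    rw [e1, harr] at hval'
    refine ⟨_, _, Runs.seq h (Runs.seq h' (Runs.setReg _ _ _)), ?_, by simp [harr, harr'], ?_, ?_⟩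
    · simp only [Expr.cost, Polynomial.eval_add, Polynomial.eval_ofNat]
      omega
    · simp only [Function.update_self, Expr.eval, hval', Tm.eval]
      rw [hreg' _ (by omega), hval]
    · intro j hj
      rw [← hreg j hj, ← hreg' j (by omega)]
      exact Function.update_of_ne (by omega) _ _
  | sub t u iht ihu =>
    obtain ⟨p, hp⟩ := iht
    obtain ⟨q, hq⟩ := ihu
    refine ⟨p + (q + 4), fun d s => ?_⟩
    obtain ⟨s', T, h, hT, harr, hval, hreg⟩ := hp d s
    obtain ⟨s'', T', h', hT', harr', hval', hreg'⟩ := hq (d + 1) s'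
    have e0 : s'.reg 0 = s.reg 0 := hreg 0 (by omega)
    have e1 : (fun i => s'.reg (2 * i + 1)) = fun i => s.reg (2 * i + 1) := by
      funext i
      exact hreg _ (by omega)
    rw [e0] at hT' hval'
    rw [e1, harr] at hval'
    refine ⟨_, _, Runs.seq h (Runs.seq h' (Runs.setReg _ _ _)), ?_, by simp [harr, harr'], ?_, ?_⟩
    · simp only [Expr.cost, Polynomial.eval_add, Polynomial.eval_ofNat]
      omega
    · simp only [Function.update_self, Expr.eval, hval', Tm.eval]
      rw [hreg' _ (by omega), hval]
    · intro j hj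
      rw [← hreg j hj, ← hreg' j (by omega)]
      exact Function.update_of_ne (by omega) _ _
  | sum i t ih =>
    obtain ⟨p, hp⟩ := ih
    -- A test costs four steps and so does each of the two assignments of a round, whence twelve.
    -- The four assignments outside the loop cost two steps each.
    refine ⟨(Polynomial.X + 1) * (p + 12) + 8, fun d s => ?_⟩
    let env : ℕ → ℕ := fun j => s.reg (2 * j + 1)
    let I : ℕ → Memory → Prop := fun k s' =>
      s'.arr = s.arr ∧ s'.reg (2 * i + 1) = k ∧ s'.reg (2 * (d + 1) + 2) = s.reg (2 * i + 1) ∧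
      s'.reg (2 * d + 2)
        = ∑ m ∈ Finset.range k, t.eval (s.reg 0) s.arr (Function.update env i m) ∧
      ∀ j, j ≠ 2 * i + 1 → (j % 2 = 1 ∨ j < 2 * d + 2) → s'.reg j = s.reg j
    obtain ⟨s', T, hrun, hT, hI⟩ := Runs.counting_loop (c := .seq (t.comp (d + 2))
          (.seq (.setReg (2 * d + 2) (.add (.reg (2 * d + 2)) (.reg (2 * (d + 2) + 2))))
            (.setReg (2 * i + 1) (.add (.reg (2 * i + 1)) (.const 1)))))
        (e := .sub (.reg 0) (.reg (2 * i + 1))) I (s.reg 0) (p.eval (s.reg 0) + 8)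
      (by
        rintro k s' hk ⟨-, h2, -, -, h5⟩
        simp [Expr.eval, h2, h5 0 (by omega) (by omega)])
      (by
        rintro k s1 hk ⟨h1, h2, h3, h4, h5⟩
        obtain ⟨s2, T, h, hT, harr, hval, hreg⟩ := hp (d + 2) s1
        have e0 : s1.reg 0 = s.reg 0 := h5 0 (by omega) (by omega)
        have e1 : (fun j => s1.reg (2 * j + 1)) = Function.update env i k := by
          funext j
          by_cases hj : j = i
          · subst hj; simp [h2]
          · rw [Function.update_of_ne hj]
            exact h5 _ (by omega) (by omega)
        rw [e0] at hT hval
        rw [e1, h1] at hval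
        refine ⟨_, _, Runs.seq h (Runs.seq (Runs.setReg _ _ _) (Runs.setReg _ _ _)), ?_, ?_⟩
        · simp only [Expr.cost]
          omega
        · refine ⟨by simp [harr, h1], ?_, ?_, ?_, ?_⟩
          · simp only [Function.update_self, Expr.eval]
            rw [Function.update_of_ne (by omega), hreg _ (by omega), h2]
          · simp only
            rw [Function.update_of_ne (by omega), Function.update_of_ne (by omega),
              hreg _ (by omega), h3]
          · simp only [Expr.eval]
            rw [Function.update_of_ne (by omega), Function.update_self, Finset.sum_range_succ,
              hreg _ (by omega), h4, hval]
          · intro j hj hj'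
            simp only
            rw [Function.update_of_ne (by omega), Function.update_of_ne (by omega),
              hreg _ (by omega), h5 _ hj hj'])
      (s.reg 0) 0
      { s with reg := Function.update (Function.update (Function.update s.reg (2 * d + 2) 0)
          (2 * (d + 1) + 2) (Function.update s.reg (2 * d + 2) 0 (2 * i + 1))) (2 * i + 1) 0 }
      (by omega)
      (by
        refine ⟨rfl, by simp, ?_, ?_, ?_⟩
        · simp only
          rw [Function.update_of_ne (by omega), Function.update_self,
            Function.update_of_ne (by omega)]
        · simp only
          rw [Function.update_of_ne (by omega), Function.update_of_ne (by omega),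
            Function.update_self]
          simp
        · intro j hj hj'
          simp only
          rw [Function.update_of_ne (by omega), Function.update_of_ne (by omega),
            Function.update_of_ne (by omega)])
    obtain ⟨h1, h2, h3, h4, h5⟩ := hI
    refine ⟨_, _, Runs.seq (Runs.setReg _ _ _) (Runs.seq (Runs.setReg _ _ _)
      (Runs.seq (Runs.setReg _ _ _) (Runs.seq hrun (Runs.setReg _ _ _)))), ?_, ?_, ?_, ?_⟩
    · simp only [Expr.cost, Polynomial.eval_add, Polynomial.eval_mul, Polynomial.eval_X,
        Polynomial.eval_one, Polynomial.eval_ofNat] at hT ⊢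
      have : (s.reg 0 + 1) * (1 + 1 + 1 + 1 + (p.eval (s.reg 0) + 8))
        = (s.reg 0 + 1) * (p.eval (s.reg 0) + 12) := by ring
      omega
    · simpa using h1
    · simp only
      rw [Function.update_of_ne (by omega), h4]
      rfl
    · intro j hj
      simp only [Expr.eval]
      by_cases hji : j = 2 * i + 1
      · subst hji; simp [h3]
      · rw [Function.update_of_ne hji, h5 j hji hj]

/-- Statements: assignments to table cells, and loops of length `N`. -/
inductive St : Type
  | put (a : ℕ) (index t : Tm) : St
  | seq (c d : St) : St
  | forLoop (i : ℕ) (c : St) : St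

/-- The effect of a statement on the tables. -/
def St.run (N : ℕ) : St → (ℕ → ℕ) → (ℕ → ℕ → ℕ) → (ℕ → ℕ → ℕ)
  | .put a index t, env, A =>
      Function.update A a (Function.update (A a) (index.eval N A env) (t.eval N A env))
  | .seq c d, env, A => d.run N env (c.run N env A)
  | .forLoop i c, env, A => Nat.rec A (fun k A' => c.run N (Function.update env i k) A') N

/-- The program of a statement; the registers `2 * j + 2` with `j < d` are preserved. -/
def St.comp : St → ℕ → Program
  | .put a index t, d => .seq (index.comp d) (.seq (t.comp (d + 1))
      (.setArr a (.reg (2 * d + 2)) (.reg (2 * (d + 1) + 2))))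
  | .seq c d, e => .seq (c.comp e) (d.comp e)
  | .forLoop i c, d =>
      .seq (.setReg (2 * d + 2) (.reg (2 * i + 1))) <|
      .seq (.setReg (2 * i + 1) (.const 0)) <|
      .seq (.loop (.sub (.reg 0) (.reg (2 * i + 1)))
        (.seq (c.comp (d + 1))
            (.setReg (2 * i + 1) (.add (.reg (2 * i + 1)) (.const 1))))) <|
      .setReg (2 * i + 1) (.reg (2 * d + 2))

theorem St.comp_spec (c : St) : ∃ p : Polynomial ℕ, ∀ (d : ℕ) (s : Memory), ∃ s' T,
    Runs (c.comp d) s s' T ∧ T ≤ p.eval (s.reg 0) ∧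
    s'.arr = c.run (s.reg 0) (fun i => s.reg (2 * i + 1)) s.arr ∧
    ∀ j, (j % 2 = 1 ∨ j < 2 * d + 2) → s'.reg j = s.reg j := by
  induction c with
  | put a index t =>
    obtain ⟨p, hp⟩ := index.comp_spec
    obtain ⟨q, hq⟩ := t.comp_spec
    refine ⟨p + (q + 3), fun d s => ?_⟩
    obtain ⟨s', T, h, hT, harr, hval, hreg⟩ := hp d s
    obtain ⟨s'', T', h', hT', harr', hval', hreg'⟩ := hq (d + 1) s'
    have e0 : s'.reg 0 = s.reg 0 := hreg 0 (by omega)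
    have e1 : (fun i => s'.reg (2 * i + 1)) = fun i => s.reg (2 * i + 1) := by
      funext i
      exact hreg _ (by omega)
    rw [e0] at hT' hval'
    rw [e1, harr] at hval'
    refine ⟨_, _, Runs.seq h (Runs.seq h' (Runs.setArr _ _ _ _)), ?_, ?_, ?_⟩
    · simp only [Expr.cost, Polynomial.eval_add, Polynomial.eval_ofNat]
      omega
    · simp only [Expr.eval, hval', St.run, harr', harr]
      rw [hreg' _ (by omega), hval]
    · intro j hj
      rw [← hreg j hj, ← hreg' j (by omega)]
  | seq c d ihc ihd =>
    obtain ⟨p, hp⟩ := ihc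
    obtain ⟨q, hq⟩ := ihd
    refine ⟨p + q, fun d s => ?_⟩
    obtain ⟨s', T, h, hT, harr, hreg⟩ := hp d s
    obtain ⟨s'', T', h', hT', harr', hreg'⟩ := hq d s'
    have e0 : s'.reg 0 = s.reg 0 := hreg 0 (by omega)
    have e1 : (fun i => s'.reg (2 * i + 1)) = fun i => s.reg (2 * i + 1) := by
      funext i
      exact hreg _ (by omega)
    rw [e0] at hT' harr'
    rw [e1, harr] at harr'
    refine ⟨_, _, Runs.seq h h', by simp only [Polynomial.eval_add]; omega, harr', ?_⟩
    intro j hj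
    rw [← hreg j hj, ← hreg' j hj]
  | forLoop i c ih =>
    obtain ⟨p, hp⟩ := ih
    refine ⟨(Polynomial.X + 1) * (p + 8) + 8, fun d s => ?_⟩
    let env : ℕ → ℕ := fun j => s.reg (2 * j + 1)
    let I : ℕ → Memory → Prop := fun k s' =>
      s'.arr = Nat.rec s.arr (fun k A' => c.run (s.reg 0) (Function.update env i k) A') k ∧
      s'.reg (2 * i + 1) = k ∧ s'.reg (2 * d + 2) = s.reg (2 * i + 1) ∧
      ∀ j, j ≠ 2 * i + 1 → (j % 2 = 1 ∨ j < 2 * d + 2) → s'.reg j = s.reg j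
    obtain ⟨s', T, hrun, hT, hI⟩ := Runs.counting_loop (c := .seq (c.comp (d + 1))
            (.setReg (2 * i + 1) (.add (.reg (2 * i + 1)) (.const 1))))
        (e := .sub (.reg 0) (.reg (2 * i + 1))) I (s.reg 0) (p.eval (s.reg 0) + 4)
      (by
        rintro k s' hk ⟨-, h2, -, h5⟩
        simp [Expr.eval, h2, h5 0 (by omega) (by omega)])
      (by
        rintro k s1 hk ⟨h1, h2, h3, h5⟩
        obtain ⟨s2, T, h, hT, harr, hreg⟩ := hp (d + 1) s1
        have e0 : s1.reg 0 = s.reg 0 := h5 0 (by omega) (by omega)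
        have e1 : (fun j => s1.reg (2 * j + 1)) = Function.update env i k := by
          funext j
          by_cases hj : j = i
          · subst hj; simp [h2]
          · rw [Function.update_of_ne hj]
            exact h5 _ (by omega) (by omega)
        rw [e0] at hT harr
        rw [e1, h1] at harr
        refine ⟨_, _, Runs.seq h (Runs.setReg _ _ _), ?_, ?_⟩
        · simp only [Expr.cost]
          omega
        · refine ⟨harr, ?_, ?_, ?_⟩
          · simp only [Function.update_self, Expr.eval]
            rw [hreg _ (by omega), h2]
          · simp only
            rw [Function.update_of_ne (by omega), hreg _ (by omega), h3]
          · intro j hj hj'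
            simp only
            rw [Function.update_of_ne (by omega), hreg _ (by omega), h5 _ hj hj'])
      (s.reg 0) 0
      { s with reg := (Function.update (Function.update s.reg (2 * d + 2) (s.reg (2 * i + 1)))
          (2 * i + 1) 0) } (by omega)
      (by
        refine ⟨rfl, by simp, ?_, ?_⟩
        · simp only
          rw [Function.update_of_ne (by omega), Function.update_self]
        · intro j hj hj'
          simp only
          rw [Function.update_of_ne (by omega), Function.update_of_ne (by omega)])
    obtain ⟨h1, h2, h3, h5⟩ := hI
    refine ⟨_, _, Runs.seq (Runs.setReg _ _ _) (Runs.seq (Runs.setReg _ _ _)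
      (Runs.seq hrun (Runs.setReg _ _ _))), ?_, h1, ?_⟩
    · simp only [Expr.cost, Polynomial.eval_add, Polynomial.eval_mul, Polynomial.eval_X,
        Polynomial.eval_one, Polynomial.eval_ofNat] at hT ⊢
      have : (s.reg 0 + 1) * (1 + 1 + 1 + 1 + (p.eval (s.reg 0) + 4))
        = (s.reg 0 + 1) * (p.eval (s.reg 0) + 8) := by ring
      omega
    · intro j hj
      simp only [Expr.eval]
      by_cases hji : j = 2 * i + 1
      · subst hji; simp [h3]
      · rw [Function.update_of_ne hji, h5 j hji hj]

/-! ### Tables indexed by tuples -/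

/-- The number with the digits `l` in base `N`. -/
def code (N : ℕ) (l : List ℕ) : ℕ := l.foldl (fun c x => c * N + x) 0

theorem code_append (N : ℕ) (l : List ℕ) (x : ℕ) : code N (l ++ [x]) = code N l * N + x := by
  simp [code]

theorem code_lt {N : ℕ} : ∀ {l : List ℕ}, (∀ x ∈ l, x < N) → code N l < N ^ l.length := by
  intro l
  induction l using List.reverseRecOn with
  | nil => simp [code]
  | append_singleton l x ih =>
    intro h
    rw [code_append, List.length_append, List.length_singleton, pow_succ]
    have h1 := ih fun y hy => h y (by simp [hy])
    have h2 := h x (by simp)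
    calc code N l * N + x < code N l * N + N := by omega
      _ = (code N l + 1) * N := by ring
      _ ≤ _ := Nat.mul_le_mul_right _ h1

/-- Uniqueness of the digits in base `N`; it guarantees that the cells of different tuples do not
collide. -/
theorem code_injective {N : ℕ} : ∀ {l l' : List ℕ}, l.length = l'.length → (∀ x ∈ l, x < N) →
    (∀ x ∈ l', x < N) → code N l = code N l' → l = l' := by
  intro l
  induction l using List.reverseRecOn with
  | nil =>
    intro l' h _ _ _
    exact (List.length_eq_zero_iff.1 h.symm).symm
  | append_singleton l x ih =>
    intro l' hlen h h' hc
    rcases List.eq_nil_or_concat l' with rfl | ⟨l'', y, rfl⟩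
    · simp at hlen
    · rw [List.concat_eq_append] at *
      rw [code_append, code_append] at hc
      have hx := h x (by simp)
      have hy := h' y (by simp)
      have e1 : code N l = code N l'' := by
        have := congrArg (· / N) hc
        simpa [Nat.add_div_of_dvd_right, Nat.div_eq_of_lt, hx, hy, Nat.mul_comm _ N,
          Nat.mul_add_div (by omega : 0 < N)] using this
      have e2 : x = y := by rw [e1] at hc; omega
      rw [e2, ih (by simpa using hlen) (fun z hz => h z (by simp [hz]))
        (fun z hz => h' z (by simp [hz])) e1]

/-- Array `7` is a table of the multiples of `N`. -/
def HasMultiples (N : ℕ) (A : ℕ → ℕ → ℕ) : Prop := ∀ i < N ^ 6, A 7 i = i * N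

/-- The code of a tuple of variables. -/
def Tm.code (l : List ℕ) : Tm := l.foldl (fun c i => .add (.tab 7 c) (.var i)) (.const 0)

/-- Horner's scheme, with array `7` replacing the multiplication that the machine does not have. The
proper prefixes of a tuple have at most five digits, so their codes stay within the range of the
table. -/
theorem Tm.eval_code {N : ℕ} {A : ℕ → ℕ → ℕ} (hA : HasMultiples N A) {env : ℕ → ℕ} :
    ∀ {l : List ℕ}, l.length ≤ 6 → (∀ i ∈ l, env i < N) →
      (Tm.code l).eval N A env = BurlingRec.code N (l.map env) := by
  intro l
  induction l using List.reverseRecOn with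
  | nil => intros; rfl
  | append_singleton l x ih =>
    intro h h'
    have h1 := ih (by simp at h; omega) fun y hy => h' y (by simp [hy])
    have hx := h' x (by simp)
    have e : Tm.code (l ++ [x]) = .add (.tab 7 (Tm.code l)) (.var x) := by simp [Tm.code]
    rw [e, List.map_append, List.map_singleton, code_append]
    simp only [Tm.eval]
    rw [h1, hA]
    have h2 : BurlingRec.code N (l.map env) < N ^ (l.map env).length := code_lt (by
      intro y hy
      obtain ⟨i, hi, rfl⟩ := List.mem_map.1 hy
      exact h' i (by simp [hi]))
    refine h2.trans_le (Nat.pow_le_pow_right (by omega) ?_)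
    simp at h ⊢
    omega

/-- The arrays that a term reads. -/
def Tm.reads : Tm → List ℕ
  | .const _ => []
  | .var _ => []
  | .size => []
  | .tab a t => a :: t.reads
  | .add t u => t.reads ++ u.reads
  | .sub t u => t.reads ++ u.reads
  | .sum _ t => t.reads

theorem Tm.eval_congr {N : ℕ} {A B : ℕ → ℕ → ℕ} (t : Tm) (h : ∀ a ∈ t.reads, A a = B a)
    (env : ℕ → ℕ) : t.eval N A env = t.eval N B env := by
  induction t generalizing env with
  | const | var | size => rfl
  | tab a t ih =>
    simp only [Tm.reads, List.mem_cons, forall_eq_or_imp] at h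
    simp only [Tm.eval, h.1, ih h.2]
  | add t u iht ihu | sub t u iht ihu =>
    simp only [Tm.reads, List.mem_append] at h
    simp only [Tm.eval, iht fun a ha => h a (.inl ha), ihu fun a ha => h a (.inr ha)]
  | sum i t ih =>
    simp only [Tm.eval, ih h]

/-! ### Formulas -/

/-- First-order formulas with bounded quantifiers over relations that are stored in arrays. -/
inductive Fm : Type
  | rel (a : ℕ) (vs : List ℕ) : Fm
  | lt (i j : ℕ) : Fm
  | eq (i j : ℕ) : Fm
  | top (i : ℕ) : Fm
  | small (i : ℕ) : Fm
  | zero (i : ℕ) : Fm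
  | not (φ : Fm) : Fm
  | and (φ ψ : Fm) : Fm
  | or (φ ψ : Fm) : Fm
  | ex (i : ℕ) (φ : Fm) : Fm
  | all (i : ℕ) (φ : Fm) : Fm

/-- Truth of a formula. -/
def Fm.tr {N : ℕ} (I : ℕ → List (Fin N) → Prop) : Fm → (ℕ → Fin N) → Prop
  | .rel a vs, env => I a (vs.map env)
  | .lt i j, env => env i < env j
  | .eq i j, env => env i = env j
  | .top i, env => (env i : ℕ) = N - 2
  | .small i, env => (env i : ℕ) < N - 2
  | .zero i, env => (env i : ℕ) = 0
  | .not φ, env => ¬ φ.tr I env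
  | .and φ ψ, env => φ.tr I env ∧ ψ.tr I env
  | .or φ ψ, env => φ.tr I env ∨ ψ.tr I env
  | .ex i φ, env => ∃ k, φ.tr I (Function.update env i k)
  | .all i φ, env => ∀ k, φ.tr I (Function.update env i k)

/-- The characteristic function of a formula as a term. -/
def Fm.tm : Fm → Tm
  | .rel a vs => .sub (.const 1) (.sub (.const 1) (.tab a (Tm.code vs)))
  | .lt i j => .sub (.const 1) (.sub (.const 1) (.sub (.var j) (.var i)))
  | .eq i j => .sub (.const 1) (.add (.sub (.var j) (.var i)) (.sub (.var i) (.var j)))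
  | .top i => .sub (.const 1) (.add (.sub (.sub .size (.const 2)) (.var i))
      (.sub (.var i) (.sub .size (.const 2))))
  | .small i => .sub (.const 1) (.sub (.const 1) (.sub (.sub .size (.const 2)) (.var i)))
  | .zero i => .sub (.const 1) (.var i)
  | .not φ => .sub (.const 1) φ.tm
  | .and φ ψ => .sub (.const 1) (.add (.sub (.const 1) φ.tm) (.sub (.const 1) ψ.tm))
  | .or φ ψ => .sub (.const 1) (.sub (.const 1) (.add φ.tm ψ.tm))
  | .ex i φ => .sub (.const 1) (.sub (.const 1) (.sum i φ.tm))
  | .all i φ => .sub (.const 1) (.sum i (.sub (.const 1) φ.tm))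

/-- The relations stored in the tables. -/
def interp (N : ℕ) (A : ℕ → ℕ → ℕ) (a : ℕ) (l : List (Fin N)) : Prop :=
  A a (code N (l.map Fin.val)) ≠ 0

/-- The tuples in the formula have at most six entries. -/
def Fm.short : Fm → Bool
  | .rel _ vs => vs.length ≤ 6
  | .not φ => φ.short
  | .and φ ψ => φ.short && ψ.short
  | .or φ ψ => φ.short && ψ.short
  | .ex _ φ => φ.short
  | .all _ φ => φ.short
  | _ => true

open Classical in
theorem Tm.eval_sum {N : ℕ} {A : ℕ → ℕ → ℕ} (i : ℕ) (t : Tm) (env : ℕ → Fin N) :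
    (Tm.sum i t).eval N A (fun j => env j)
      = ∑ k : Fin N, t.eval N A (fun j => Function.update env i k j) := by
  simp only [Tm.eval]
  rw [Finset.sum_range]
  refine Finset.sum_congr rfl fun k _ => ?_
  congr 1
  funext j
  by_cases h : j = i
  · subst h; simp
  · simp [h]

-- Truncated subtraction supplies the logic: `1 - a` negates a truth value and `1 - (1 - a)` cuts
-- any number down to a truth value, which turns bounded sums into existential quantifiers.
open Classical in
theorem Fm.eval_tm {N : ℕ} {A : ℕ → ℕ → ℕ} (hA : HasMultiples N A) (φ : Fm) (hφ : φ.short = true)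
    (env : ℕ → Fin N) :
    φ.tm.eval N A (fun i => env i) = if φ.tr (interp N A) env then 1 else 0 := by
  induction φ generalizing env with
  | rel a vs =>
    have hc := Tm.eval_code hA (env := fun i => env i) (l := vs) (by simpa [Fm.short] using hφ)
      (fun i _ => (env i).2)
    simp only [Fm.tm, Tm.eval, hc, Fm.tr, interp, List.map_map]
    have : (Fin.val ∘ env) = fun i => (env i : ℕ) := rfl
    rw [this]
    split_ifs <;> omega
  | lt i j =>
    simp only [Fm.tm, Tm.eval, Fm.tr, Fin.lt_def]
    split_ifs <;> omega
  | eq i j =>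
    simp only [Fm.tm, Tm.eval, Fm.tr, Fin.ext_iff]
    split_ifs <;> omega
  | top i =>
    by_cases h : (Fm.top i).tr (interp N A) env
    · rw [if_pos h]
      simp only [Fm.tm, Tm.eval, Fm.tr] at h ⊢
      omega
    · rw [if_neg h]
      simp only [Fm.tm, Tm.eval, Fm.tr] at h ⊢
      omega
  | small i =>
    by_cases h : (Fm.small i).tr (interp N A) env
    · rw [if_pos h]
      simp only [Fm.tm, Tm.eval, Fm.tr] at h ⊢
      omega
    · rw [if_neg h]
      simp only [Fm.tm, Tm.eval, Fm.tr] at h ⊢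
      omega
  | zero i =>
    by_cases h : (Fm.zero i).tr (interp N A) env
    · rw [if_pos h]
      simp only [Fm.tm, Tm.eval, Fm.tr] at h ⊢
      omega
    · rw [if_neg h]
      simp only [Fm.tm, Tm.eval, Fm.tr] at h ⊢
      omega
  | not φ ih =>
    have h := ih hφ env
    simp only [Fm.tm, Tm.eval, Fm.tr, h]
    split_ifs <;> simp_all
  | and φ ψ ih ih' =>
    simp only [Fm.short, Bool.and_eq_true] at hφ
    simp only [Fm.tm, Tm.eval, Fm.tr, ih hφ.1, ih' hφ.2]
    split_ifs <;> simp_all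
  | or φ ψ ih ih' =>
    simp only [Fm.short, Bool.and_eq_true] at hφ
    simp only [Fm.tm, Tm.eval, Fm.tr, ih hφ.1, ih' hφ.2]
    split_ifs <;> simp_all
  | ex i φ ih =>
    have e : (Fm.ex i φ).tm.eval N A (fun i => env i)
      = 1 - (1 - (Tm.sum i φ.tm).eval N A (fun i => env i)) := rfl
    rw [e, Tm.eval_sum]
    simp only [ih hφ]
    by_cases h : (Fm.ex i φ).tr (interp N A) env
    · rw [if_pos h]
      obtain ⟨k, hk⟩ := h
      have : 0 < ∑ k : Fin N, if φ.tr (interp N A) (Function.update env i k) then 1 else 0 :=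
        Finset.sum_pos' (by simp) ⟨k, Finset.mem_univ _, by simp [hk]⟩
      omega
    · rw [if_neg h]
      simp only [Fm.tr, not_exists] at h
      simp [h]
  | all i φ ih =>
    have e : (Fm.all i φ).tm.eval N A (fun i => env i)
      = 1 - ((Tm.sum i (.sub (.const 1) φ.tm)).eval N A (fun i => env i)) := rfl
    rw [e, Tm.eval_sum]
    simp only [Tm.eval, ih hφ]
    by_cases h : (Fm.all i φ).tr (interp N A) env
    · rw [if_pos h]
      simp only [Fm.tr] at h
      simp [h]
    · rw [if_neg h]
      simp only [Fm.tr, not_forall] at h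
      obtain ⟨k, hk⟩ := h
      have : 0 < ∑ k : Fin N, (1 - if φ.tr (interp N A) (Function.update env i k) then 1 else 0) :=
        Finset.sum_pos' (by simp) ⟨k, Finset.mem_univ _, by simp [hk]⟩
      omega

/-- The arrays that a formula reads. -/
def Fm.reads : Fm → List ℕ
  | .rel a _ => [a]
  | .not φ => φ.reads
  | .and φ ψ => φ.reads ++ ψ.reads
  | .or φ ψ => φ.reads ++ ψ.reads
  | .ex _ φ => φ.reads
  | .all _ φ => φ.reads
  | _ => []

theorem Fm.tr_congr {N : ℕ} {I J : ℕ → List (Fin N) → Prop} (φ : Fm)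
    (h : ∀ a ∈ φ.reads, ∀ l, I a l ↔ J a l) (env : ℕ → Fin N) : φ.tr I env ↔ φ.tr J env := by
  induction φ generalizing env with
  | rel a vs => exact h a (by simp [Fm.reads]) _
  | lt | eq | top | small | zero => rfl
  | not φ ih => simp only [Fm.tr, ih h]
  | and φ ψ ih ih' | or φ ψ ih ih' =>
    simp only [Fm.reads, List.mem_append] at h
    simp only [Fm.tr, ih fun a ha => h a (.inl ha), ih' fun a ha => h a (.inr ha)]
  | ex i φ ih | all i φ ih => simp only [Fm.tr, ih h]

/-- Relation `a` occurs only with `k` arguments and only positively (if `b` holds) or only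
negatively (otherwise). -/
def Fm.polarity (a k : ℕ) : Bool → Fm → Bool
  | b, .rel a' vs => a' != a || (b && vs.length == k)
  | b, .not φ => φ.polarity a k (!b)
  | b, .and φ ψ => φ.polarity a k b && ψ.polarity a k b
  | b, .or φ ψ => φ.polarity a k b && ψ.polarity a k b
  | b, .ex _ φ => φ.polarity a k b
  | b, .all _ φ => φ.polarity a k b
  | _, _ => true

/-- Negation exchanges the polarities, so both halves need one common induction. Only tuples of
length `k` matter because `Fm.polarity` also checks the arity of the occurrences. -/
theorem Fm.tr_mono {N a k : ℕ} {I J : ℕ → List (Fin N) → Prop}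
    (h : ∀ a', a' ≠ a → ∀ l, I a' l ↔ J a' l) (h' : ∀ l, l.length = k → I a l → J a l) (φ : Fm) :
    (φ.polarity a k true = true → ∀ env, φ.tr I env → φ.tr J env) ∧
    (φ.polarity a k false = true → ∀ env, φ.tr J env → φ.tr I env) := by
  induction φ with
  | rel a' vs =>
    by_cases ha : a' = a
    · subst ha
      simp only [Fm.polarity, Fm.tr]
      refine ⟨fun hk env => h' _ (by simpa using hk), by simp⟩
    · exact ⟨fun _ env => (h a' ha _).1, fun _ env => (h a' ha _).2⟩
  | lt | eq | top | small | zero => exact ⟨fun _ _ h => h, fun _ _ h => h⟩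
  | not φ ih =>
    exact ⟨fun hp env ht hf => ht (ih.2 hp env hf), fun hp env ht hf => ht (ih.1 hp env hf)⟩
  | and φ ψ ih ih' =>
    simp only [Fm.polarity, Bool.and_eq_true, Fm.tr]
    exact ⟨fun hp env ht => ⟨ih.1 hp.1 env ht.1, ih'.1 hp.2 env ht.2⟩,
      fun hp env ht => ⟨ih.2 hp.1 env ht.1, ih'.2 hp.2 env ht.2⟩⟩
  | or φ ψ ih ih' =>
    simp only [Fm.polarity, Bool.and_eq_true, Fm.tr]
    exact ⟨fun hp env ht => ht.imp (ih.1 hp.1 env) (ih'.1 hp.2 env),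
      fun hp env ht => ht.imp (ih.2 hp.1 env) (ih'.2 hp.2 env)⟩
  | ex i φ ih =>
    exact ⟨fun hp env ⟨m, hm⟩ => ⟨m, ih.1 hp _ hm⟩, fun hp env ⟨m, hm⟩ => ⟨m, ih.2 hp _ hm⟩⟩
  | all i φ ih =>
    exact ⟨fun hp env hm m => ih.1 hp _ (hm m), fun hp env hm m => ih.2 hp _ (hm m)⟩

/-- The iterates increase, and as long as they are not stable each step adds an element. A number of
rounds known in advance thus replaces a test for convergence. -/
theorem iterate_empty_stable {α : Type*} [Finite α] {f : Set α → Set α} (hf : Monotone f)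
    {m : ℕ} (hm : Nat.card α ≤ m) : f (f^[m] ∅) = f^[m] ∅ := by
  have hmono : ∀ j, f^[j] ∅ ⊆ f^[j + 1] ∅ := by
    intro j
    induction j with
    | zero => exact Set.empty_subset _
    | succ j ih =>
      rw [Function.iterate_succ_apply', Function.iterate_succ_apply' f (j + 1)]
      exact hf ih
  have key : ∀ j, f (f^[j] ∅) = f^[j] ∅ ∨ j + 1 ≤ (f^[j + 1] ∅ : Set α).ncard := by
    intro j
    induction j with
    | zero =>
      by_cases h : f (f^[0] ∅) = f^[0] ∅
      · exact .inl h
      · right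
        have h1 : (f^[0 + 1] ∅ : Set α).Nonempty := by
          rw [Set.nonempty_iff_ne_empty]
          exact h
        have := (Set.ncard_pos (Set.toFinite _)).2 h1
        omega
    | succ j ih =>
      rcases ih with ih | ih
      · left
        rw [Function.iterate_succ_apply', ih, ih]
      · by_cases h : f (f^[j + 1] ∅) = f^[j + 1] ∅
        · exact .inl h
        · right
          have h1 : f^[j + 1] ∅ ⊂ f^[j + 1 + 1] ∅ := by
            refine (hmono _).ssubset_of_ne fun e => h ?_
            rw [← Function.iterate_succ_apply' f]
            exact e.symm
          have := Set.ncard_lt_ncard h1 (Set.toFinite _)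
          omega
  rcases key m with h | h
  · exact h
  · have := Set.ncard_le_card (f^[m + 1] ∅ : Set α)
    omega

/-! ### Filling tables and computing least fixed points -/

/-- `k` nested loops over the variables `0, …, k - 1`. -/
def St.loops : ℕ → St → St
  | 0, c => c
  | k + 1, c => .forLoop k (St.loops k c)

/-- Write the values of a term into a table with `k` arguments. -/
def St.fill (a k : ℕ) (t : Tm) : St := St.loops k (.put a (Tm.code (List.range k)) t)

/-- Nested loops serve here merely to repeat the body `N ^ k` times. The values of the loop
variables are irrelevant, so the hypothesis on the body admits every assignment that vanishes from
`K` on. -/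
theorem St.run_loops_induction {N : ℕ} (P : ℕ → (ℕ → ℕ → ℕ) → Prop) {K : ℕ} (c : St)
    (h : ∀ j A env, (∀ i, K ≤ i → env i = 0) → P j A → P (j + 1) (c.run N env A)) :
    ∀ k, k ≤ K → ∀ j A env, (∀ i, K ≤ i → env i = 0) → P j A →
      P (j + N ^ k) ((St.loops k c).run N env A) := by
  intro k
  induction k with
  | zero =>
    intro hk j A env he hP
    simpa [St.loops] using h j A env he hP
  | succ k ih =>
    intro hk j A env he hP
    have key : ∀ m, P (j + m * N ^ k) (Nat.rec A (fun x A' =>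
        (St.loops k c).run N (Function.update env k x) A') m) := by
      intro m
      induction m with
      | zero => simpa using hP
      | succ m ihm =>
        have := ih (by omega) _ _ (Function.update env k m) (by
          intro i hi
          rw [Function.update_of_ne (by omega)]
          exact he i hi) ihm
        convert this using 1
        ring
    have e : j + N ^ (k + 1) = j + N * N ^ k := by rw [pow_succ]; ring
    rw [e]
    exact key N

theorem map_range_injective {k : ℕ} {e e' : ℕ → ℕ}
    (h : (List.range k).map e = (List.range k).map e') : ∀ i < k, e i = e' i := by
  intro i hi
  have := congrArg (fun l => l[i]?) h
  simpa [hi] using this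

/-- The last clause, on cells that are not addressed, carries the induction: another value of
variable `j` gives another code, so later rounds do not overwrite earlier entries. Since `t` does
not read table `a`, its value is not affected while that table changes. -/
theorem St.run_loops_put {N a k : ℕ} {t : Tm} (hk : k ≤ 6) (ha : a ≠ 7) (hat : a ∉ t.reads) :
    ∀ j ≤ k, ∀ (A : ℕ → ℕ → ℕ) (env : ℕ → ℕ), HasMultiples N A →
      (∀ i, j ≤ i → i < k → env i < N) →
      let A' := (St.loops j (.put a (Tm.code (List.range k)) t)).run N env A
      (∀ b, b ≠ a → A' b = A b) ∧
      (∀ env', (∀ i, j ≤ i → env' i = env i) → (∀ i < j, env' i < N) →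
        A' a (code N ((List.range k).map env')) = t.eval N A env') ∧
      (∀ c, (∀ env', (∀ i, j ≤ i → env' i = env i) → (∀ i < j, env' i < N) →
        c ≠ code N ((List.range k).map env')) → A' a c = A a c) := by
  intro j
  induction j with
  | zero =>
    intro _ A env hA henv
    have hc := Tm.eval_code hA (env := env) (l := List.range k) (by simpa using hk)
      (fun i hi => henv i (by omega) (by simpa using hi))
    refine ⟨fun b hb => ?_, fun env' h1 _ => ?_, fun c h1 => ?_⟩
    · simp [St.loops, St.run, hb]
    · have : env' = env := funext fun i => h1 i (by omega)
      subst this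
      simp [St.loops, St.run, hc]
    · have := h1 env (fun _ _ => rfl) (by simp)
      simp [St.loops, St.run, hc, this]
  | succ j ih =>
    intro hjk A env hA henv
    have hmem : ∀ env' : ℕ → ℕ, (∀ i, j + 1 ≤ i → env' i = env i) → (∀ i < j + 1, env' i < N) →
        ∀ x ∈ (List.range k).map env', x < N := by
      intro env' h1 h2 x hx
      obtain ⟨i, hi, rfl⟩ := List.mem_map.1 hx
      rw [List.mem_range] at hi
      by_cases hij : i < j + 1
      · exact h2 i hij
      · rw [h1 i (by omega)]
        exact henv i (by omega) hi
    let B : ℕ → ℕ → ℕ → ℕ := fun m => Nat.rec A (fun x A' =>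
        (St.loops j (.put a (Tm.code (List.range k)) t)).run N (Function.update env j x) A') m
    have key : ∀ m ≤ N, (∀ b, b ≠ a → B m b = A b) ∧
      (∀ env', (∀ i, j + 1 ≤ i → env' i = env i) → (∀ i < j + 1, env' i < N) → env' j < m →
        B m a (code N ((List.range k).map env')) = t.eval N A env') ∧
      (∀ c, (∀ env', (∀ i, j + 1 ≤ i → env' i = env i) → (∀ i < j + 1, env' i < N) → env' j < m →
        c ≠ code N ((List.range k).map env')) → B m a c = A a c) := by
      intro m
      induction m with
      | zero => exact fun _ => ⟨fun _ _ => rfl, fun _ _ _ h => absurd h (by omega), fun _ _ => rfl⟩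
      | succ m ihm =>
        intro hm
        obtain ⟨i1, i2, i3⟩ := ihm (by omega)
        obtain ⟨r1, r2, r3⟩ := ih (by omega) (B m) (Function.update env j m)
          (by intro i hi; rw [i1 7 ha.symm]; exact hA i hi)
          (by
            intro i hi hik
            by_cases hij : i = j
            · subst hij; simpa using hm
            · rw [Function.update_of_ne hij]
              exact henv i (by omega) hik)
        have hB : B (m + 1) = (St.loops j (.put a (Tm.code (List.range k)) t)).run N
          (Function.update env j m) (B m) := rfl
        rw [← hB] at r1 r2 r3
        have hupd : ∀ env' : ℕ → ℕ, (∀ i, j ≤ i → env' i = Function.update env j m i) →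
            (∀ i, j + 1 ≤ i → env' i = env i) ∧ env' j = m := by
          intro env' h
          refine ⟨fun i hi => ?_, by simpa using h j le_rfl⟩
          rw [h i (by omega), Function.update_of_ne (by omega)]
        refine ⟨fun b hb => by rw [r1 b hb, i1 b hb], fun env' h1 h2 h3 => ?_, fun c hc => ?_⟩
        · by_cases hm' : env' j = m
          · rw [r2 env' ?_ fun i hi => h2 i (by omega)]
            · refine t.eval_congr (fun b hb => i1 b ?_) _
              rintro rfl
              exact hat hb
            · intro i hi
              by_cases hij : i = j
              · subst hij; simp [hm']
              · rw [Function.update_of_ne hij]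
                exact h1 i (by omega)
          · rw [r3, i2 env' h1 h2 (by omega)]
            intro env'' h1' h2' he
            obtain ⟨h3', h4'⟩ := hupd env'' h1'
            have := map_range_injective (code_injective (by simp) (hmem env' h1 h2)
              (hmem env'' h3' (by
                intro i hi
                by_cases hij : i = j
                · subst hij; omega
                · exact h2' i (by omega))) he) j (by omega)
            omega
        · rw [r3, i3]
          · exact fun env' h1 h2 h3 => hc env' h1 h2 (by omega)
          · intro env' h1 h2
            obtain ⟨h3, h4⟩ := hupd env' h1
            exact hc env' h3 (by
                intro i hi
                by_cases hij : i = j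
                · subst hij; omega
                · exact h2 i (by omega)) (by omega)
    obtain ⟨k1, k2, k3⟩ := key N le_rfl
    exact ⟨k1, fun env' h1 h2 => k2 env' h1 h2 (h2 j (by omega)),
      fun c hc => k3 c fun env' h1 h2 _ => hc env' h1 h2⟩

/-- The assignment given by a tuple. -/
def tupleEnv {N : ℕ} [NeZero N] (l : List (Fin N)) (i : ℕ) : Fin N := l.getD i 0

theorem map_tupleEnv {N : ℕ} [NeZero N] (l : List (Fin N)) :
    (List.range l.length).map (fun i => (tupleEnv l i : ℕ)) = l.map Fin.val := by
  apply List.ext_getElem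
  · simp
  · intro i h1 h2
    simp only [List.length_map] at h2
    simp [tupleEnv, h2]

theorem St.run_fill {N a k : ℕ} [NeZero N] {t : Tm} (hk : k ≤ 6) (ha : a ≠ 7) (hat : a ∉ t.reads)
    {A : ℕ → ℕ → ℕ} {env : ℕ → ℕ} (hA : HasMultiples N A) (henv : ∀ i, k ≤ i → env i = 0) :
    (∀ b, b ≠ a → (St.fill a k t).run N env A b = A b) ∧
    ∀ l : List (Fin N), l.length = k →
      (St.fill a k t).run N env A a (code N (l.map Fin.val))
        = t.eval N A (fun i => tupleEnv l i) := by
  obtain ⟨h1, h2, -⟩ := St.run_loops_put hk ha hat k le_rfl A env hA (by intros; omega)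
  refine ⟨h1, fun l hl => ?_⟩
  rw [← map_tupleEnv l, hl]
  refine h2 _ (fun i hi => ?_) fun i hi => (tupleEnv l i).2
  rw [henv i hi]
  simp [tupleEnv, List.getElem?_eq_none (by omega : l.length ≤ i)]

/-- A step of a computation: tabulate a term, or compute the least fixed point of a formula. -/
inductive Stage : Type
  | fill (a k : ℕ) (t : Tm) : Stage
  | lfp (a k : ℕ) (φ : Fm) : Stage

/-- The array that is written. -/
def Stage.target : Stage → ℕ
  | .fill a _ _ => a
  | .lfp a _ _ => a

/-- The arrays that are read. -/
def Stage.reads : Stage → List ℕ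
  | .fill _ _ t => t.reads
  | .lfp _ _ φ => φ.reads

/-- The statement for a step. Array `8` is a buffer. -/
def Stage.st : Stage → St
  | .fill a k t => .fill a k t
  | .lfp a k φ => .seq (.fill a k (.const 0)) (.loops k (.seq (.fill 8 k φ.tm)
      (.fill a k (.tab 8 (Tm.code (List.range k))))))

/-- What a step guarantees about the final tables. -/
def Stage.Holds (N : ℕ) [NeZero N] (A : ℕ → ℕ → ℕ) : Stage → Prop
  | .fill a k t => ∀ l : List (Fin N), l.length = k →
      A a (code N (l.map Fin.val)) = t.eval N A (fun i => tupleEnv l i)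
  | .lfp a k φ =>
      (∀ l : List (Fin N), l.length = k →
        (interp N A a l ↔ φ.tr (interp N A) (tupleEnv l))) ∧
      ∀ P : List (Fin N) → Prop,
        (∀ l, l.length = k → φ.tr (Function.update (interp N A) a P) (tupleEnv l) → P l) →
        ∀ l, l.length = k → interp N A a l → P l

/-- Side conditions on a step. -/
def Stage.ok : Stage → Bool
  | .fill a k t => k ≤ 6 && a != 7 && a != 8 && !t.reads.contains a && !t.reads.contains 8
  | .lfp a k φ => k ≤ 6 && a != 7 && a != 8 && !φ.reads.contains 8 && φ.short &&
      φ.polarity a k true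

theorem Tm.reads_code (l : List ℕ) : ∀ a ∈ (Tm.code l).reads, a = 7 := by
  induction l using List.reverseRecOn with
  | nil => simp [Tm.code, Tm.reads]
  | append_singleton l x ih =>
    have e : Tm.code (l ++ [x]) = .add (.tab 7 (Tm.code l)) (.var x) := by simp [Tm.code]
    rw [e]
    simpa [Tm.reads] using ih

theorem Fm.reads_tm (φ : Fm) : ∀ a ∈ φ.tm.reads, a = 7 ∨ a ∈ φ.reads := by
  induction φ with
  | rel a vs =>
    intro b hb
    simp only [Fm.tm, Tm.reads, List.nil_append, List.mem_cons] at hb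
    rcases hb with rfl | hb
    · right; simp [Fm.reads]
    · exact .inl (Tm.reads_code _ _ hb)
  | lt | eq | top | small | zero => intro b hb; simp [Fm.tm, Tm.reads] at hb
  | not φ ih | ex i φ ih | all i φ ih => simpa [Fm.tm, Tm.reads, Fm.reads] using ih
  | and φ ψ ih ih' | or φ ψ ih ih' =>
    intro b hb
    simp only [Fm.tm, Tm.reads, Fm.reads, List.nil_append, List.mem_append] at hb ⊢
    rcases hb with hb | hb
    · exact (ih b hb).imp id .inl
    · exact (ih' b hb).imp id .inr

theorem Stage.holds_congr {N : ℕ} [NeZero N] {A B : ℕ → ℕ → ℕ} (s : Stage)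
    (h : A s.target = B s.target) (h' : ∀ a ∈ s.reads, A a = B a) (hs : s.Holds N A) :
    s.Holds N B := by
  cases s with
  | fill a k t =>
    intro l hl
    rw [← t.eval_congr h', ← hs l hl]
    exact congrFun h.symm _
  | lfp a k φ =>
    have h1 : ∀ l, interp N A a l ↔ interp N B a l := fun l => by
      simp only [interp]
      rw [show A a = B a from h]
    refine ⟨fun l hl => ?_, fun P hP l hl hI => hs.2 P (fun l hl h2 => hP l hl ?_) l hl ((h1 l).2 hI)⟩
    · rw [← h1, hs.1 l hl]
      refine φ.tr_congr (fun b hb l => ?_) _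
      simp only [interp, h' b hb]
    · rwa [φ.tr_congr (I := Function.update (interp N B) a P)]
      intro b hb l
      by_cases hba : b = a
      · subst hba; simp
      · simp [hba, interp, h' b hb]

/-- The operator of `φ` is iterated from the empty relation `N ^ k` times, once for each tuple, so
`iterate_empty_stable` yields a fixed point. It is the least one because every iterate lies in each
relation that is closed under the operator. -/
theorem Stage.run_lfp {N a k : ℕ} [NeZero N] {φ : Fm} (hok : (Stage.lfp a k φ).ok = true)
    {A : ℕ → ℕ → ℕ} {env : ℕ → ℕ} (hA : HasMultiples N A) (henv : ∀ i, env i = 0) :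
    (∀ b, b ≠ a → b ≠ 8 → (Stage.lfp a k φ).st.run N env A b = A b) ∧
    (Stage.lfp a k φ).Holds N ((Stage.lfp a k φ).st.run N env A) := by
  simp only [Stage.ok, Bool.and_eq_true, decide_eq_true_eq, bne_iff_ne, ne_eq,
    Bool.not_eq_true', List.contains_eq_mem, decide_eq_false_iff_not] at hok
  obtain ⟨⟨⟨⟨⟨hk, ha7⟩, ha8⟩, h8⟩, hshort⟩, hpol⟩ := hok
  let J : Set (List.Vector (Fin N) k) → ℕ → List (Fin N) → Prop := fun S =>
    Function.update (interp N A) a (fun l => ∃ v ∈ S, v.1 = l)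
  let Φ : Set (List.Vector (Fin N) k) → Set (List.Vector (Fin N) k) := fun S =>
    {v | φ.tr (J S) (tupleEnv v.1)}
  have hJmono : ∀ (I I' : ℕ → List (Fin N) → Prop), (∀ b, b ≠ a → ∀ l, I b l ↔ I' b l) →
      (∀ l, l.length = k → I a l → I' a l) → ∀ env, φ.tr I env → φ.tr I' env :=
    fun I I' h1 h2 => (φ.tr_mono h1 h2).1 hpol
  have hΦ : Monotone Φ := by
    intro S T hST v hv
    refine hJmono (J S) (J T) (fun b hb l => ?_) (fun l _ => ?_) _ hv
    · simp [J, hb]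
    · simp only [J, Function.update_self]
      rintro ⟨v, hv, rfl⟩
      exact ⟨v, hST hv, rfl⟩
  let P : ℕ → (ℕ → ℕ → ℕ) → Prop := fun j B =>
    (∀ b, b ≠ a → b ≠ 8 → B b = A b) ∧
    ∀ v : List.Vector (Fin N) k, interp N B a v.1 ↔ v ∈ Φ^[j] ∅
  have hmult : ∀ j B, P j B → HasMultiples N B := by
    intro j B hB i hi
    rw [hB.1 7 (Ne.symm ha7) (by decide)]
    exact hA i hi
  have hI : ∀ j B, P j B → ∀ env, φ.tr (interp N B) env ↔ φ.tr (J (Φ^[j] ∅)) env := by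
    intro j B hB env
    have h1 : ∀ b, b ≠ a → b ∈ φ.reads → ∀ l, interp N B b l ↔ J (Φ^[j] ∅) b l := by
      intro b hb hb' l
      have : b ≠ 8 := by rintro rfl; exact h8 hb'
      simp [J, hb, interp, hB.1 b hb this]
    have h2 : ∀ l, l.length = k → (interp N B a l ↔ J (Φ^[j] ∅) a l) := by
      intro l hl
      have := hB.2 ⟨l, hl⟩
      simp only [J, Function.update_self]
      rw [this]
      exact ⟨fun h => ⟨_, h, rfl⟩, fun ⟨v, hv, e⟩ => by
        have : v = ⟨l, hl⟩ := Subtype.ext e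
        exact this ▸ hv⟩
    -- The current tables may differ from the initial ones at the buffer `8`, and table `a` is
    -- controlled only on tuples of length `k`. Relations that `φ` does not read are exchanged
    -- first; then monotonicity, applied in both directions, disposes of the other lengths.
    have e := φ.tr_congr (I := interp N B)
      (J := fun b l => if b ∈ φ.reads then interp N B b l else J (Φ^[j] ∅) b l)
      (fun b hb l => by simp [hb]) env
    rw [e]
    constructor
    · refine hJmono _ _ (fun b hb l => ?_) (fun l hl => ?_) env
      · by_cases hb' : b ∈ φ.reads <;> simp [hb']
        exact h1 b hb hb' l
      · by_cases hb' : a ∈ φ.reads <;> simp [hb']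
        exact (h2 l hl).1
    · refine hJmono _ _ (fun b hb l => ?_) (fun l hl => ?_) env
      · by_cases hb' : b ∈ φ.reads <;> simp [hb']
        exact (h1 b hb hb' l).symm
      · by_cases hb' : a ∈ φ.reads <;> simp [hb']
        exact (h2 l hl).2
  have hread : 8 ∉ φ.tm.reads := fun h => by
    rcases φ.reads_tm 8 h with h | h
    · omega
    · exact h8 h
  have hstep : ∀ j B env, (∀ i, k ≤ i → env i = 0) → P j B → P (j + 1)
      ((St.seq (.fill 8 k φ.tm) (.fill a k (.tab 8 (Tm.code (List.range k))))).run N env B) := by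
    intro j B env he hB
    have hBm := hmult j B hB
    obtain ⟨f1, f2⟩ := St.run_fill (t := φ.tm) hk (by decide : 8 ≠ 7) hread hBm he
    set B1 := (St.fill 8 k φ.tm).run N env B with hB1
    have hB1m : HasMultiples N B1 := by
      intro i hi
      rw [f1 7 (by decide)]
      exact hBm i hi
    obtain ⟨g1, g2⟩ := St.run_fill (a := a) (t := .tab 8 (Tm.code (List.range k))) hk ha7
      (by
        intro h
        simp only [Tm.reads, List.mem_cons] at h
        rcases h with h | h
        · exact ha8 h
        · exact ha7 (Tm.reads_code _ _ h)) hB1m he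
    refine ⟨fun b hb hb8 => ?_, fun v => ?_⟩
    · simp only [St.run]
      rw [g1 b hb, f1 b hb8, hB.1 b hb hb8]
    · rw [Function.iterate_succ_apply']
      simp only [interp, St.run]
      rw [← hB1, g2 v.1 v.2]
      simp only [Tm.eval]
      rw [Tm.eval_code hB1m (by simpa using hk) (fun i _ => (tupleEnv v.1 i).2)]
      have hmap : (List.range k).map (fun i => (tupleEnv v.1 i : ℕ)) = v.1.map Fin.val := by
        have := map_tupleEnv v.1
        rwa [v.2] at this
      rw [hmap, f2 v.1 v.2, Fm.eval_tm hBm φ hshort]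
      have := hI j B hB (tupleEnv v.1)
      simp only [Φ, Set.mem_ofPred_eq]
      rw [← this]
      split_ifs with h <;> simp [h]
  obtain ⟨z1, z2⟩ := St.run_fill (a := a) (t := .const 0) (env := env) hk ha7 (by simp [Tm.reads])
    hA (fun i _ => henv i)
  have hzero : P 0 ((St.fill a k (.const 0)).run N env A) := by
    refine ⟨fun b hb _ => z1 b hb, fun v => ?_⟩
    simp [interp, z2 v.1 v.2, Tm.eval]
  have hfin := St.run_loops_induction P _ hstep k le_rfl 0 _ env (fun i _ => henv i) hzero
  rw [zero_add] at hfin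
  have hrun : (Stage.lfp a k φ).st.run N env A = (St.loops k (.seq (.fill 8 k φ.tm)
      (.fill a k (.tab 8 (Tm.code (List.range k)))))).run N env
        ((St.fill a k (.const 0)).run N env A) := rfl
  rw [hrun]
  set B := (St.loops k (.seq (.fill 8 k φ.tm)
      (.fill a k (.tab 8 (Tm.code (List.range k)))))).run N env
        ((St.fill a k (.const 0)).run N env A) with hBdef
  refine ⟨hfin.1, fun l hl => ?_, fun Q hQ l hl hIl => ?_⟩
  · have hst : Φ (Φ^[N ^ k] ∅) = Φ^[N ^ k] ∅ := iterate_empty_stable hΦ (by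
      rw [Nat.card_eq_fintype_card, card_vector, Fintype.card_fin])
    rw [hI _ _ hfin, hfin.2 ⟨l, hl⟩]
    conv_lhs => rw [← hst]
    rfl
  · have hsub : ∀ j, ∀ v ∈ Φ^[j] ∅, Q v.1 := by
      intro j
      induction j with
      | zero => intro v hv; exact absurd hv (by simp)
      | succ j ih =>
        intro v hv
        rw [Function.iterate_succ_apply'] at hv
        refine hQ v.1 v.2 ?_
        have h0 : φ.tr (fun b l => if b ∈ φ.reads then Function.update (interp N B) a Q b l
            else J (Φ^[j] ∅) b l) (tupleEnv v.1) := by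
          refine hJmono _ _ (fun b hb l => ?_) (fun l hl => ?_) _ hv
          · by_cases hb' : b ∈ φ.reads <;> simp [hb']
            have : b ≠ 8 := by rintro rfl; exact h8 hb'
            simp [J, hb, interp, hfin.1 b hb this]
          · by_cases hb' : a ∈ φ.reads <;> simp [hb']
            simp only [J, Function.update_self]
            rintro ⟨w, hw, rfl⟩
            exact ih w hw
        rwa [φ.tr_congr (J := Function.update (interp N B) a Q)] at h0
        intro b hb l
        simp [hb]
    exact hsub _ ⟨l, hl⟩ ((hfin.2 ⟨l, hl⟩).1 hIl)

theorem Stage.run_st {N : ℕ} [NeZero N] {s : Stage} (hok : s.ok = true)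
    {A : ℕ → ℕ → ℕ} {env : ℕ → ℕ} (hA : HasMultiples N A) (henv : ∀ i, env i = 0) :
    (∀ b, b ≠ s.target → b ≠ 8 → s.st.run N env A b = A b) ∧ s.Holds N (s.st.run N env A) := by
  cases s with
  | lfp a k φ => exact Stage.run_lfp hok hA henv
  | fill a k t =>
    simp only [Stage.ok, Bool.and_eq_true, decide_eq_true_eq, bne_iff_ne, ne_eq,
      Bool.not_eq_true', List.contains_eq_mem, decide_eq_false_iff_not] at hok
    obtain ⟨⟨⟨⟨hk, ha7⟩, ha8⟩, ha⟩, h8⟩ := hok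
    obtain ⟨h1, h2⟩ := St.run_fill (env := env) hk ha7 ha hA (fun i _ => henv i)
    refine ⟨fun b hb _ => h1 b hb, fun l hl => ?_⟩
    refine (h2 l hl).trans (t.eval_congr (fun b hb => (h1 b ?_).symm) _)
    rintro rfl
    exact ha hb

/-- The statement for a list of steps. -/
def stagesSt : List Stage → St
  | [] => .put 8 (.const 0) (.const 0)
  | s :: rest => .seq s.st (stagesSt rest)

/-- No step reads or overwrites a table that is written later. -/
def stagesOk : List Stage → Bool
  | [] => true
  | s :: rest => s.ok && (s.target :: s.reads).all (fun a => !(rest.map Stage.target).contains a)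
      && stagesOk rest

/-- The guarantee of a step mentions only tables that the step reads or writes. By `stagesOk` no
later step writes any of these, so the guarantee persists to the end. -/
theorem stagesSt_spec {N : ℕ} [NeZero N] (L : List Stage) (hL : stagesOk L = true)
    {A : ℕ → ℕ → ℕ} {env : ℕ → ℕ} (hA : HasMultiples N A) (henv : ∀ i, env i = 0) :
    (∀ b, b ∉ L.map Stage.target → b ≠ 8 → (stagesSt L).run N env A b = A b) ∧
    ∀ s ∈ L, s.Holds N ((stagesSt L).run N env A) := by
  induction L generalizing A with
  | nil =>
    refine ⟨fun b _ hb => ?_, by simp⟩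
    simp [stagesSt, St.run, hb]
  | cons s rest ih =>
    simp only [stagesOk, Bool.and_eq_true, List.all_eq_true, Bool.not_eq_true',
      List.contains_eq_mem, decide_eq_false_iff_not, List.mem_cons, forall_eq_or_imp] at hL
    obtain ⟨⟨hs, hsr, hsr'⟩, hrest⟩ := hL
    obtain ⟨h1, h2⟩ := Stage.run_st hs hA henv
    have ht : s.target ≠ 7 ∧ s.target ≠ 8 ∧ 8 ∉ s.reads := by
      cases s <;> simp [Stage.ok] at hs <;> simp [Stage.target, Stage.reads] <;> tauto
    obtain ⟨i1, i2⟩ := ih hrest (A := s.st.run N env A) (by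
      intro i hi
      rw [h1 7 ht.1.symm (by decide)]
      exact hA i hi)
    refine ⟨fun b hb hb8 => ?_, fun s' hs' => ?_⟩
    · simp only [List.map_cons, List.mem_cons, not_or] at hb
      exact (i1 b hb.2 hb8).trans (h1 b hb.1 hb8)
    · rcases List.mem_cons.1 hs' with rfl | hs'
      · refine s'.holds_congr (A := s'.st.run N env A) (i1 _ hsr ht.2.1).symm
          (fun a ha => (i1 a (hsr' a ha) ?_).symm) h2
        rintro rfl
        exact ht.2.2 ha
      · exact i2 s' hs'

/-- Tabulate the multiples of `N` in array `7` and those of `N - 2` in array `5`. -/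
def multiplesSt : St :=
  .loops 6 <| .seq
    (.put 7 (.add (.tab 6 (.const 0)) (.const 1)) (.add (.tab 7 (.tab 6 (.const 0))) .size)) <|
    .seq (.put 5 (.add (.tab 6 (.const 0)) (.const 1))
      (.add (.tab 5 (.tab 6 (.const 0))) (.sub .size (.const 2))))
    (.put 6 (.const 0) (.add (.tab 6 (.const 0)) (.const 1)))

/-- Cell `0` of array `6` counts the rounds. Each round appends one entry to both tables by a single
addition, and six nested loops give `N ^ 6` rounds. -/
theorem multiplesSt_spec {N : ℕ} {A : ℕ → ℕ → ℕ} (h5 : A 5 = 0) (h6 : A 6 = 0) (h7 : A 7 = 0)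
    {env : ℕ → ℕ} (henv : ∀ i, env i = 0) :
    (∀ i ≤ N ^ 6, multiplesSt.run N env A 7 i = i * N ∧
      multiplesSt.run N env A 5 i = i * (N - 2)) ∧ multiplesSt.run N env A 0 = A 0 := by
  let P : ℕ → (ℕ → ℕ → ℕ) → Prop := fun j B =>
    B 6 0 = j ∧ (∀ i ≤ j, B 7 i = i * N ∧ B 5 i = i * (N - 2)) ∧ B 0 = A 0
  have := St.run_loops_induction (N := N) (K := 6) P (.seq
    (.put 7 (.add (.tab 6 (.const 0)) (.const 1)) (.add (.tab 7 (.tab 6 (.const 0))) .size)) <|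
    .seq (.put 5 (.add (.tab 6 (.const 0)) (.const 1))
      (.add (.tab 5 (.tab 6 (.const 0))) (.sub .size (.const 2))))
    (.put 6 (.const 0) (.add (.tab 6 (.const 0)) (.const 1)))) (by
      rintro j B e - ⟨p1, p2, p3⟩
      refine ⟨by simp [St.run, Tm.eval, p1], fun i hi => ?_, by simp [St.run, p3]⟩
      have hj := p2 j le_rfl
      by_cases hij : i = j + 1
      · subst hij
        simp [St.run, Tm.eval, p1, hj, add_mul]
      · simpa [St.run, Tm.eval, p1, hij] using p2 i (by omega)) 6 le_rfl 0 A env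
      (fun i _ => henv i) ⟨by simp [h6], fun i hi => by
        have : i = 0 := by omega
        simp [this, h5, h7], rfl⟩
  rw [zero_add] at this
  exact this.2

/-- A list of steps is carried out by a program in polynomial time. -/
theorem exists_program (L : List Stage) (hL : stagesOk L = true)
    (hT : ∀ a ∈ [0, 5], a ∉ L.map Stage.target) (out : ℕ) :
    ∃ (c : Program) (p : Polynomial ℕ), ∀ (n : ℕ) (G : SimpleGraph (Fin n)),
      ∃ (s : Memory) (T : ℕ), Runs c (inputMemory G) s T ∧ T ≤ p.eval n ∧
        s.reg 0 = s.arr out 0 ∧ (∀ st ∈ L, st.Holds (n + 2) s.arr) ∧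
        HasMultiples (n + 2) s.arr ∧ s.arr 0 = (inputMemory G).arr 0 ∧
        ∀ i < n + 2, s.arr 5 i = i * n := by
  have h7 : 7 ∉ L.map Stage.target := by
    clear hT
    induction L with
    | nil => simp
    | cons s rest ih =>
      simp only [stagesOk, Bool.and_eq_true] at hL
      have : s.target ≠ 7 := by
        have := hL.1.1
        cases s <;> simp [Stage.ok] at this <;> simp [Stage.target] <;> tauto
      simp only [List.map_cons, List.mem_cons, not_or]
      exact ⟨this.symm, ih hL.2⟩
  obtain ⟨p, hp⟩ := (St.seq multiplesSt (stagesSt L)).comp_spec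
  -- The range is enlarged by two elements, the isolated vertices of `extend`. The rows of the input
  -- matrix still have length `N - 2`, which is the reason for the table in array `5`.
  refine ⟨.seq (.setReg 0 (.add (.reg 0) (.const 2))) (.seq ((St.seq multiplesSt (stagesSt L)).comp 0)
    (.setReg 0 (.arr out (.const 0)))), p.comp (.X + 2) + 10, fun n G => ?_⟩
  let s0 : Memory := { inputMemory G with reg := Function.update (inputMemory G).reg 0 (n + 2) }
  obtain ⟨s, T, hrun, hTle, harr, -⟩ := hp 0 s0
  have e0 : s0.reg 0 = n + 2 := by simp [s0]
  have henv : ∀ i, s0.reg (2 * i + 1) = 0 := by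
    intro i
    simp only [s0]
    rw [Function.update_of_ne (by omega)]
    simp [inputMemory]
  rw [e0] at hTle harr
  have hz : ∀ a, a ≠ 0 → s0.arr a = 0 := by
    intro a ha
    funext j
    simp [s0, inputMemory, ha]
  obtain ⟨m1, m2⟩ := multiplesSt_spec (N := n + 2) (hz 5 (by decide)) (hz 6 (by decide))
    (hz 7 (by decide)) henv
  set A1 := multiplesSt.run (n + 2) (fun i => s0.reg (2 * i + 1)) s0.arr with hA1
  have hA1m : HasMultiples (n + 2) A1 := fun i hi => (m1 i hi.le).1
  obtain ⟨t1, t2⟩ := stagesSt_spec (N := n + 2) L hL hA1m henv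
  have harr' : s.arr = (stagesSt L).run (n + 2) (fun i => s0.reg (2 * i + 1)) A1 := harr
  rw [← harr'] at t1 t2
  refine ⟨{ s with reg := Function.update s.reg 0 (s.arr out 0) }, _,
    Runs.seq (s' := s0) (T := 4) ?_ (Runs.seq hrun (Runs.setReg _ _ _)), ?_, by simp, t2, ?_, ?_, ?_⟩
  · have := Runs.setReg (inputMemory G) 0 (.add (.reg 0) (.const 2))
    simpa [Expr.eval, Expr.cost, inputMemory, s0] using this
  · simp only [Expr.cost, Polynomial.eval_add, Polynomial.eval_comp, Polynomial.eval_X,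
      Polynomial.eval_ofNat]
    omega
  · intro i hi
    simp only [t1 7 h7 (by decide)]
    exact hA1m i hi
  · simp only
    rw [t1 0 (hT 0 (by simp)) (by decide), m2]
  · intro i hi
    simp only
    rw [t1 5 (hT 5 (by simp)) (by decide), (m1 i (hi.le.trans (Nat.le_self_pow (by decide) _))).2]
    simp

/-! ### Burling relations -/

/-- The pairs of relations that describe Burling graphs: `lt` is nesting, and `arr` orients the
edges. -/
structure BurlingRel {V : Type*} (lt arr : V → V → Prop) : Prop where
  irrefl : ∀ x, ¬ lt x x
  trans : ∀ x y z, lt x y → lt y z → lt x z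
  lt_lt : ∀ x y z, lt x y → lt x z → y = z ∨ lt y z ∨ lt z y
  arr_arr : ∀ x y z, arr x y → arr x z → y = z ∨ lt y z ∨ lt z y
  arr_lt : ∀ x y z, arr x y → lt x z → lt y z
  lt_arr : ∀ x y z, arr x y → lt y z → arr x z ∨ lt x z
  rank : ∃ f : V → ℕ, ∀ x y, arr x y → f y < f x

/-- The pair of relations orients `adj`. -/
def Orients {V : Type*} (adj arr : V → V → Prop) : Prop := ∀ u v, adj u v ↔ arr u v ∨ arr v u

theorem BurlingRel.comap {V W : Type*} {lt arr : V → V → Prop} (h : BurlingRel lt arr)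
    {φ : W → V} (hφ : Function.Injective φ) :
    BurlingRel (fun u v => lt (φ u) (φ v)) (fun u v => arr (φ u) (φ v)) where
  irrefl x := h.irrefl _
  trans x y z := h.trans _ _ _
  lt_lt x y z h1 h2 := (h.lt_lt _ _ _ h1 h2).imp (fun e => hφ e) id
  arr_arr x y z h1 h2 := (h.arr_arr _ _ _ h1 h2).imp (fun e => hφ e) id
  arr_lt x y z := h.arr_lt _ _ _
  lt_arr x y z := h.lt_arr _ _ _
  rank := h.rank.elim fun f hf => ⟨f ∘ φ, fun x y => hf _ _⟩

/-- Nesting in the next graph of Burling's construction. -/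
def NextVertex.Lt {P : SetGraph} (lt : P.V → P.V → Prop) : NextVertex P → NextVertex P → Prop
  | .base u, .base v => lt u v
  | .copy S u, .copy T v => S = T ∧ lt u v
  | .copy S _, .base v => v ∈ S.1
  | .apex S _, .base v => v ∈ S.1
  | _, _ => False

/-- The orientation of the next graph of Burling's construction. -/
def NextVertex.Arr {P : SetGraph} (arr : P.V → P.V → Prop) : NextVertex P → NextVertex P → Prop
  | .base u, .base v => arr u v
  | .copy S u, .copy T v => S = T ∧ arr u v
  | .apex S Q, .copy T v => S = T ∧ v ∈ Q.1
  | _, _ => False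

/-- The graph has a Burling relation of height at most `k` in which the distinguished sets are
upper chains. -/
def SetGraph.Layered (P : SetGraph) (k : ℕ) : Prop :=
  ∃ lt arr : P.V → P.V → Prop,
    BurlingRel lt arr ∧ Orients P.graph.Adj arr ∧
    (∃ f : P.V → ℕ, (∀ x y, arr x y → f y < f x) ∧ ∀ x, f x ≤ k) ∧
    ∀ S ∈ P.sets, (∀ u ∈ S, ∀ v ∈ S, u = v ∨ lt u v ∨ lt v u) ∧
      ∀ u ∈ S, ∀ v, lt u v → v ∈ S

/-- The copy of `S` and the new vertices of `S` are nested in all members of `S`, and the new vertex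
of `S`, `Q` sends arrows to `Q`. That distinguished sets are chains gives `lt_lt` and `arr_arr`;
that they are closed upwards gives transitivity and `lt_arr`. The height bound `k` leaves the rank
`k + 1` for the new vertices. -/
theorem SetGraph.Layered.next {P : SetGraph} {k : ℕ} (h : P.Layered k) : P.next.Layered (k + 1) := by
  obtain ⟨lt, arr, hB, hO, ⟨f, hf, hfk⟩, hS⟩ := h
  let f' : NextVertex P → ℕ := fun
    | .base u => f u
    | .copy _ u => f u
    | .apex _ _ => k + 1
  have hf' : ∀ x y, NextVertex.Arr arr x y → f' y < f' x := by
    rintro (u | ⟨S, u⟩ | ⟨S, Q⟩) (v | ⟨T, v⟩ | ⟨T, R⟩) h <;> simp only [NextVertex.Arr] at h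
    · exact hf _ _ h
    · exact hf _ _ h.2
    · exact Nat.lt_succ_of_le (hfk v)
  refine ⟨NextVertex.Lt lt, NextVertex.Arr arr, ?_, ?_, ⟨f', hf', ?_⟩, ?_⟩
  · refine ⟨?_, ?_, ?_, ?_, ?_, ?_, f', hf'⟩
    · rintro (u | ⟨S, u⟩ | ⟨S, Q⟩) <;> simp [NextVertex.Lt, hB.irrefl]
    · rintro (u | ⟨S, u⟩ | ⟨S, Q⟩) (v | ⟨T, v⟩ | ⟨T, R⟩) (w | ⟨T', w⟩ | ⟨T', R'⟩) h h' <;>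
        simp only [NextVertex.Lt] at h h' ⊢
      · exact hB.trans _ _ _ h h'
      · exact (hS S.1 S.2).2 _ h _ h'
      · exact h.1 ▸ h'
      · exact ⟨h.1.trans h'.1, hB.trans _ _ _ h.2 h'.2⟩
      · exact (hS S.1 S.2).2 _ h _ h'
    · rintro (u | ⟨S, u⟩ | ⟨S, Q⟩) (v | ⟨T, v⟩ | ⟨T, R⟩) (w | ⟨T', w⟩ | ⟨T', R'⟩) h h' <;>
        simp only [NextVertex.Lt] at h h' ⊢
      · exact (hB.lt_lt _ _ _ h h').imp (congrArg _) id
      · exact ((hS S.1 S.2).1 _ h _ h').imp (congrArg _) id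
      · exact .inr (.inr (h'.1 ▸ h))
      · exact .inr (.inl (h.1 ▸ h'))
      · obtain ⟨rfl, h⟩ := h
        obtain ⟨rfl, h'⟩ := h'
        exact (hB.lt_lt _ _ _ h h').imp (congrArg _) (Or.imp (fun h => ⟨rfl, h⟩) fun h => ⟨rfl, h⟩)
      · exact ((hS S.1 S.2).1 _ h _ h').imp (congrArg _) id
    · rintro (u | ⟨S, u⟩ | ⟨S, Q⟩) (v | ⟨T, v⟩ | ⟨T, R⟩) (w | ⟨T', w⟩ | ⟨T', R'⟩) h h' <;>
        simp only [NextVertex.Lt, NextVertex.Arr] at h h' ⊢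
      · exact (hB.arr_arr _ _ _ h h').imp (congrArg _) id
      · obtain ⟨rfl, h⟩ := h
        obtain ⟨rfl, h'⟩ := h'
        exact (hB.arr_arr _ _ _ h h').imp (congrArg _) (Or.imp (fun h => ⟨rfl, h⟩) fun h => ⟨rfl, h⟩)
      · obtain ⟨rfl, h⟩ := h
        obtain ⟨rfl, h'⟩ := h'
        exact ((hS Q.1 Q.2).1 _ h _ h').imp (congrArg _) (Or.imp (fun h => ⟨rfl, h⟩) fun h => ⟨rfl, h⟩)
    · rintro (u | ⟨S, u⟩ | ⟨S, Q⟩) (v | ⟨T, v⟩ | ⟨T, R⟩) (w | ⟨T', w⟩ | ⟨T', R'⟩) h h' <;>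
        simp only [NextVertex.Lt, NextVertex.Arr] at h h' ⊢
      · exact hB.arr_lt _ _ _ h h'
      · exact h.1 ▸ h'
      · exact ⟨h.1 ▸ h'.1, hB.arr_lt _ _ _ h.2 h'.2⟩
      · exact h.1 ▸ h'
    · rintro (u | ⟨S, u⟩ | ⟨S, Q⟩) (v | ⟨T, v⟩ | ⟨T, R⟩) (w | ⟨T', w⟩ | ⟨T', R'⟩) h h' <;>
        simp only [NextVertex.Lt, NextVertex.Arr] at h h' ⊢
      · exact hB.lt_arr _ _ _ h h'
      · exact .inr (h.1 ▸ h')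
      · exact (hB.lt_arr _ _ _ h.2 h'.2).imp (fun h'' => ⟨h.1.trans h'.1, h''⟩)
          fun h'' => ⟨h.1.trans h'.1, h''⟩
      · exact .inr (h.1 ▸ h')
      · exact .inl ⟨h.1.trans h'.1, (hS Q.1 Q.2).2 _ h.2 _ h'.2⟩
  · rintro (u | ⟨S, u⟩ | ⟨S, Q⟩) (v | ⟨T, v⟩ | ⟨T, R⟩) <;>
      simp only [SetGraph.next, NextVertex.Adj, NextVertex.Arr, or_false, false_or]
    · exact hO u v
    · constructor
      · rintro ⟨rfl, h⟩
        exact ((hO u v).1 h).imp (fun h => ⟨rfl, h⟩) (fun h => ⟨rfl, h⟩)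
      · rintro (⟨rfl, h⟩ | ⟨rfl, h⟩)
        · exact ⟨rfl, (hO u v).2 (.inl h)⟩
        · exact ⟨rfl, (hO u v).2 (.inr h)⟩
  · rintro (u | ⟨S, u⟩ | ⟨S, Q⟩)
    · exact (hfk u).trans (Nat.le_succ k)
    · exact (hfk u).trans (Nat.le_succ k)
    · exact le_rfl
  · rintro A ⟨S, Q, rfl | rfl⟩
    · constructor
      · rintro _ (⟨u, hu, rfl⟩ | ⟨u, hu, rfl⟩) _ (⟨v, hv, rfl⟩ | ⟨v, hv, rfl⟩)
        · exact ((hS S.1 S.2).1 u hu v hv).imp (congrArg _) id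
        · exact .inr (.inr hu)
        · exact .inr (.inl hv)
        · exact ((hS Q.1 Q.2).1 u hu v hv).imp (congrArg _)
            (Or.imp (fun h => ⟨rfl, h⟩) fun h => ⟨rfl, h⟩)
      · rintro _ (⟨u, hu, rfl⟩ | ⟨u, hu, rfl⟩) (v | ⟨T, v⟩ | ⟨T, R⟩) h <;>
          simp only [NextVertex.Lt] at h
        · exact .inl ⟨v, (hS S.1 S.2).2 u hu v h, rfl⟩
        · exact .inl ⟨v, h, rfl⟩
        · obtain ⟨rfl, h⟩ := h
          exact .inr ⟨v, (hS Q.1 Q.2).2 u hu v h, rfl⟩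
    · constructor
      · rintro _ (⟨u, hu, rfl⟩ | rfl) _ (⟨v, hv, rfl⟩ | rfl)
        · exact ((hS S.1 S.2).1 u hu v hv).imp (congrArg _) id
        · exact .inr (.inr hu)
        · exact .inr (.inl hv)
        · exact .inl rfl
      · rintro _ (⟨u, hu, rfl⟩ | rfl) (v | ⟨T, v⟩ | ⟨T, R⟩) h <;>
          simp only [NextVertex.Lt] at h
        · exact .inl ⟨v, (hS S.1 S.2).2 u hu v h, rfl⟩
        · exact .inl ⟨v, h, rfl⟩

theorem burlingSeq_layered (k : ℕ) : (burlingSeq k).Layered k := by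
  induction k with
  | zero =>
    refine ⟨fun _ _ => False, fun _ _ => False, ?_, ?_, ⟨fun _ => 0, by simp, by simp⟩, ?_⟩
    · constructor <;> simp
    · intro u v
      simp only [or_false, iff_false]
      exact id
    · intro S _
      exact ⟨fun u _ v _ => .inl rfl, by simp⟩
  | succ k ih => exact ih.next

theorem IsBurlingGraph.exists_burlingRel {V : Type*} {G : SimpleGraph V} (h : IsBurlingGraph G) :
    ∃ lt arr : V → V → Prop, BurlingRel lt arr ∧ Orients G.Adj arr := by
  obtain ⟨k, ⟨φ⟩⟩ := h
  obtain ⟨lt, arr, hB, hO, -⟩ := burlingSeq_layered k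
  refine ⟨_, _, hB.comap φ.injective, fun u v => ?_⟩
  rw [← φ.map_adj_iff]
  exact hO _ _

/-! ### Embedding graphs with Burling relations into the Burling sequence. -/

/-- The set `P` is a chain of `W` that is closed upwards in `W`. -/
def IsUpperChain {V : Type*} (lt : V → V → Prop) (W P : Set V) : Prop :=
  P ⊆ W ∧ (∀ u ∈ P, ∀ v ∈ P, u = v ∨ lt u v ∨ lt v u) ∧ ∀ u ∈ P, ∀ v ∈ W, lt u v → v ∈ P

/-- The graph `P` contains `adj` on `W`, and every upper chain is cut out by a distinguished
set. -/
def SetGraph.Hosts {V : Type*} (P : SetGraph) (lt adj : V → V → Prop) (W : Set V) : Prop :=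
  ∃ φ : V → P.V, Set.InjOn φ W ∧ (∀ u ∈ W, ∀ v ∈ W, adj u v ↔ P.graph.Adj (φ u) (φ v)) ∧
    ∀ C, IsUpperChain lt W C → ∃ S ∈ P.sets, ∀ u ∈ W, φ u ∈ S ↔ u ∈ C

theorem SetGraph.hosts_next_of {V : Type*} {P : SetGraph} {lt adj : V → V → Prop} {W : Set V}
    (φ : V → NextVertex P) (h1 : Set.InjOn φ W)
    (h2 : ∀ u ∈ W, ∀ v ∈ W, adj u v ↔ NextVertex.Adj (φ u) (φ v))
    (h3 : ∀ C, IsUpperChain lt W C → ∃ S Q : P.sets,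
      (∀ u ∈ W, φ u ∈ NextVertex.base '' S.1 ∪ NextVertex.copy S '' Q.1 ↔ u ∈ C) ∨
      (∀ u ∈ W, φ u ∈ NextVertex.base '' S.1 ∪ {NextVertex.apex S Q} ↔ u ∈ C)) :
    P.next.Hosts lt adj W := by
  refine ⟨φ, h1, h2, fun C hC => ?_⟩
  obtain ⟨S, Q, h | h⟩ := h3 C hC
  · exact ⟨_, ⟨S, Q, .inl rfl⟩, h⟩
  · exact ⟨_, ⟨S, Q, .inr rfl⟩, h⟩

/-- The base copy is used: on it a distinguished set formed from `S` and a new vertex has the same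
trace as `S`. -/
theorem SetGraph.Hosts.next {V : Type*} {P : SetGraph} {lt adj : V → V → Prop} {W : Set V}
    (h : P.Hosts lt adj W) : P.next.Hosts lt adj W := by
  obtain ⟨φ, h1, h2, h3⟩ := h
  refine SetGraph.hosts_next_of (fun u => .base (φ u))
    (fun u hu v hv e => h1 hu hv (NextVertex.base.inj e)) h2 fun C hC => ?_
  obtain ⟨S, hS, hSC⟩ := h3 C hC
  refine ⟨⟨S, hS⟩, ⟨S, hS⟩, .inr fun u hu => ?_⟩
  rw [← hSC u hu]
  simp

/-- A new vertex that is joined to an upper chain can be hosted in the next graph. -/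
theorem SetGraph.Hosts.insert_root {V : Type*} {P : SetGraph} {lt adj : V → V → Prop} {R : Set V}
    (h : P.Hosts lt adj R) {x : V} (hx : x ∉ R) (hC : IsUpperChain lt R {v ∈ R | adj x v})
    (hlt : ∀ v ∈ R, ¬ lt v x ∧ ¬ lt x v) (hsymm : ∀ u v, adj u v → adj v u) (hirr : ¬ adj x x) :
    P.next.Hosts lt adj (insert x R) := by
  classical
  obtain ⟨φ, h1, h2, h3⟩ := h
  obtain ⟨Q, hQ, hQC⟩ := h3 _ hC
  let S : P.sets := ⟨Q, hQ⟩
  have hne : ∀ v ∈ R, v ≠ x := by rintro v hv rfl; exact hx hv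
  have hxQ : ∀ v ∈ R, adj x v ↔ φ v ∈ Q := by
    intro v hv
    rw [hQC v hv]
    simp [hv]
  -- Everything goes to the copy that belongs to `S`, where the new vertex of `S`, `S` sees exactly
  -- the neighbours of `x`, and nothing goes to the base copy. An upper chain through `x` is `{x}`
  -- and is cut out by the set containing the new vertex; the others are cut out inside the copy.
  refine SetGraph.hosts_next_of (fun u => if u = x then .apex S S else .copy S (φ u)) ?_ ?_ ?_
  · rintro u hu v hv e
    by_cases hux : u = x <;> by_cases hvx : v = x <;> simp [hux, hvx] at e ⊢
    exact h1 (hu.resolve_left hux) (hv.resolve_left hvx) e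
  · rintro u (rfl | hu) v (rfl | hv)
    · simp [hirr, NextVertex.Adj]
    · simp [hne v hv, NextVertex.Adj, hxQ v hv, S]
    · rw [show adj u v ↔ adj v u from ⟨hsymm _ _, hsymm _ _⟩]
      simp [hne u hu, NextVertex.Adj, hxQ u hu, S]
    · simp [hne u hu, hne v hv, NextVertex.Adj, h2 u hu v hv]
  · rintro C ⟨hC1, hC2, hC3⟩
    by_cases hxC : x ∈ C
    · refine ⟨S, S, .inr ?_⟩
      rintro u (rfl | hu)
      · simp [hxC]
      · have : u ∉ C := by
          intro huC
          rcases hC2 u huC x hxC with rfl | h | h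
          · exact hx hu
          · exact (hlt u hu).1 h
          · exact (hlt u hu).2 h
        simp [hne u hu, this]
    · have hCR : IsUpperChain lt R C :=
        ⟨fun u hu => (hC1 hu).resolve_left fun e => hxC (e ▸ hu), hC2,
          fun u hu v hv => hC3 u hu v (.inr hv)⟩
      obtain ⟨T, hT, hTC⟩ := h3 C hCR
      refine ⟨S, ⟨T, hT⟩, .inl ?_⟩
      rintro u (rfl | hu)
      · simp [hxC]
      · simp [hne u hu, hTC u hu]

/-- Graphs can be nested below a vertex. -/
theorem SetGraph.Hosts.nest {V : Type*} {P : SetGraph} {lt adj : V → V → Prop} {W D : Set V}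
    (hW : P.Hosts lt adj W) (hD : P.Hosts lt adj D) {x : V} (hx : x ∈ W) (hWD : Disjoint W D)
    (hlt : ∀ v ∈ W, ¬ lt v x ∧ ¬ lt x v) (hDx : ∀ u ∈ D, lt u x)
    (hadj : ∀ u ∈ W, ∀ v ∈ D, ¬ adj u v ∧ ¬ adj v u) :
    P.next.Hosts lt adj (W ∪ D) := by
  classical
  obtain ⟨φ, h1, h2, h3⟩ := hW
  obtain ⟨ψ, g1, g2, g3⟩ := hD
  -- In `W` the singleton of `x` is an upper chain, so some distinguished set meets the image of `W`
  -- only in the image of `x`. In the copy belonging to that set, `D` is nested below `x` and below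
  -- nothing else of `W`.
  obtain ⟨Q, hQ, hQC⟩ := h3 {x} ⟨by simpa using hx, by simp, by
    rintro u rfl v hv h
    exact absurd h (hlt v hv).2⟩
  let S : P.sets := ⟨Q, hQ⟩
  have hnotW : ∀ v ∈ D, v ∉ W := fun v hv hv' => Set.disjoint_left.1 hWD hv' hv
  refine SetGraph.hosts_next_of (fun u => if u ∈ W then .base (φ u) else .copy S (ψ u)) ?_ ?_ ?_
  · rintro u hu v hv e
    by_cases huW : u ∈ W <;> by_cases hvW : v ∈ W <;> simp [huW, hvW] at e
    · exact h1 huW hvW e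
    · exact g1 (hu.resolve_left huW) (hv.resolve_left hvW) e
  · rintro u (hu | hu) v (hv | hv)
    · simp [hu, hv, NextVertex.Adj, h2 u hu v hv]
    · simp [hu, hnotW v hv, NextVertex.Adj, (hadj u hu v hv).1]
    · simp [hv, hnotW u hu, NextVertex.Adj, (hadj v hv u hu).2]
    · simp [hnotW u hu, hnotW v hv, NextVertex.Adj, g2 u hu v hv]
  · rintro C ⟨hC1, hC2, hC3⟩
    by_cases hCD : ∃ d ∈ D, d ∈ C
    · obtain ⟨d, hd, hdC⟩ := hCD
      have hxC : x ∈ C := hC3 d hdC x (.inl hx) (hDx d hd)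
      obtain ⟨T, hT, hTC⟩ := g3 (C ∩ D) ⟨Set.inter_subset_right,
        fun u hu v hv => hC2 u hu.1 v hv.1, fun u hu v hv h => ⟨hC3 u hu.1 v (.inr hv) h, hv⟩⟩
      refine ⟨S, ⟨T, hT⟩, .inl ?_⟩
      rintro u (hu | hu)
      · have : u ∈ C ↔ u = x := by
          refine ⟨fun huC => ?_, fun e => e ▸ hxC⟩
          rcases hC2 u huC x hxC with h | h | h
          · exact h
          · exact absurd h (hlt u hu).1
          · exact absurd h (hlt u hu).2
        have h4 := hQC u hu
        simp only [Set.mem_singleton_iff] at h4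
        simp [hu, this, h4, S]
      · simp [hnotW u hu, hTC u hu, hu]
    · push Not at hCD
      obtain ⟨T, hT, hTC⟩ := h3 C ⟨fun u hu => (hC1 hu).resolve_right fun h => hCD u h hu, hC2,
        fun u hu v hv h => hC3 u hu v (.inl hv) h⟩
      refine ⟨⟨T, hT⟩, ⟨T, hT⟩, .inr ?_⟩
      rintro u (hu | hu)
      · simp [hu, hTC u hu]
      · simp [hnotW u hu, hCD u hu]

theorem BurlingRel.exists_root {V : Type*} {lt arr : V → V → Prop} (h : BurlingRel lt arr)
    {W : Set V} (hfin : W.Finite) {u : V} (hu : u ∈ W) :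
    ∃ r ∈ W, (r = u ∨ lt u r) ∧ ∀ v ∈ W, ¬ lt r v := by
  obtain ⟨r, ⟨hr, hur⟩, hmax⟩ := Set.exists_max_image {r ∈ W | r = u ∨ lt u r}
    (fun r => {v ∈ W | lt v r}.ncard) (hfin.subset (Set.sep_subset _ _)) ⟨u, hu, .inl rfl⟩
  refine ⟨r, hr, hur, fun v hv hrv => ?_⟩
  have h1 := hmax v ⟨hv, .inr (hur.elim (fun e => e ▸ hrv) fun e => h.trans _ _ _ e hrv)⟩
  have h2 : {w ∈ W | lt w r}.ncard < {w ∈ W | lt w v}.ncard :=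
    Set.ncard_lt_ncard ⟨fun w hw => ⟨hw.1, h.trans _ _ _ hw.2 hrv⟩,
      fun hsub => h.irrefl r (hsub ⟨hr, hrv⟩).2⟩ (hfin.subset (Set.sep_subset _ _))
  exact absurd h1 (not_le.2 h2)

/-- A nonempty finite set has a maximal vertex that is not entered by an arrow. -/
theorem BurlingRel.exists_source_root {V : Type*} {lt arr : V → V → Prop} (h : BurlingRel lt arr)
    {W : Set V} (hfin : W.Finite) (hne : W.Nonempty) :
    ∃ x ∈ W, (∀ v ∈ W, ¬ lt x v) ∧ ∀ v ∈ W, ¬ arr v x := by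
  obtain ⟨f, hf⟩ := h.rank
  obtain ⟨u, hu⟩ := hne
  obtain ⟨r, hr, -, hroot⟩ := h.exists_root hfin hu
  obtain ⟨x, ⟨hx, hx'⟩, hmax⟩ := Set.exists_max_image {r ∈ W | ∀ v ∈ W, ¬ lt r v} f
    (hfin.subset (Set.sep_subset _ _)) ⟨r, hr, hroot⟩
  refine ⟨x, hx, hx', fun v hv hvx => ?_⟩
  have := hmax v ⟨hv, fun w hw hvw => hx' w hw (h.arr_lt _ _ _ hvx hvw)⟩
  exact absurd (hf _ _ hvx) (not_lt.2 this)

/-- An outermost vertex `x` that no arrow enters splits `W` into `x`, the vertices nested in `x`,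
and the rest. The neighbours of `x` form an upper chain of the rest, and by `arr_lt` and `lt_arr` no
edge joins the nested vertices to anything else. So `insert_root` and `nest` rebuild `W` at the cost
of one step of the sequence each. -/
theorem BurlingRel.exists_hosts {V : Type*} {lt arr adj : V → V → Prop} (h : BurlingRel lt arr)
    (hO : Orients adj arr) : ∀ W : Finset V, ∃ K, ∀ k ≥ K,
      (burlingSeq k).Hosts lt adj (W : Set V) := by
  classical
  have hirr : ∀ x, ¬ adj x x := by
    obtain ⟨f, hf⟩ := h.rank
    intro x hx
    rcases (hO x x).1 hx with hx | hx <;> exact lt_irrefl _ (hf _ _ hx)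
  have hsymm : ∀ u v, adj u v → adj v u := fun u v huv => (hO v u).2 ((hO u v).1 huv).symm
  intro W
  induction W using Finset.strongInduction with
  | H W ih =>
  rcases W.eq_empty_or_nonempty with rfl | hne
  · refine ⟨0, fun k hk => ?_⟩
    clear hk
    induction k with
    | zero =>
      exact ⟨fun _ => (), by simp [Set.InjOn], by simp, fun C _ => ⟨Set.univ, rfl, by simp⟩⟩
    | succ k ihk => exact ihk.next
  · obtain ⟨x, hx, hroot, hsource⟩ := h.exists_source_root W.finite_toSet hne
    have hmem : ∀ u, u ∈ W ↔ u = x ∨ u ∈ W.filter (fun u => u ≠ x ∧ ¬ lt u x) ∨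
        u ∈ W.filter (fun u => lt u x) := by
      intro u
      simp only [Finset.mem_filter]
      constructor
      · tauto
      · rintro (rfl | h | h)
        exacts [hx, h.1, h.1]
    obtain ⟨K1, h1⟩ := ih (W.filter fun u => u ≠ x ∧ ¬ lt u x) (Finset.filter_ssubset.2
      ⟨x, hx, by simp⟩)
    obtain ⟨K2, h2⟩ := ih (W.filter fun u => lt u x) (Finset.filter_ssubset.2
      ⟨x, hx, h.irrefl x⟩)
    refine ⟨max K1 K2 + 2, fun k hk => ?_⟩
    obtain ⟨k, rfl⟩ : ∃ k', k = k' + 2 := ⟨k - 2, by omega⟩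
    have e1 := h1 k (by omega)
    have e2 := (h2 k (by omega)).next
    have e3 := e1.insert_root (x := x) (by simp) ⟨Set.sep_subset _ _, ?_, ?_⟩ ?_ hsymm (hirr x)
    · have e4 := e3.nest e2 (x := x) (by simp) ?_ ?_ ?_ ?_
      · have : (W : Set V) = insert x ((W.filter fun u => u ≠ x ∧ ¬ lt u x : Finset V) : Set V) ∪
            ((W.filter fun u => lt u x : Finset V) : Set V) := by
          ext u
          rw [Finset.mem_coe, hmem u]
          simp only [Set.mem_union, Set.mem_insert_iff, Finset.mem_coe, or_assoc]
        rw [this]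
        exact e4
      · rw [Set.disjoint_left]
        rintro u (rfl | hu) hu'
        · simp [h.irrefl] at hu'
        · simp at hu hu'
          exact hu.2.2 hu'.2
      · rintro u (rfl | hu)
        · exact ⟨h.irrefl _, h.irrefl _⟩
        · simp at hu
          exact ⟨hu.2.2, hroot u hu.1⟩
      · intro u hu
        simp at hu
        exact hu.2
      · have key : ∀ u ∈ insert x ((W.filter fun u => u ≠ x ∧ ¬ lt u x : Finset V) : Set V),
            ∀ v ∈ ((W.filter fun u => lt u x : Finset V) : Set V), ¬ adj u v := by
          intro u hu v hv huv
          simp at hu hv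
          have hux : ¬ lt u x := by
            rcases hu with rfl | hu
            · exact h.irrefl _
            · exact hu.2.2
          rcases (hO u v).1 huv with huv | huv
          · rcases h.lt_arr _ _ _ huv hv.2 with h' | h'
            · rcases hu with rfl | hu
              · exact hirr _ ((hO _ _).2 (.inl h'))
              · exact hsource u hu.1 h'
            · exact hux h'
          · exact hux (h.arr_lt _ _ _ huv hv.2)
        exact fun u hu v hv => ⟨key u hu v hv, fun h' => key u hu v hv (hsymm _ _ h')⟩
    · rintro u ⟨hu, hxu⟩ v ⟨hv, hxv⟩
      simp at hu hv
      exact h.arr_arr x u v (((hO _ _).1 hxu).resolve_right (hsource u hu.1))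
        (((hO _ _).1 hxv).resolve_right (hsource v hv.1))
    · rintro u ⟨hu, hxu⟩ v hv huv
      simp at hu
      have hv' := hv
      simp at hv'
      refine ⟨hv, (hO _ _).2 (.inl ?_)⟩
      exact (h.lt_arr x u v (((hO _ _).1 hxu).resolve_right (hsource u hu.1)) huv).resolve_right
        (hroot v hv'.1)
    · intro v hv
      simp at hv
      exact ⟨hv.2.2, hroot v hv.1⟩

theorem BurlingRel.isBurlingGraph {V : Type*} [Finite V] {G : SimpleGraph V}
    {lt arr : V → V → Prop} (h : BurlingRel lt arr) (hO : Orients G.Adj arr) :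
    IsBurlingGraph G := by
  have := Fintype.ofFinite V
  obtain ⟨K, hK⟩ := h.exists_hosts hO Finset.univ
  obtain ⟨φ, h1, h2, -⟩ := hK K le_rfl
  rw [Finset.coe_univ, Set.injOn_univ] at h1
  exact ⟨K, ⟨⟨⟨φ, h1⟩, fun {u v} => (h2 u (by simp) v (by simp)).symm⟩⟩⟩

/-! ### Forest orders -/

/-- A strict order in which the elements above any element form a chain. -/
structure ForestOrder {V : Type*} (R : V → V → Prop) : Prop where
  irrefl : ∀ x, ¬ R x x
  trans : ∀ x y z, R x y → R y z → R x z
  chain : ∀ x y z, R x y → R x z → y = z ∨ R y z ∨ R z y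

/-- The branch of `u` precedes the branch of `v` in the preorder that sorts siblings by the given
linear order. -/
def LeftOf {V : Type*} [LT V] (R : V → V → Prop) (u v : V) : Prop :=
  ∃ u' v', (u = u' ∨ R u u') ∧ (v = v' ∨ R v v') ∧ u' < v' ∧ ∀ w, R u' w ↔ R v' w

namespace ForestOrder

variable {V : Type*} {R : V → V → Prop}

theorem chain' (h : ForestOrder R) {x y z : V} (hy : x = y ∨ R x y) (hz : x = z ∨ R x z) :
    y = z ∨ R y z ∨ R z y := by
  rcases hy with rfl | hy <;> rcases hz with rfl | hz
  · exact .inl rfl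
  · exact .inr (.inl hz)
  · exact .inr (.inr hy)
  · exact h.chain _ _ _ hy hz

theorem trans' (h : ForestOrder R) {x y z : V} (hy : x = y ∨ R x y) (hz : y = z ∨ R y z) :
    x = z ∨ R x z := by
  rcases hy with rfl | hy <;> rcases hz with rfl | hz
  · exact .inl rfl
  · exact .inr hz
  · exact .inr hy
  · exact .inr (h.trans _ _ _ hy hz)

theorem siblings (h : ForestOrder R) {x u v : V} (hu : x = u ∨ R x u) (hv : x = v ∨ R x v)
    (huv : ∀ w, R u w ↔ R v w) : u = v := by
  rcases h.chain' hu hv with e | e | e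
  · exact e
  · exact absurd ((huv _).1 e) (h.irrefl _)
  · exact absurd ((huv _).2 e) (h.irrefl _)

/-- The witness is the branch towards `u` at the place where the ways down to `u` and `v` separate.
-/
theorem exists_top_not [Finite V] (h : ForestOrder R) {u v : V} (hu : ¬ (v = u ∨ R v u)) :
    ∃ u', (u = u' ∨ R u u') ∧ ¬ (v = u' ∨ R v u') ∧ ∀ w, R u' w → v = w ∨ R v w := by
  obtain ⟨u', ⟨h1, h2⟩, hmax⟩ := Set.exists_max_image {w | (u = w ∨ R u w) ∧ ¬ (v = w ∨ R v w)}
    (fun w => {x | R x w}.ncard) (Set.toFinite _) ⟨u, .inl rfl, hu⟩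
  refine ⟨u', h1, h2, fun w hw => ?_⟩
  by_contra hvw
  have := hmax w ⟨h.trans' h1 (.inr hw), hvw⟩
  have h3 : {x | R x u'}.ncard < {x | R x w}.ncard :=
    Set.ncard_lt_ncard ⟨fun x hx => h.trans _ _ _ hx hw, fun hs => h.irrefl u' (hs hw)⟩
      (Set.toFinite _)
  omega

variable [LinearOrder V]

theorem leftOf_mono (h : ForestOrder R) {u v x y : V} (huv : LeftOf R u v) (hx : x = u ∨ R x u)
    (hy : y = v ∨ R y v) : LeftOf R x y := by
  obtain ⟨u', v', h1, h2, h3, h4⟩ := huv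
  exact ⟨u', v', h.trans' hx h1, h.trans' hy h2, h3, h4⟩

theorem not_leftOf (h : ForestOrder R) {x u v : V} (hu : x = u ∨ R x u) (hv : x = v ∨ R x v) :
    ¬ LeftOf R u v := by
  rintro ⟨u', v', h1, h2, h3, h4⟩
  exact h3.ne (h.siblings (h.trans' hu h1) (h.trans' hv h2) h4)

theorem leftOf_trans (h : ForestOrder R) {u v w : V} (huv : LeftOf R u v) (hvw : LeftOf R v w) :
    LeftOf R u w := by
  obtain ⟨u', v', h1, h2, h3, h4⟩ := huv
  obtain ⟨v'', w', g1, g2, g3, g4⟩ := hvw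
  rcases h.chain' h2 g1 with rfl | e | e
  · exact ⟨u', w', h1, g2, h3.trans g3, fun x => (h4 x).trans (g4 x)⟩
  · exact ⟨v'', w', h.trans' h1 (.inr ((h4 _).2 e)), g2, g3, g4⟩
  · exact ⟨u', v', h1, h.trans' g2 (.inr ((g4 _).1 e)), h3, h4⟩

theorem leftOf_asymm (h : ForestOrder R) {u v : V} (huv : LeftOf R u v) : ¬ LeftOf R v u :=
  fun hvu => h.not_leftOf (.inl rfl) (.inl rfl) (h.leftOf_trans huv hvu)

/-- The two branches at the place of separation have the same proper ancestors, so they are siblings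
and the linear order of the vertices compares them. -/
theorem leftOf_total [Finite V] (h : ForestOrder R) {u v : V} (hne : u ≠ v) (huv : ¬ R u v)
    (hvu : ¬ R v u) : LeftOf R u v ∨ LeftOf R v u := by
  obtain ⟨u', h1, h2, h3⟩ := h.exists_top_not (u := u) (v := v)
    (fun e => e.elim (fun e => hne e.symm) hvu)
  obtain ⟨v', g1, g2, g3⟩ := h.exists_top_not (u := v) (v := u) (fun e => e.elim hne huv)
  have key : ∀ w, R u' w ↔ R v' w := by
    intro w
    constructor
    · intro hw
      rcases h.chain' (h3 w hw) g1 with e | e | e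
      · exact absurd (h.trans' h1 (.inr (e ▸ hw))) g2
      · exact absurd (h.trans' (h.trans' h1 (.inr hw)) (.inr e)) g2
      · exact e
    · intro hw
      rcases h.chain' (g3 w hw) h1 with e | e | e
      · exact absurd (h.trans' g1 (.inr (e ▸ hw))) h2
      · exact absurd (h.trans' (h.trans' g1 (.inr hw)) (.inr e)) h2
      · exact e
  rcases lt_trichotomy u' v' with e | e | e
  · exact .inl ⟨u', v', h1, g1, e, key⟩
  · exact absurd (e ▸ g1) h2
  · exact .inr ⟨v', u', g1, h1, e, fun w => (key w).symm⟩

end ForestOrder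

open Classical in
/-- The start of the interval of `u` in the preorder. -/
noncomputable def intervalStart {V : Type*} [Fintype V] [LT V] (R : V → V → Prop) (u : V) : ℕ :=
  ∑ w, ((if R u w then 1 else 0) + ((if LeftOf R w u then 1 else 0) +
    (if LeftOf R w u then 1 else 0)))

open Classical in
/-- The end of the interval of `u` in the preorder. -/
noncomputable def intervalEnd {V : Type*} [Fintype V] [LT V] (R : V → V → Prop) (u : V) : ℕ :=
  ∑ w, (((if R u w then 1 else 0) + ((if LeftOf R w u then 1 else 0) +
    (if LeftOf R w u then 1 else 0))) + ((if R w u then 1 else 0) + ((if R w u then 1 else 0) +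
    (if w = u then 1 else 0))))

namespace ForestOrder

variable {V : Type*} [Fintype V] [LinearOrder V] {R : V → V → Prop}

theorem intervalStart_lt (u : V) : intervalStart R u < intervalEnd R u := by
  refine Finset.sum_lt_sum (fun w _ => Nat.le_add_right _ _) ⟨u, Finset.mem_univ _, ?_⟩
  simp

/-- The coordinates count parentheses of a depth-first traversal. Before `u` opens, every ancestor
has contributed one and every vertex to the left two; before `u` closes, `u` has contributed one
more and every descendant two. The sums are compared term by term. -/
theorem intervalStart_lt_of_rel (h : ForestOrder R) {u v : V} (huv : R u v) :
    intervalStart R v < intervalStart R u := by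
  have hu : ∀ w, R v w → R u w := fun w hw => h.trans _ _ _ huv hw
  have hl : ∀ w, LeftOf R w v → LeftOf R w u := fun w hw => h.leftOf_mono hw (.inl rfl) (.inr huv)
  refine Finset.sum_lt_sum (fun w _ => ?_) ⟨v, Finset.mem_univ _, ?_⟩
  · have := hu w
    have := hl w
    split_ifs <;> simp_all
  · simp [h.irrefl v, huv, h.not_leftOf (u := v) (v := v) (.inl rfl) (.inl rfl)]

/-- What lies to the left of `u` lies to the left of `v` or below `v`, and so contributes two to
both ends. The strict term is that of `u`, which contributes one to its own end and two to that of
`v`. -/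
theorem intervalEnd_lt_of_rel (h : ForestOrder R) {u v : V} (huv : R u v) :
    intervalEnd R u < intervalEnd R v := by
  have hup : ∀ w, R u w → w = v ∨ R w v ∨ R v w := fun w hw => h.chain _ _ _ hw huv
  have hl : ∀ w, LeftOf R w u → R w v ∨ LeftOf R w v := by
    intro w hw
    by_contra! hcon
    by_cases e : w = v
    · subst e
      exact h.not_leftOf (.inr huv) (.inl rfl) hw
    · by_cases e' : R v w
      · exact h.not_leftOf (.inr (h.trans _ _ _ huv e')) (.inl rfl) hw
      · rcases h.leftOf_total e hcon.1 e' with e'' | e''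
        · exact hcon.2 e''
        · exact h.leftOf_asymm hw (h.leftOf_mono e'' (.inr huv) (.inl rfl))
  have hx1 : ∀ w, R u w → ¬ LeftOf R w u := fun w hw => h.not_leftOf (.inr hw) (.inl rfl)
  have hx2 : ∀ w, R u w → ¬ R w u := fun w hw hw' => h.irrefl _ (h.trans _ _ _ hw hw')
  have hx3 : ∀ w, R w u → ¬ LeftOf R w u := fun w hw => h.not_leftOf (.inl rfl) (.inr hw)
  have hd : ∀ w, R w u → R w v := fun w hw => h.trans _ _ _ hw huv
  refine Finset.sum_lt_sum (fun w _ => ?_) ⟨u, Finset.mem_univ _, ?_⟩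
  · by_cases e1 : R u w
    · have : w ≠ u := by rintro rfl; exact h.irrefl _ e1
      simp only [e1, hx1 w e1, hx2 w e1, this, if_true, if_false]
      rcases hup w e1 with e | e | e <;> simp only [e, if_true] <;> omega
    · by_cases e2 : LeftOf R w u
      · have e3 : ¬ R w u := fun e => hx3 w e e2
        have : w ≠ u := by rintro rfl; exact h.not_leftOf (.inl rfl) (.inl rfl) e2
        simp only [e1, e2, e3, this, if_true, if_false]
        rcases hl w e2 with e | e <;> simp only [e, if_true] <;> omega
      · by_cases e3 : R w u
        · have : w ≠ u := by rintro rfl; exact h.irrefl _ e3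
          simp only [e1, e2, e3, hd w e3, this, if_true, if_false]
          omega
        · by_cases e4 : w = u
          · subst e4
            simp only [e1, e2, huv, if_true, if_false]
            omega
          · simp [e1, e2, e3, e4]
  · simp only [h.irrefl u, huv, h.not_leftOf (u := u) (v := u) (.inl rfl) (.inl rfl), if_true,
      if_false]
    omega

/-- The vertices to the left of `u` or below `u`, and those ancestors of `u` that are not ancestors
of `v`, all lie to the left of `v`. The strict term is again that of `u`. -/
theorem intervalEnd_lt_of_leftOf (h : ForestOrder R) {u v : V} (huv : LeftOf R u v) :
    intervalEnd R u < intervalStart R v := by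
  have hup : ∀ w, R u w → LeftOf R w v ∨ R v w := by
    intro w hw
    by_contra! hcon
    by_cases e : w = v
    · subst e
      exact h.not_leftOf (.inl rfl) (.inr hw) huv
    · by_cases e' : R w v
      · exact h.not_leftOf (.inl rfl) (.inr (h.trans _ _ _ hw e')) huv
      · rcases h.leftOf_total e e' hcon.2 with e'' | e''
        · exact hcon.1 e''
        · exact h.leftOf_asymm huv (h.leftOf_mono e'' (.inl rfl) (.inr hw))
  have hl : ∀ w, LeftOf R w u → LeftOf R w v := fun w hw => h.leftOf_trans hw huv
  have hd : ∀ w, R w u → LeftOf R w v := fun w hw => h.leftOf_mono huv (.inr hw) (.inl rfl)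
  have hx1 : ∀ w, R u w → ¬ LeftOf R w u := fun w hw => h.not_leftOf (.inr hw) (.inl rfl)
  have hx2 : ∀ w, R u w → ¬ R w u := fun w hw hw' => h.irrefl _ (h.trans _ _ _ hw hw')
  have hx3 : ∀ w, R w u → ¬ LeftOf R w u := fun w hw => h.not_leftOf (.inl rfl) (.inr hw)
  refine Finset.sum_lt_sum (fun w _ => ?_) ⟨u, Finset.mem_univ _, ?_⟩
  · by_cases e1 : R u w
    · have : w ≠ u := by rintro rfl; exact h.irrefl _ e1
      simp only [e1, hx1 w e1, hx2 w e1, this, if_true, if_false]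
      rcases hup w e1 with e | e <;> simp only [e, if_true] <;> omega
    · by_cases e2 : LeftOf R w u
      · have e3 : ¬ R w u := fun e => hx3 w e e2
        have : w ≠ u := by rintro rfl; exact h.not_leftOf (.inl rfl) (.inl rfl) e2
        simp only [e1, e2, e3, this, hl w e2, if_true, if_false]
        omega
      · by_cases e3 : R w u
        · have : w ≠ u := by rintro rfl; exact h.irrefl _ e3
          simp only [e1, e2, e3, hd w e3, this, if_true, if_false]
          omega
        · by_cases e4 : w = u
          · subst e4
            simp only [e1, e2, huv, if_true, if_false]
            omega
          · simp [e1, e2, e3, e4]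
  · simp only [h.irrefl u, huv, h.not_leftOf (u := u) (v := u) (.inl rfl) (.inl rfl), if_true,
      if_false]
    omega

end ForestOrder

/-! ### The vertical order -/

/-- The vertical order restricted to a set of vertices. -/
def VertOn {V : Type*} (lt arr : V → V → Prop) (W : Set V) : V → V → Prop :=
  Relation.TransGen fun a b => a ∈ W ∧ b ∈ W ∧ (lt a b ∨ arr a b)

namespace BurlingRel

variable {V : Type*} {lt arr : V → V → Prop} {W : Set V}

theorem vertOn_mem {u v : V} (huv : VertOn lt arr W u v) : u ∈ W ∧ v ∈ W := by
  induction huv with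
  | single h => exact ⟨h.1, h.2.1⟩
  | tail _ h ih => exact ⟨ih.1, h.2.1⟩

/-- A mixed pair is comparable by `arr_lt`: the target of an arrow lies inside everything that
encloses its source. -/
theorem step_chain (h : BurlingRel lt arr) {x y z : V} (hy : lt x y ∨ arr x y)
    (hz : lt x z ∨ arr x z) : y = z ∨ (lt y z ∨ arr y z) ∨ lt z y ∨ arr z y := by
  rcases hy with hy | hy <;> rcases hz with hz | hz
  · rcases h.lt_lt _ _ _ hy hz with e | e | e <;> tauto
  · exact .inr (.inr (.inl (h.arr_lt _ _ _ hz hy)))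
  · exact .inr (.inl (.inl (h.arr_lt _ _ _ hy hz)))
  · rcases h.arr_arr _ _ _ hy hz with e | e | e <;> tauto

theorem vertOn_chain (h : BurlingRel lt arr) {x y z : V} (hy : VertOn lt arr W x y)
    (hz : VertOn lt arr W x z) : y = z ∨ VertOn lt arr W y z ∨ VertOn lt arr W z y := by
  have key : ∀ x z, VertOn lt arr W x z → ∀ y, (x ∈ W ∧ y ∈ W ∧ (lt x y ∨ arr x y)) →
      y = z ∨ VertOn lt arr W y z ∨ VertOn lt arr W z y := by
    intro x z hz
    induction hz using Relation.TransGen.head_induction_on with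
    | single hs =>
      intro y hy
      rcases h.step_chain hy.2.2 hs.2.2 with e | e | e
      · exact .inl e
      · exact .inr (.inl (.single ⟨hy.2.1, hs.2.1, e⟩))
      · exact .inr (.inr (.single ⟨hs.2.1, hy.2.1, e⟩))
    | head hs ht ih =>
      intro y hy
      rcases h.step_chain hy.2.2 hs.2.2 with e | e | e
      · exact .inr (.inl (e ▸ ht))
      · exact .inr (.inl (.head ⟨hy.2.1, hs.2.1, e⟩ ht))
      · exact ih y ⟨hs.2.1, hy.2.1, e⟩
  induction hy using Relation.TransGen.head_induction_on with
  | single hs => exact key _ _ hz _ hs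
  | head hs ht ih =>
    rcases key _ _ hz _ hs with e | e | e
    · exact .inr (.inr (e ▸ ht))
    · exact ih e
    · exact .inr (.inr (e.trans ht))

/-- By `lt_arr` an arrow followed by a nesting step is a single arrow or a single nesting step, so
every walk shortens to one step followed by arrows. A closed walk of this form contradicts the rank
if the first step is an arrow. If it is a nesting step, `lt_arr` pulls it back along the arrows
until a cycle of arrows or a vertex nested in itself appears. -/
theorem vertOn_irrefl (h : BurlingRel lt arr) (x : V) : ¬ VertOn lt arr W x x := by
  obtain ⟨f, hf⟩ := h.rank
  have h1 : ∀ w u, Relation.ReflTransGen arr w u → f u ≤ f w := by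
    intro w u hwu
    induction hwu with
    | refl => exact le_rfl
    | tail _ hs ih => exact (hf _ _ hs).le.trans ih
  have h2 : ∀ w u, Relation.ReflTransGen arr w u → ¬ lt u w := by
    intro w u hwu
    induction hwu with
    | refl => exact h.irrefl w
    | tail hr hs ih =>
      intro hlt
      rcases h.lt_arr _ _ _ hs hlt with e | e
      · exact absurd (hf _ _ e) (not_lt.2 (h1 _ _ hr))
      · exact ih e
  have h3 : ∀ x y, VertOn lt arr W x y →
      (∃ w, arr x w ∧ Relation.ReflTransGen arr w y) ∨
        ∃ w, lt x w ∧ Relation.ReflTransGen arr w y := by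
    intro x y hxy
    induction hxy using Relation.TransGen.head_induction_on with
    | single hs => exact hs.2.2.symm.imp (fun e => ⟨_, e, .refl⟩) fun e => ⟨_, e, .refl⟩
    | head hs _ ih =>
      rcases ih with ⟨w, e, hw⟩ | ⟨w, e, hw⟩
      · exact hs.2.2.symm.imp (fun e' => ⟨_, e', .head e hw⟩) fun e' => ⟨_, e', .head e hw⟩
      · rcases hs.2.2 with e' | e'
        · exact .inr ⟨w, h.trans _ _ _ e' e, hw⟩
        · exact (h.lt_arr _ _ _ e' e).imp (fun e'' => ⟨_, e'', hw⟩) fun e'' => ⟨_, e'', hw⟩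
  intro hx
  rcases h3 x x hx with ⟨w, e, hw⟩ | ⟨w, e, hw⟩
  · exact absurd (hf _ _ e) (not_lt.2 (h1 _ _ hw))
  · exact h2 _ _ hw e

theorem vertOn_forestOrder (h : BurlingRel lt arr) (W : Set V) : ForestOrder (VertOn lt arr W) where
  irrefl := h.vertOn_irrefl
  trans _ _ _ h1 h2 := Relation.TransGen.trans h1 h2
  chain _ _ _ := h.vertOn_chain

/-- What lies vertically above a vertex `a` nested in `c` is nested in `c` or above `c`. -/
theorem vertOn_of_lt (h : BurlingRel lt arr) {a b c : V} (hc : c ∈ W) (hac : lt a c)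
    (hab : VertOn lt arr W a b) : b = c ∨ lt b c ∨ VertOn lt arr W c b := by
  induction hab using Relation.TransGen.head_induction_on with
  | single hs =>
    rcases hs.2.2 with e | e
    · rcases h.lt_lt _ _ _ e hac with e' | e' | e'
      · exact .inl e'
      · exact .inr (.inl e')
      · exact .inr (.inr (.single ⟨hc, hs.2.1, .inl e'⟩))
    · exact .inr (.inl (h.arr_lt _ _ _ e hac))
  | head hs ht ih =>
    rcases hs.2.2 with e | e
    · rcases h.lt_lt _ _ _ e hac with e' | e' | e'
      · exact .inr (.inr (e' ▸ ht))
      · exact ih e'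
      · exact .inr (.inr (.head ⟨hc, hs.2.1, .inl e'⟩ ht))
    · exact ih (h.arr_lt _ _ _ e hac)

end BurlingRel

/-! ### The horizontal order -/

/-- The conditions on the horizontal coordinates. -/
structure HorizontalOn {V α : Type*} [LT α] (lt arr : V → V → Prop) (W : Set V) (l r : V → α) :
    Prop where
  left_lt_right : ∀ u ∈ W, l u < r u
  left_lt_left : ∀ u v, VertOn lt arr W u v → l v < l u
  right_lt_left : ∀ u v, VertOn lt arr W u v → ¬ lt u v → ¬ arr u v → r v < l u
  right_lt_right : ∀ u ∈ W, ∀ v ∈ W, lt u v → r u < r v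
  left_lt_right_of_arr : ∀ u ∈ W, ∀ v ∈ W, arr u v → l u < r v
  right_lt_right_of_arr : ∀ u ∈ W, ∀ v ∈ W, arr u v → r v < r u

/-- Split off an outermost vertex `x` that no arrow enters. The vertices nested in `x` are shifted
to the right of all others, and the right side of `x` is put beyond everything. Only the left side
of `x` needs care: it must precede the right sides of the out-neighbours of `x`, but follow the left
sides of all vertices vertically above `x` and the right sides of those among them that are not
out-neighbours. -/
theorem BurlingRel.exists_horizontalOn {V : Type*} {lt arr : V → V → Prop} (h : BurlingRel lt arr) :
    ∀ W : Finset V, ∃ l r : V → ℝ, HorizontalOn lt arr (W : Set V) l r := by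
  classical
  intro W
  induction W using Finset.strongInduction with
  | H W ih =>
  rcases W.eq_empty_or_nonempty with rfl | hne
  · refine ⟨fun _ => 0, fun _ => 0, ?_, ?_, ?_, ?_, ?_, ?_⟩
    · simp
    · intro u v huv
      exact absurd (BurlingRel.vertOn_mem huv).1 (by simp)
    · intro u v huv
      exact absurd (BurlingRel.vertOn_mem huv).1 (by simp)
    · simp
    · simp
    · simp
  obtain ⟨x, hx, hroot, hsource⟩ := h.exists_source_root W.finite_toSet hne
  obtain ⟨RR, hRR⟩ : ∃ RR, RR = W.filter fun u => u ≠ x ∧ ¬ lt u x := ⟨_, rfl⟩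
  obtain ⟨D, hD⟩ : ∃ D, D = W.filter fun u => lt u x := ⟨_, rfl⟩
  obtain ⟨l1, r1, H1⟩ := ih RR (hRR ▸ Finset.filter_ssubset.2 ⟨x, hx, by simp⟩)
  obtain ⟨l2, r2, H2⟩ := ih D (hD ▸ Finset.filter_ssubset.2 ⟨x, hx, h.irrefl x⟩)
  have mR : ∀ u, u ∈ RR ↔ u ∈ W ∧ u ≠ x ∧ ¬ lt u x := fun u => by simp [hRR]
  have mD : ∀ u, u ∈ D ↔ u ∈ W ∧ lt u x := fun u => by simp [hD]
  have hcase : ∀ u ∈ W, u ∈ RR ∨ u = x ∨ u ∈ D := by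
    intro u hu
    rw [mR, mD]
    tauto
  have hxR : x ∉ RR := by simp [mR]
  have hxD : x ∉ D := by simp [mD, h.irrefl]
  have hRD : ∀ u ∈ RR, u ∉ D := fun u hu hu' => ((mR u).1 hu).2.2 ((mD u).1 hu').2
  -- single steps
  have sR : ∀ u ∈ RR, ∀ v ∈ W, (lt u v ∨ arr u v) → v ∈ RR := by
    intro u hu v hv huv
    rw [mR] at hu
    rcases hcase v hv with e | rfl | e
    · exact e
    · exact absurd huv (not_or.2 ⟨hu.2.2, hsource u hu.1⟩)
    · rw [mD] at e
      rcases huv with huv | huv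
      · exact absurd (h.trans _ _ _ huv e.2) hu.2.2
      · rcases h.lt_arr _ _ _ huv e.2 with e' | e'
        · exact absurd e' (hsource u hu.1)
        · exact absurd e' hu.2.2
  have sx : ∀ v ∈ W, (lt x v ∨ arr x v) → v ∈ RR ∧ arr x v := by
    intro v hv hxv
    have hxv' := hxv.resolve_left (hroot v hv)
    refine ⟨(mR v).2 ⟨hv, ?_, ?_⟩, hxv'⟩
    · rintro rfl
      exact hsource _ hv hxv'
    · intro e
      rcases h.lt_arr _ _ _ hxv' e with e' | e'
      · exact hsource _ hx e'
      · exact h.irrefl _ e'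
  have sDR : ∀ u ∈ D, ∀ v ∈ RR, ¬ lt u v ∧ ¬ arr u v := by
    intro u hu v hv
    rw [mD] at hu
    rw [mR] at hv
    refine ⟨fun e => ?_, fun e => hv.2.2 (h.arr_lt _ _ _ e hu.2)⟩
    rcases h.lt_lt _ _ _ e hu.2 with e' | e' | e'
    · exact hv.2.1 e'
    · exact hv.2.2 e'
    · exact hroot v hv.1 e'
  have sDx : ∀ u ∈ D, ¬ arr u x := fun u hu => hsource u ((mD u).1 hu).1
  -- the vertical order
  have vR : ∀ u v, VertOn lt arr (W : Set V) u v → u ∈ RR →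
      v ∈ RR ∧ VertOn lt arr (RR : Set V) u v := by
    intro u v huv
    induction huv using Relation.TransGen.head_induction_on with
    | single hs =>
      intro hu
      have := sR _ hu _ hs.2.1 hs.2.2
      exact ⟨this, .single ⟨hu, this, hs.2.2⟩⟩
    | head hs _ ih =>
      intro hu
      have := sR _ hu _ hs.2.1 hs.2.2
      exact ⟨(ih this).1, .head ⟨hu, this, hs.2.2⟩ (ih this).2⟩
  have vx : ∀ v, VertOn lt arr (W : Set V) x v →
      v ∈ RR ∧ ∃ p ∈ RR, arr x p ∧ (p = v ∨ VertOn lt arr (RR : Set V) p v) := by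
    intro v hv
    rcases Relation.TransGen.head'_iff.1 hv with ⟨p, hs, hp⟩
    obtain ⟨hpR, hxp⟩ := sx p hs.2.1 hs.2.2
    rcases Relation.reflTransGen_iff_eq_or_transGen.1 hp with rfl | hp
    · exact ⟨hpR, v, hpR, hxp, .inl rfl⟩
    · exact ⟨(vR _ _ hp hpR).1, p, hpR, hxp, .inr (vR _ _ hp hpR).2⟩
  have vD : ∀ u v, VertOn lt arr (W : Set V) u v → u ∈ D →
      (v ∈ D ∧ VertOn lt arr (D : Set V) u v) ∨ v = x ∨ v ∈ RR := by
    intro u v huv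
    induction huv using Relation.TransGen.head_induction_on with
    | single hs =>
      intro hu
      rcases hcase v hs.2.1 with e | e | e
      · exact .inr (.inr e)
      · exact .inr (.inl e)
      · exact .inl ⟨e, .single ⟨hu, e, hs.2.2⟩⟩
    | head hs ht ih =>
      intro hu
      rcases hcase _ hs.2.1 with e | rfl | e
      · exact .inr (.inr (vR _ _ ht e).1)
      · exact .inr (.inr (vx _ ht).1)
      · rcases ih e with ⟨h1, h2⟩ | h'
        · exact .inl ⟨h1, .head ⟨hu, e, hs.2.2⟩ h2⟩
        · exact .inr h'
  have hxx : ¬ arr x x := hsource x hx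
  -- the left side of the new frame
  have hkey : ∀ p ∈ RR, arr x p → ∀ v, VertOn lt arr (W : Set V) x v → arr x v ∨ r1 v < r1 p := by
    intro p hp hxp v hv
    by_cases hxv : arr x v
    · exact .inl hxv
    right
    obtain ⟨hvR, p', hp', hxp', hpv⟩ := vx v hv
    have hdir : VertOn lt arr (RR : Set V) p v → r1 v < r1 p := by
      intro hpv
      by_cases e : lt p v
      · rcases h.lt_arr _ _ _ hxp e with e' | e'
        · exact absurd e' hxv
        · exact absurd e' (hroot v ((mR v).1 hvR).1)
      · by_cases e' : arr p v
        · exact H1.right_lt_right_of_arr p hp v hvR e'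
        · exact (H1.right_lt_left _ _ hpv e e').trans (H1.left_lt_right p hp)
    have hpv' : VertOn lt arr (RR : Set V) p' v := by
      rcases hpv with rfl | hpv
      · exact absurd hxp' hxv
      · exact hpv
    -- The way up to `v` starts with some out-neighbour `p'` of `x`, which is comparable with `p`.
    -- If `p'` lies inside `p`, then `vertOn_of_lt` locates `v` relative to `p`.
    rcases h.arr_arr _ _ _ hxp hxp' with rfl | e | e
    · exact hdir hpv'
    · exact hdir (.head ⟨hp, hp', .inl e⟩ hpv')
    · rcases h.vertOn_of_lt hp e hpv' with rfl | e' | e'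
      · exact absurd hxp hxv
      · exact H1.right_lt_right v hvR p hp e'
      · exact hdir e'
  obtain ⟨m, hm1, hm2⟩ := Order.exists_between_finsets
    ((W.filter fun v => VertOn lt arr (W : Set V) x v).image l1 ∪
      (W.filter fun v => VertOn lt arr (W : Set V) x v ∧ ¬ arr x v).image r1)
    ((W.filter fun v => arr x v).image r1) (by
      intro a ha b hb
      simp only [Finset.mem_union, Finset.mem_image, Finset.mem_filter] at ha hb
      obtain ⟨p, ⟨hp, hxp⟩, rfl⟩ := hb
      have hpR := (sx p hp (.inr hxp)).1
      rcases ha with ⟨v, ⟨hv, hxv⟩, rfl⟩ | ⟨v, ⟨hv, hxv, hxv'⟩, rfl⟩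
      · have hvR := (vx v hxv).1
        rcases hkey p hpR hxp v hxv with e | e
        · rcases h.arr_arr _ _ _ hxp e with rfl | e' | e'
          · exact H1.left_lt_right p hpR
          · exact (H1.left_lt_left p v (.single ⟨hpR, hvR, .inl e'⟩)).trans (H1.left_lt_right p hpR)
          · exact (H1.left_lt_right v hvR).trans (H1.right_lt_right v hvR p hpR e')
        · exact (H1.left_lt_right v hvR).trans e
      · exact (hkey p hpR hxp v hxv).resolve_left hxv')
  have hm_l : ∀ v, VertOn lt arr (W : Set V) x v → l1 v < m := fun v hv => hm1 _ (by
    simp only [Finset.mem_union, Finset.mem_image, Finset.mem_filter]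
    exact .inl ⟨v, ⟨(BurlingRel.vertOn_mem hv).2, hv⟩, rfl⟩)
  have hm_r : ∀ v, VertOn lt arr (W : Set V) x v → ¬ arr x v → r1 v < m := fun v hv hv' => hm1 _ (by
    simp only [Finset.mem_union, Finset.mem_image, Finset.mem_filter]
    exact .inr ⟨v, ⟨(BurlingRel.vertOn_mem hv).2, hv, hv'⟩, rfl⟩)
  have hm_p : ∀ v ∈ W, arr x v → m < r1 v := fun v hv hv' => hm2 _ (by
    simp only [Finset.mem_image, Finset.mem_filter]
    exact ⟨v, ⟨hv, hv'⟩, rfl⟩)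
  -- shifts
  obtain ⟨M, hM⟩ := (insert m (RR.image l1 ∪ RR.image r1)).exists_le
  obtain ⟨C, hC⟩ := (D.image fun u => M + 1 - l2 u).exists_le
  obtain ⟨E, hE⟩ := (insert M (insert m (D.image fun u => r2 u + C))).exists_le
  have hMm : m ≤ M := hM _ (by simp)
  have hMl : ∀ v ∈ RR, l1 v ≤ M := fun v hv => hM _ (by simp; exact .inr (.inl ⟨v, hv, rfl⟩))
  have hMr : ∀ v ∈ RR, r1 v ≤ M := fun v hv => hM _ (by simp; exact .inr (.inr ⟨v, hv, rfl⟩))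
  have hCD : ∀ u ∈ D, M < l2 u + C := fun u hu => by
    have := hC _ (Finset.mem_image_of_mem _ hu)
    linarith
  have hEM : M ≤ E := hE _ (by simp)
  have hED : ∀ u ∈ D, r2 u + C ≤ E := fun u hu => hE _ (by simp; exact .inr (.inr ⟨u, hu, rfl⟩))
  let l : V → ℝ := fun u => if u = x then m else if u ∈ RR then l1 u else l2 u + C
  let r : V → ℝ := fun u => if u = x then E + 1 else if u ∈ RR then r1 u else r2 u + C
  have lx : l x = m := by simp [l]
  have rx : r x = E + 1 := by simp [r]
  have lR : ∀ u ∈ RR, l u = l1 u := fun u hu => by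
    have : u ≠ x := by rintro rfl; exact hxR hu
    simp [l, this, hu]
  have rR : ∀ u ∈ RR, r u = r1 u := fun u hu => by
    have : u ≠ x := by rintro rfl; exact hxR hu
    simp [r, this, hu]
  have lD : ∀ u ∈ D, l u = l2 u + C := fun u hu => by
    have h1 : u ≠ x := by rintro rfl; exact hxD hu
    have h2 : u ∉ RR := fun h => hRD u h hu
    simp [l, h1, h2]
  have rD : ∀ u ∈ D, r u = r2 u + C := fun u hu => by
    have h1 : u ≠ x := by rintro rfl; exact hxD hu
    have h2 : u ∉ RR := fun h => hRD u h hu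
    simp [r, h1, h2]
  refine ⟨l, r, ?_, ?_, ?_, ?_, ?_, ?_⟩
  · intro u hu
    rcases hcase u hu with e | rfl | e
    · rw [lR u e, rR u e]; exact H1.left_lt_right u e
    · rw [lx, rx]; linarith
    · rw [lD u e, rD u e]
      have := H2.left_lt_right u e
      linarith
  · intro u v huv
    rcases hcase u (BurlingRel.vertOn_mem huv).1 with e | rfl | e
    · obtain ⟨hv, hv'⟩ := vR u v huv e
      rw [lR u e, lR v hv]; exact H1.left_lt_left u v hv'
    · rw [lx, lR v (vx v huv).1]; exact hm_l v huv
    · rcases vD u v huv e with ⟨hv, hv'⟩ | rfl | hv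
      · rw [lD u e, lD v hv]
        have := H2.left_lt_left u v hv'
        linarith
      · rw [lx, lD u e]
        have := hCD u e
        linarith
      · rw [lR v hv, lD u e]
        have := hCD u e
        have := hMl v hv
        linarith
  · intro u v huv h1 h2
    rcases hcase u (BurlingRel.vertOn_mem huv).1 with e | rfl | e
    · obtain ⟨hv, hv'⟩ := vR u v huv e
      rw [lR u e, rR v hv]; exact H1.right_lt_left u v hv' h1 h2
    · rw [lx, rR v (vx v huv).1]; exact hm_r v huv h2
    · rcases vD u v huv e with ⟨hv, hv'⟩ | rfl | hv
      · rw [lD u e, rD v hv]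
        have := H2.right_lt_left u v hv' h1 h2
        linarith
      · exact absurd ((mD u).1 e).2 h1
      · rw [rR v hv, lD u e]
        have := hCD u e
        have := hMr v hv
        linarith
  · intro u hu v hv huv
    rcases hcase u hu with e | rfl | e
    · have hv := sR u e v hv (.inl huv)
      rw [rR u e, rR v hv]; exact H1.right_lt_right u e v hv huv
    · exact absurd huv (hroot v hv)
    · rcases hcase v hv with e' | rfl | e'
      · exact absurd huv (sDR u e v e').1
      · rw [rx, rD u e]
        have := hED u e
        linarith
      · rw [rD u e, rD v e']
        have := H2.right_lt_right u e v e' huv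
        linarith
  · intro u hu v hv huv
    rcases hcase u hu with e | rfl | e
    · have hv := sR u e v hv (.inr huv)
      rw [lR u e, rR v hv]; exact H1.left_lt_right_of_arr u e v hv huv
    · rw [lx, rR v (sx v hv (.inr huv)).1]; exact hm_p v hv huv
    · rcases hcase v hv with e' | rfl | e'
      · exact absurd huv (sDR u e v e').2
      · exact absurd huv (sDx u e)
      · rw [lD u e, rD v e']
        have := H2.left_lt_right_of_arr u e v e' huv
        linarith
  · intro u hu v hv huv
    rcases hcase u hu with e | rfl | e
    · have hv := sR u e v hv (.inr huv)
      rw [rR u e, rR v hv]; exact H1.right_lt_right_of_arr u e v hv huv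
    · have hvR := (sx v hv (.inr huv)).1
      rw [rx, rR v hvR]
      have := hMr v hvR
      linarith
    · rcases hcase v hv with e' | rfl | e'
      · exact absurd huv (sDR u e v e').2
      · exact absurd huv (sDx u e)
      · rw [rD u e, rD v e']
        have := H2.right_lt_right_of_arr u e v e' huv
        linarith

/-! ### Coordinates -/

/-- The order constraints between the left (kind in `z`) and right (kind not in `z`) sides. -/
def SideStep {κ V : Type*} (z : κ → Prop) (lt arr vert : V → V → Prop) (e f : κ × V) : Prop :=
  (z e.1 ∧ z f.1 ∧ vert f.2 e.2) ∨
  (¬ z e.1 ∧ z f.1 ∧ vert f.2 e.2 ∧ ¬ lt f.2 e.2 ∧ ¬ arr f.2 e.2) ∨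
  (¬ z e.1 ∧ ¬ z f.1 ∧ (lt e.2 f.2 ∨ arr f.2 e.2)) ∨
  (z e.1 ∧ ¬ z f.1 ∧ (arr e.2 f.2 ∨ e.2 = f.2))

open Classical in
/-- The number of predecessors. -/
noncomputable def predCount {κ V : Type*} [Fintype κ] [Fintype V] (R : κ × V → κ × V → Prop)
    (e : κ × V) : ℕ := ∑ k, ∑ w, if R (k, w) e then 1 else 0

/-- Counting predecessors turns a finite strict order into natural coordinates by plain summation,
which the tables can express. -/
theorem predCount_lt {κ V : Type*} [Fintype κ] [Fintype V] {R : κ × V → κ × V → Prop}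
    (hirr : ∀ e, ¬ R e e) (htrans : ∀ e f g, R e f → R f g → R e g) {e f : κ × V} (h : R e f) :
    predCount R e < predCount R f := by
  classical
  unfold predCount
  rw [← Fintype.sum_prod_type' (f := fun k w => if R (k, w) e then 1 else 0),
    ← Fintype.sum_prod_type' (f := fun k w => if R (k, w) f then 1 else 0)]
  refine Finset.sum_lt_sum (fun g _ => ?_) ⟨e, Finset.mem_univ _, ?_⟩
  · have := htrans g e f
    split_ifs <;> simp_all
  · simp [hirr, h]

/-- The counted horizontal coordinates satisfy the constraints. -/
theorem BurlingRel.horizontalOn_predCount {κ V : Type*} [Fintype κ] [Fintype V]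
    {lt arr : V → V → Prop} (h : BurlingRel lt arr) {z : κ → Prop} {k₀ k₁ : κ} (h0 : z k₀)
    (h1 : ¬ z k₁) :
    HorizontalOn lt arr Set.univ
      (fun v => predCount (Relation.TransGen (SideStep z lt arr (VertOn lt arr Set.univ))) (k₀, v))
      (fun v => predCount (Relation.TransGen (SideStep z lt arr (VertOn lt arr Set.univ))) (k₁, v)) := by
  classical
  -- The real coordinates serve only to show that the system of constraints has no cycle.
  obtain ⟨l, r, H⟩ := h.exists_horizontalOn Finset.univ
  rw [Finset.coe_univ] at H
  let p : κ × V → ℝ := fun e => if z e.1 then l e.2 else r e.2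
  have hstep : ∀ e f, SideStep z lt arr (VertOn lt arr Set.univ) e f → p e < p f := by
    rintro ⟨k, u⟩ ⟨k', v⟩ (⟨a, b, c⟩ | ⟨a, b, c, d, d'⟩ | ⟨a, b, c | c⟩ | ⟨a, b, c | c⟩) <;>
      simp only at a b c <;> simp only [p, a, b, if_true, if_false]
    · exact H.left_lt_left _ _ c
    · exact H.right_lt_left _ _ c d d'
    · exact H.right_lt_right _ (Set.mem_univ _) _ (Set.mem_univ _) c
    · exact H.right_lt_right_of_arr _ (Set.mem_univ _) _ (Set.mem_univ _) c
    · exact H.left_lt_right_of_arr _ (Set.mem_univ _) _ (Set.mem_univ _) c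
    · exact c ▸ H.left_lt_right _ (Set.mem_univ _)
  have htrans : ∀ e f, Relation.TransGen (SideStep z lt arr (VertOn lt arr Set.univ)) e f →
      p e < p f := by
    intro e f hef
    induction hef with
    | single hs => exact hstep _ _ hs
    | tail _ hs ih => exact ih.trans (hstep _ _ hs)
  have key : ∀ e f, SideStep z lt arr (VertOn lt arr Set.univ) e f →
      predCount (Relation.TransGen (SideStep z lt arr (VertOn lt arr Set.univ))) e <
      predCount (Relation.TransGen (SideStep z lt arr (VertOn lt arr Set.univ))) f :=
    fun e f hef => predCount_lt (fun e he => lt_irrefl _ (htrans e e he))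
      (fun _ _ _ => Relation.TransGen.trans) (.single hef)
  refine ⟨fun u _ => key _ _ ?_, fun u v huv => key _ _ ?_, fun u v huv a b => key _ _ ?_,
    fun u _ v _ huv => key _ _ ?_, fun u _ v _ huv => key _ _ ?_, fun u _ v _ huv => key _ _ ?_⟩
  · exact .inr (.inr (.inr ⟨h0, h1, .inr rfl⟩))
  · exact .inl ⟨h0, h0, huv⟩
  · exact .inr (.inl ⟨h1, h0, huv, a, b⟩)
  · exact .inr (.inr (.inl ⟨h1, h1, .inl huv⟩))
  · exact .inr (.inr (.inr ⟨h0, h1, .inl huv⟩))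
  · exact .inr (.inr (.inl ⟨h1, h1, .inr huv⟩))

theorem mem_frame {l r b t x y : ℝ} : (x, y) ∈ frame l r b t ↔
    ((x = l ∨ x = r) ∧ b ≤ y ∧ y ≤ t) ∨ ((l ≤ x ∧ x ≤ r) ∧ (y = b ∨ y = t)) := by
  simp [frame]

/-- Frames with separated, nested or crossing rectangles. -/
theorem frame_inter_eq_empty {l r b t l' r' b' t' : ℝ} (h1 : l < r) (h2 : b < t) (h1' : l' < r')
    (h2' : b' < t') (h : r < l' ∨ t < b' ∨ (l' < l ∧ r < r' ∧ b' < b ∧ t < t')) :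
    ¬ (frame l r b t ∩ frame l' r' b' t').Nonempty := by
  rintro ⟨⟨x, y⟩, hx, hy⟩
  rw [mem_frame] at hx hy
  have e1 : l ≤ x ∧ x ≤ r ∧ b ≤ y ∧ y ≤ t := by
    rcases hx with ⟨rfl | rfl, a⟩ | ⟨a, rfl | rfl⟩ <;>
      exact ⟨by linarith [a.1, a.2], by linarith [a.1, a.2], by linarith [a.1, a.2],
        by linarith [a.1, a.2]⟩
  obtain ⟨p1, p2, p3, p4⟩ := e1
  rcases h with h | h | ⟨a1, a2, a3, a4⟩
  · rcases hy with ⟨rfl | rfl, a⟩ | ⟨a, rfl | rfl⟩ <;> linarith [a.1, a.2]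
  · rcases hy with ⟨rfl | rfl, a⟩ | ⟨a, rfl | rfl⟩ <;> linarith [a.1, a.2]
  · rcases hy with ⟨rfl | rfl, a⟩ | ⟨a, rfl | rfl⟩ <;> linarith [a.1, a.2]

theorem frame_inter_nonempty {l r b t l' r' b' t' : ℝ} (h2 : b < t) (a1 : l < r') (a2 : r' < r)
    (a3 : b' < b) (a4 : t < t') : (frame l r b t ∩ frame l' r' b' t').Nonempty :=
  ⟨(r', b), mem_frame.2 (.inr ⟨⟨a1.le, a2.le⟩, .inl rfl⟩),
    mem_frame.2 (.inl ⟨.inr rfl, a3.le, by linarith⟩)⟩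

/-- The four corners of the first frame do not lie on the second one. -/
def CornersOff (l r b t l' r' b' t' : ℝ) : Prop :=
  (l, b) ∉ frame l' r' b' t' ∧ (l, t) ∉ frame l' r' b' t' ∧
  (r, b) ∉ frame l' r' b' t' ∧ (r, t) ∉ frame l' r' b' t'

theorem cornersOff_of_inter_empty {l r b t l' r' b' t' : ℝ} (h1 : l < r) (h2 : b < t)
    (h : ¬ (frame l r b t ∩ frame l' r' b' t').Nonempty) : CornersOff l r b t l' r' b' t' := by
  refine ⟨fun e => h ⟨_, ?_, e⟩, fun e => h ⟨_, ?_, e⟩, fun e => h ⟨_, ?_, e⟩,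
    fun e => h ⟨_, ?_, e⟩⟩ <;> rw [mem_frame] <;> left <;>
    exact ⟨by simp, by linarith, by linarith⟩

theorem cornersOff_of_cross {l r b t l' r' b' t' : ℝ} (a0 : l' < l) (a1 : l < r') (a2 : r' < r)
    (a3 : b' < b) (a : b < t) (a4 : t < t') : CornersOff l r b t l' r' b' t' ∧
      CornersOff l' r' b' t' l r b t := by
  refine ⟨⟨?_, ?_, ?_, ?_⟩, ?_, ?_, ?_, ?_⟩ <;> rw [mem_frame] <;>
    rintro (⟨e | e, e1, e2⟩ | ⟨⟨e1, e2⟩, e | e⟩) <;> linarith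

/-- Vertically incomparable vertices have disjoint vertical intervals. Comparable vertices without
an arrow between them have nested frames or frames separated horizontally, and an arrow produces
precisely the crossing that strictness permits. -/
theorem BurlingRel.isStrictFrameRep {V : Type*} [Fintype V] [LinearOrder V] {G : SimpleGraph V}
    {lt arr : V → V → Prop} (h : BurlingRel lt arr) (hO : Orients G.Adj arr) {l r : V → ℕ}
    (H : HorizontalOn lt arr Set.univ l r) :
    IsStrictFrameRep G (fun v => (l v : ℝ)) (fun v => (r v : ℝ))
      (fun v => (intervalStart (VertOn lt arr Set.univ) v : ℝ))
      (fun v => (intervalEnd (VertOn lt arr Set.univ) v : ℝ)) := by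
  have F := h.vertOn_forestOrder Set.univ
  set R := VertOn lt arr Set.univ with hR
  have hlr : ∀ v, (l v : ℝ) < r v := fun v => by exact_mod_cast H.left_lt_right v trivial
  have hbt : ∀ v, (intervalStart R v : ℝ) < intervalEnd R v := fun v => by
    exact_mod_cast ForestOrder.intervalStart_lt v
  have hv : ∀ u v, R u v → (intervalStart R v : ℝ) < intervalStart R u ∧
      (intervalEnd R u : ℝ) < intervalEnd R v := fun u v huv => by
    exact_mod_cast And.intro (F.intervalStart_lt_of_rel huv) (F.intervalEnd_lt_of_rel huv)
  have hleft : ∀ u v, LeftOf R u v → (intervalEnd R u : ℝ) < intervalStart R v := fun u v huv => by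
    exact_mod_cast F.intervalEnd_lt_of_leftOf huv
  have h_lt : ∀ u v, lt u v → R u v := fun u v e => .single ⟨trivial, trivial, .inl e⟩
  have h_arr : ∀ u v, arr u v → R u v := fun u v e => .single ⟨trivial, trivial, .inr e⟩
  have hll : ∀ u v, R u v → (l v : ℝ) < l u := fun u v e => by
    exact_mod_cast H.left_lt_left u v e
  have hrl : ∀ u v, R u v → ¬ lt u v → ¬ arr u v → (r v : ℝ) < l u := fun u v e e1 e2 => by
    exact_mod_cast H.right_lt_left u v e e1 e2
  have hrr : ∀ u v, lt u v → (r u : ℝ) < r v := fun u v e => by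
    exact_mod_cast H.right_lt_right u trivial v trivial e
  have hlra : ∀ u v, arr u v → (l u : ℝ) < r v := fun u v e => by
    exact_mod_cast H.left_lt_right_of_arr u trivial v trivial e
  have hrra : ∀ u v, arr u v → (r v : ℝ) < r u := fun u v e => by
    exact_mod_cast H.right_lt_right_of_arr u trivial v trivial e
  -- the frames of non-adjacent vertices are disjoint
  have hempty : ∀ u v, R u v → ¬ arr u v →
      ¬ (frame (l u) (r u) (intervalStart R u) (intervalEnd R u) ∩
        frame (l v) (r v) (intervalStart R v) (intervalEnd R v)).Nonempty := by
    intro u v huv hna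
    by_cases e : lt u v
    · exact frame_inter_eq_empty (hlr u) (hbt u) (hlr v) (hbt v)
        (.inr (.inr ⟨hll u v huv, hrr u v e, (hv u v huv).1, (hv u v huv).2⟩))
    · rw [Set.inter_comm]
      exact frame_inter_eq_empty (hlr v) (hbt v) (hlr u) (hbt u) (.inl (hrl u v huv e hna))
  have hempty' : ∀ u v, LeftOf R u v →
      ¬ (frame (l u) (r u) (intervalStart R u) (intervalEnd R u) ∩
        frame (l v) (r v) (intervalStart R v) (intervalEnd R v)).Nonempty := fun u v huv =>
    frame_inter_eq_empty (hlr u) (hbt u) (hlr v) (hbt v) (.inr (.inl (hleft u v huv)))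
  have hdich : ∀ u v, u ≠ v → arr u v ∨ arr v u ∨
      (¬ arr u v ∧ ¬ arr v u ∧
      ¬ (frame (l u) (r u) (intervalStart R u) (intervalEnd R u) ∩
        frame (l v) (r v) (intervalStart R v) (intervalEnd R v)).Nonempty) := by
    intro u v hne
    by_cases e1 : arr u v
    · exact .inl e1
    by_cases e2 : arr v u
    · exact .inr (.inl e2)
    refine .inr (.inr ⟨e1, e2, ?_⟩)
    by_cases e3 : R u v
    · exact hempty u v e3 e1
    by_cases e4 : R v u
    · rw [Set.inter_comm]
      exact hempty v u e4 e2
    rcases F.leftOf_total hne e3 e4 with e | e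
    · exact hempty' u v e
    · rw [Set.inter_comm]
      exact hempty' v u e
  have hcross : ∀ u v, arr u v → (l v : ℝ) < l u ∧ (l u : ℝ) < r v ∧ (r v : ℝ) < r u ∧
      (intervalStart R v : ℝ) < intervalStart R u ∧ (intervalStart R u : ℝ) < intervalEnd R u ∧
      (intervalEnd R u : ℝ) < intervalEnd R v := fun u v e =>
    ⟨hll u v (h_arr u v e), hlra u v e, hrra u v e, (hv u v (h_arr u v e)).1, hbt u,
      (hv u v (h_arr u v e)).2⟩
  have hmeet : ∀ u v, arr u v →
      (frame (l u) (r u) (intervalStart R u) (intervalEnd R u) ∩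
        frame (l v) (r v) (intervalStart R v) (intervalEnd R v)).Nonempty := fun u v e => by
    obtain ⟨-, c2, c3, c4, c5, c6⟩ := hcross u v e
    exact frame_inter_nonempty c5 c2 c3 c4 c6
  have hnest : ∀ u v, (intervalStart R v : ℝ) < intervalStart R u →
      (intervalEnd R u : ℝ) < intervalEnd R v → R u v := by
    intro u v a b
    by_contra e3
    by_cases e4 : R v u
    · linarith [(hv v u e4).1]
    · have hne : u ≠ v := by rintro rfl; exact lt_irrefl _ a
      rcases F.leftOf_total hne e3 e4 with e | e
      · linarith [hleft u v e, hbt u, hbt v]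
      · linarith [hleft v u e, hbt u, hbt v]
  refine ⟨⟨hlr, hbt, ?_, ?_⟩, ?_, ?_⟩
  · intro u v hne
    rcases hdich u v hne with e | e | ⟨-, -, e⟩
    · obtain ⟨c1, c2, c3, c4, c5, c6⟩ := hcross u v e
      exact (cornersOff_of_cross c1 c2 c3 c4 c5 c6).1
    · obtain ⟨c1, c2, c3, c4, c5, c6⟩ := hcross v u e
      exact (cornersOff_of_cross c1 c2 c3 c4 c5 c6).2
    · exact cornersOff_of_inter_empty (hlr u) (hbt u) e
  · intro u v hne
    rw [hO u v]
    constructor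
    · rintro (e | e)
      · exact hmeet u v e
      · rw [Set.inter_comm]
        exact hmeet v u e
    · intro hm
      rcases hdich u v hne with e | e | ⟨-, -, e⟩
      · exact .inl e
      · exact .inr e
      · exact absurd hm e
  · intro i j hne hm
    rcases hdich i j hne with e | e | ⟨-, -, e⟩
    · exact .inr (hcross i j e)
    · exact .inl (hcross j i e)
    · exact absurd hm e
  -- The vertical intervals put `k` below `j` and `j` below `i`. As the left side of `k` precedes
  -- the right sides of `i` and `j`, each of these encloses `k` or receives an arrow from it, so the
  -- axioms would nest `i` and `j`. One direction contradicts the vertical order, the other the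
  -- right sides.
  · rintro ⟨i, j, k, ⟨a1, a2, a3, a4⟩, b1, b2, b3, b4, b5⟩
    have vji := hnest j i b1 b5
    have vkj := hnest k j b2 b4
    have vki := F.trans _ _ _ vkj vji
    have asym : ¬ lt i j := fun e => F.irrefl _ (F.trans _ _ _ (h_lt _ _ e) vji)
    have asym' : ¬ lt j i := fun e => by linarith [hrr j i e]
    have hne : i ≠ j := by rintro rfl; exact lt_irrefl _ a1
    have kj : lt k j ∨ arr k j := by
      by_contra! e
      linarith [hrl k j vkj e.1 e.2]
    have ki : lt k i ∨ arr k i := by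
      by_contra! e
      linarith [hrl k i vki e.1 e.2]
    rcases kj with kj | kj <;> rcases ki with ki | ki
    · rcases h.lt_lt _ _ _ kj ki with e | e | e
      exacts [hne e.symm, asym' e, asym e]
    · exact asym (h.arr_lt _ _ _ ki kj)
    · exact asym' (h.arr_lt _ _ _ kj ki)
    · rcases h.arr_arr _ _ _ kj ki with e | e | e
      exacts [hne e.symm, asym' e, asym e]

/-! ### Decomposition of a graph along a vertex -/

/-- The part of `{u | P u}` that is connected to `c` inside it. -/
inductive Comp {V : Type*} (adj : V → V → Prop) (P : V → Prop) (c : V) : V → Prop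
  | base : P c → Comp adj P c c
  | step {v u : V} : Comp adj P c v → adj v u → P u → Comp adj P c u

/-- `u` is neither `x` nor a neighbor of `x`. -/
def Far {V : Type*} (adj : V → V → Prop) (x u : V) : Prop := u ≠ x ∧ ¬ adj u x

/-- The component of `c` after the removal of `x` and its neighbors. -/
def Kern {V : Type*} (adj : V → V → Prop) (x c : V) : V → Prop := Comp adj (Far adj x) c

/-- A component together with its neighbors. -/
def Hood {V : Type*} (adj : V → V → Prop) (x c u : V) : Prop :=
  Kern adj x c u ∨ ∃ v, Kern adj x c v ∧ adj v u

/-- The component of `l` after the removal of `z` and its neighbors from `Hood adj x c`. -/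
def Part {V : Type*} (adj : V → V → Prop) (x c z l : V) : V → Prop :=
  Comp adj (fun u => Hood adj x c u ∧ Far adj z u) l

/-- The vertices through which the part of `l` is attached. -/
def Att {V : Type*} (adj : V → V → Prop) (x c z l w : V) : Prop :=
  Hood adj x c w ∧ ¬ Part adj x c z l w ∧ ∃ u, Part adj x c z l u ∧ adj w u

/-- `l` is the least vertex of its part. -/
def Rep {V : Type*} [LE V] (adj : V → V → Prop) (x c z l : V) : Prop :=
  Part adj x c z l l ∧ ∀ u, Part adj x c z l u → l ≤ u

/-- The attachments of part `l` have a common nonempty neighborhood in part `l'`. -/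
def NestIn {V : Type*} (adj : V → V → Prop) (part att : V → V → Prop) (l l' : V) : Prop :=
  (∃ y k, att l y ∧ part l' k ∧ adj y k) ∧
    ∀ y y' k, att l y → att l y' → part l' k → adj y k → adj y' k

/-- The tie-break of `NestIn` by the order of the vertices. -/
def Below {V : Type*} [LT V] (adj : V → V → Prop) (part att : V → V → Prop) (l l' : V) : Prop :=
  l ≠ l' ∧ NestIn adj part att l l' ∧ (NestIn adj part att l' l → l' < l)

/-- Parts with a common attachment can be nested. -/
def Compat {V : Type*} (adj : V → V → Prop) (part att : V → V → Prop) (l l' : V) : Prop :=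
  (∃ y, att l y ∧ att l' y) → NestIn adj part att l l' ∨ NestIn adj part att l' l

/-- The parts inside `S` are admissible and pairwise compatible. -/
def Good {V : Type*} [LE V] (adj : V → V → Prop) (A : V → V → V → V → Prop) (x c z : V)
    (S : V → Prop) : Prop :=
  ∀ l, Rep adj x c z l → S l → A x c z l ∧
    ∀ l', Rep adj x c z l' → S l' → l ≠ l' → Compat adj (Part adj x c z) (Att adj x c z) l l'

/-- `ρ` can be the outermost vertex of the component of `c`. -/
def IsTop {V : Type*} [LE V] (adj : V → V → Prop) (A : V → V → V → V → Prop) (x c ρ : V) : Prop :=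
  Kern adj x c ρ ∧ Good adj A x c ρ fun _ => True

/-- The part of `l` can be nested in `z`. -/
def Inner {V : Type*} [LE V] (adj : V → V → Prop) (A : V → V → V → V → Prop) (x c z l : V) :
    Prop :=
  (∀ u, Part adj x c z l u → Kern adj x c u) ∧ ∃ ρ, IsTop adj A z l ρ

/-- The part of `l` hangs at the single vertex `w`. -/
def Hangs {V : Type*} [LE V] (adj : V → V → Prop) (A : V → V → V → V → Prop) (x c z l w : V) :
    Prop :=
  Kern adj x c w ∧ (∀ v, Att adj x c z l v ↔ v = w) ∧ Good adj A x c w (Part adj x c z l)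

section Decomposition

variable {V : Type*} {adj : V → V → Prop} {x c z l u v w : V}

theorem Comp.mem {P : V → Prop} (h : Comp adj P c u) : P u := by
  cases h <;> assumption

theorem Comp.trans {P : V → Prop} (h : Comp adj P c u) (h' : Comp adj P u v) : Comp adj P c v := by
  induction h' with
  | base _ => exact h
  | step _ h1 h2 ih => exact .step ih h1 h2

theorem Comp.symm (hs : ∀ u v, adj u v → adj v u) {P : V → Prop} (h : Comp adj P c u) :
    Comp adj P u c := by
  induction h with
  | base h => exact .base h
  | step h h1 h2 ih => exact (Comp.step (.base h2) (hs _ _ h1) h.mem).trans ih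

theorem Comp.closed {P Q : V → Prop} (h : Comp adj P c u) (hc : Q c)
    (hQ : ∀ v u, Comp adj P c v → Comp adj P c u → Q v → adj v u → Q u) : Q u := by
  induction h with
  | base _ => exact hc
  | step h h1 h2 ih => exact hQ _ _ h (.step h h1 h2) ih h1

theorem Comp.closed_of (hs : ∀ u v, adj u v → adj v u) {P Q : V → Prop} (hv : Comp adj P c v)
    (h : Comp adj P c u) (hc : Q v)
    (hQ : ∀ v u, Comp adj P c v → Comp adj P c u → Q v → adj v u → Q u) : Q u := by
  have h' := (hv.symm hs).trans h
  exact h'.closed hc fun a b ha hb => hQ a b (hv.trans ha) (hv.trans hb)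

theorem Part.hood (h : Part adj x c z l u) : Hood adj x c u := (Comp.mem h).1
theorem Part.far (h : Part adj x c z l u) : Far adj z u := (Comp.mem h).2

theorem Part.mem (h : Part adj x c z l u) : Hood adj x c u ∧ Far adj z u :=
  Comp.mem (P := fun u => Hood adj x c u ∧ Far adj z u) h

/-- If `w` were far from `z`, its neighbour in the part would draw it into the part. -/
theorem Att.adj_of (h : Att adj x c z l w) (hz : w ≠ z) (hs : ∀ u v, adj u v → adj v u) :
    adj w z := by
  obtain ⟨h1, h2, u, hu, huw⟩ := h
  by_contra h
  exact h2 (.step hu (hs _ _ huw) ⟨h1, hz, h⟩)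

theorem Att.ne (h : Att adj x c z l w) (hs : ∀ u v, adj u v → adj v u) : w ≠ z := by
  rintro rfl
  obtain ⟨h1, h2, u, hu, huw⟩ := h
  exact (Part.far hu).2 (hs _ _ huw)

theorem Att.adj_top (h : Att adj x c z l w) (hs : ∀ u v, adj u v → adj v u) : adj w z :=
  h.adj_of (h.ne hs) hs

/-- A part that avoids the boundary of its surroundings is a component of the whole graph. -/
theorem kern_of_part (hK : ∀ u, Part adj x c z l u → Kern adj x c u) (hl : Part adj x c z l l) :
    Kern adj z l = Part adj x c z l := by
  funext u
  refine propext ⟨fun h => ?_, fun h => ?_⟩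
  · refine Comp.closed (Q := Part adj x c z l) h hl fun v u _ hu hv huv => ?_
    exact .step hv huv ⟨.inr ⟨v, hK v hv, huv⟩, Comp.mem hu⟩
  · refine Comp.closed (Q := Kern adj z l) h (.base hl.far) fun v u _ hu hv huv => ?_
    exact .step hv huv (Part.far hu)

theorem hood_of_part (hs : ∀ u v, adj u v → adj v u)
    (hK : ∀ u, Part adj x c z l u → Kern adj x c u) (hl : Part adj x c z l l) :
    Hood adj z l u ↔ Part adj x c z l u ∨ Att adj x c z l u := by
  unfold Hood
  rw [kern_of_part hK hl]
  constructor
  · rintro (h | ⟨v, hv, hvu⟩)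
    · exact .inl h
    · by_cases h : Part adj x c z l u
      · exact .inl h
      · exact .inr ⟨.inr ⟨v, hK v hv, hvu⟩, h, v, hv, hs _ _ hvu⟩
  · rintro (h | ⟨_, _, v, hv, huv⟩)
    · exact .inl h
    · exact .inr ⟨v, hv, hs _ _ huv⟩

/-- The connected set `Kern adj x c` meets the part and contains `z`, which is outside the part.
Without attachments the part would swallow the whole set. -/
theorem exists_att (hs : ∀ u v, adj u v → adj v u) (hz : Kern adj x c z)
    (hl : Part adj x c z l l) : ∃ w, Att adj x c z l w := by
  by_contra! hno
  have hcl : ∀ u w, Part adj x c z l u → Hood adj x c w → adj u w → Part adj x c z l w := by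
    intro u w hu hw huw
    by_contra h
    exact hno w ⟨hw, h, u, hu, hs _ _ huw⟩
  obtain ⟨k, hk, hkl⟩ : ∃ k, Kern adj x c k ∧ Part adj x c z l k := by
    rcases hl.hood with h | ⟨v, hv, hvl⟩
    · exact ⟨l, h, hl⟩
    · exact ⟨v, hv, hcl l v hl (.inl hv) (hs _ _ hvl)⟩
  have := Comp.closed_of (Q := Part adj x c z l) hs hk hz hkl fun a b _ hb ha hab =>
    hcl a b ha (.inl hb) hab
  exact this.far.1 rfl

/-- A path can leave the part of `l` only through `w`, and `w` is removed. -/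
theorem part_subset (hs : ∀ u v, adj u v → adj v u) (hw : ∀ v, Att adj x c z l v → v = w)
    {l' : V} (hl' : Part adj x c z l l') (h : Part adj x c w l' u) : Part adj x c z l u := by
  refine Comp.closed (Q := Part adj x c z l) h hl' fun v u _ hu hv huv => ?_
  by_contra hn
  exact (Part.far hu).1 (hw u ⟨Part.hood hu, hn, v, hv, hs _ _ huv⟩)

theorem rep_eq [PartialOrder V] (hs : ∀ u v, adj u v → adj v u) {l' : V} (h : Rep adj x c z l)
    (h' : Rep adj x c z l') (hu : Part adj x c z l u) (hu' : Part adj x c z l' u) : l = l' := by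
  have e : Part adj x c z l l' := Comp.trans hu (Comp.symm hs hu')
  exact le_antisymm (h.2 _ e) (h'.2 _ (Comp.symm hs e))

theorem exists_rep [LinearOrder V] [Finite V] (hs : ∀ u v, adj u v → adj v u)
    (h : Hood adj x c u) (hu : Far adj z u) : ∃ l, Rep adj x c z l ∧ Part adj x c z l u := by
  have hu' : Part adj x c z u u := .base ⟨h, hu⟩
  obtain ⟨l, hl, hmin⟩ := Set.exists_min_image {v | Part adj x c z u v} id (Set.toFinite _) ⟨u, hu'⟩
  have e := Comp.symm hs hl
  exact ⟨l, ⟨.base (Part.mem hl), fun v hv => hmin v (Comp.trans hl hv)⟩, e⟩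

end Decomposition

/-! ### Burling relations pass to the parts -/

/-- The members of `Y` are outermost in `R`, contain nothing, and receive no edge. -/
def Probes {V : Type*} (lt arr : V → V → Prop) (R Y : V → Prop) : Prop :=
  ∀ y v, Y y → R y → R v → ¬ lt y v ∧ ¬ lt v y ∧ ¬ arr v y

/-- `z` is outermost in `R` and emits no edge. -/
def SinkRoot {V : Type*} (lt arr : V → V → Prop) (R : V → Prop) (z : V) : Prop :=
  ∀ v, R v → ¬ lt z v ∧ ¬ arr z v

/-- The vertices that reach `w` by descending edges and containment. -/
inductive Branch {V : Type*} (lt arr : V → V → Prop) (R : V → Prop) (w : V) : V → Prop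
  | base {u : V} : R u → u = w ∨ lt u w → Branch lt arr R w u
  | step {u v j : V} : R u → R v → (∀ t, R t → ¬ lt v t) → Branch lt arr R w j → arr v j →
      u = v ∨ lt u v → Branch lt arr R w u

/-! ### Closure properties of branches and of the interior of a vertex. -/

section Region

variable {V : Type*} {adj lt arr : V → V → Prop} {R : V → Prop} {z w : V}

theorem BurlingRel.root_of_arr (h : BurlingRel lt arr) {a b : V}
    (hb : ∀ t, R t → ¬ lt b t) (hab : arr a b) : ∀ t, R t → ¬ lt a t :=
  fun t ht hat => hb t ht (h.arr_lt _ _ _ hab hat)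

theorem Branch.mem (hu : Branch lt arr R w z) : R z := by
  cases hu <;> assumption

theorem Branch.down (h : BurlingRel lt arr) {u v : V} (hu : Branch lt arr R w u) (hv : R v)
    (hvu : lt v u) : Branch lt arr R w v := by
  cases hu with
  | base _ h1 =>
    refine .base hv (.inr ?_)
    rcases h1 with rfl | h1
    · exact hvu
    · exact h.trans _ _ _ hvu h1
  | step _ h1 h2 h3 h4 h5 =>
    refine .step hv h1 h2 h3 h4 (.inr ?_)
    rcases h5 with rfl | h5
    · exact hvu
    · exact h.trans _ _ _ hvu h5

theorem Branch.up (h : BurlingRel lt arr) {u v : V} (hw : ∀ t, R t → ¬ lt w t)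
    (hu : Branch lt arr R w u) (hv : R v) (huv : lt u v) : Branch lt arr R w v := by
  cases hu with
  | base _ h1 =>
    rcases h1 with rfl | h1
    · exact absurd huv (hw v hv)
    · rcases h.lt_lt _ _ _ h1 huv with h2 | h2 | h2
      · exact .base hv (.inl h2.symm)
      · exact absurd h2 (hw v hv)
      · exact .base hv (.inr h2)
  | step _ h1 h2 h3 h4 h5 =>
    rcases h5 with rfl | h5
    · exact absurd huv (h2 v hv)
    · rcases h.lt_lt _ _ _ h5 huv with h6 | h6 | h6
      · exact .step hv h1 h2 h3 h4 (.inl h6.symm)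
      · exact absurd h6 (h2 v hv)
      · exact .step hv h1 h2 h3 h4 (.inr h6)

/-- Arrows leave the branch only at `w`. At any other outermost member the new target is comparable
with a target `j` that already belongs to the branch, and the branch is closed under nesting in both
directions. -/
theorem Branch.of_arr (h : BurlingRel lt arr) {u v : V} (hw : ∀ t, R t → ¬ lt w t)
    (hu : Branch lt arr R w u) (huw : u ≠ w) (hv : R v) (huv : arr u v) : Branch lt arr R w v := by
  cases hu with
  | base _ h1 =>
    rcases h1 with rfl | h1
    · exact absurd rfl huw
    · exact .base hv (.inr (h.arr_lt _ _ _ huv h1))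
  | step _ h1 h2 h3 h4 h5 =>
    rcases h5 with rfl | h5
    · rcases h.arr_arr _ _ _ h4 huv with h6 | h6 | h6
      · exact h6 ▸ h3
      · exact h3.up h hw hv h6
      · exact h3.down h hv h6
    · exact .step hv h1 h2 h3 h4 (.inr (h.arr_lt _ _ _ huv h5))

theorem Branch.of_arr_rev (h : BurlingRel lt arr) {u v : V} (hw : ∀ t, R t → ¬ lt w t) (hwR : R w)
    (hu : Branch lt arr R w u) (hv : R v) (hvu : arr v u) : Branch lt arr R w v := by
  have base : ∀ j, Branch lt arr R w j → (∀ t, R t → ¬ lt j t) → arr v j → Branch lt arr R w v :=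
    fun j hj hr hvj => .step hv hv (h.root_of_arr hr hvj) hj hvj (.inl rfl)
  cases hu with
  | base hu h1 =>
    rcases h1 with rfl | h1
    · exact base _ (.base hu (.inl rfl)) hw hvu
    · rcases h.lt_arr _ _ _ hvu h1 with h2 | h2
      · exact base _ (.base hwR (.inl rfl)) hw h2
      · exact .base hv (.inr h2)
  | step hu h1 h2 h3 h4 h5 =>
    have hb := Branch.step h1 h1 h2 h3 h4 (.inl rfl)
    rcases h5 with rfl | h5
    · exact base _ hb h2 hvu
    · rcases h.lt_arr _ _ _ hvu h5 with h6 | h6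
      · exact base _ hb h2 h6
      · exact hb.down h hv h6

theorem Branch.not_below (h : BurlingRel lt arr) {u : V} (hz : SinkRoot lt arr R z)
    (hwR : R w) (hwz : arr w z) (hu : Branch lt arr R w u) : u ≠ z ∧ ¬ lt u z := by
  have key : ∀ r u, R r → R u → r ≠ z → ¬ lt r z → u = r ∨ lt u r → u ≠ z ∧ ¬ lt u z := by
    rintro r u hr hu h1 h2 (rfl | h3)
    · exact ⟨h1, h2⟩
    · refine ⟨fun e => (hz r hr).1 (e ▸ h3), fun h4 => ?_⟩
      rcases h.lt_lt _ _ _ h3 h4 with h5 | h5 | h5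
      · exact h1 h5
      · exact h2 h5
      · exact (hz r hr).1 h5
  induction hu with
  | base hu h1 =>
    refine key w _ hwR hu ?_ ?_ h1
    · rintro rfl
      exact (hz w hwR).2 hwz
    · exact fun h2 => h.irrefl _ (h.arr_lt _ _ _ hwz h2)
  | step hu h1 h2 h3 h4 h5 ih =>
    refine key _ _ h1 hu ?_ ?_ h5
    · rintro rfl
      exact (hz _ h3.mem).2 h4
    · exact fun h6 => ih.2 (h.arr_lt _ _ _ h4 h6)

/-- A nested member cannot emit the arrow, since its outermost member would then enclose `z`. An
outermost member other than `w` also has an arrow to some `j` of the branch; then `j` and `z` are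
comparable, against `Branch.not_below` or the maximality of `z`. -/
theorem Branch.eq_of_arr (h : BurlingRel lt arr) {u : V} (hz : SinkRoot lt arr R z)
    (hwR : R w) (hwz : arr w z) (hu : Branch lt arr R w u) (huz : arr u z) : u = w := by
  cases hu with
  | base hu h1 =>
    rcases h1 with rfl | h1
    · rfl
    · exact absurd (h.arr_lt _ _ _ huz h1) (hz w hwR).1
  | step hu h1 h2 h3 h4 h5 =>
    rcases h5 with rfl | h5
    · have := h3.not_below h hz hwR hwz
      rcases h.arr_arr _ _ _ h4 huz with h6 | h6 | h6
      · exact absurd h6 this.1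
      · exact absurd h6 this.2
      · exact absurd h6 (hz _ h3.mem).1
    · exact absurd (h.arr_lt _ _ _ huz h5) (hz _ h1).1

/-- No edge leaves the interior of `t` without producing a neighbour of `t`: arrows from the
interior end inside by `arr_lt`, and by `lt_arr` the source of an arrow into the interior is inside
or has an arrow to `t`. -/
theorem Comp.lt_of_lt (h : BurlingRel lt arr) (hs : ∀ u v, adj u v → adj v u)
    (hO : Orients adj arr) {P : V → Prop} {c a b t : V} (ha : Comp adj P c a) (hb : Comp adj P c b)
    (hP : ∀ v, Comp adj P c v → ¬ adj v t) (hat : lt a t) : lt b t := by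
  refine Comp.closed_of (Q := fun v => lt v t) hs ha hb hat fun u v _ hv hu huv => ?_
  rcases (hO u v).1 huv with h1 | h1
  · exact h.arr_lt _ _ _ h1 hu
  · rcases h.lt_arr _ _ _ h1 hu with h2 | h2
    · exact absurd ((hO v t).2 (.inl h2)) (hP v hv)
    · exact h2

end Region

/-! ### Nested parts, hanging parts and their compatibility. -/

section Completeness

variable {V : Type*} {adj lt arr : V → V → Prop} {R : V → Prop} {x c z l : V}

/-- The region `R` contains the part of `l` with its attachments. -/
def Covers (adj : V → V → Prop) (R : V → Prop) (x c z l : V) : Prop :=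
  Part adj x c z l l ∧ ∀ u, Part adj x c z l u ∨ Att adj x c z l u → R u

theorem arr_of_att (hO : Orients adj arr) (hz : SinkRoot lt arr R z) (hs : ∀ u v, adj u v → adj v u)
    (hc : Covers adj R x c z l) {w : V} (hw : Att adj x c z l w) : arr w z :=
  ((hO _ _).1 (hw.adj_top hs)).resolve_right (hz w (hc.2 w (.inr hw))).2

/-- The part lies inside the outermost vertex `z`, while each attachment has an arrow to `z`. Any
forbidden relation would make the attachment comparable with `z` or yield a vertex of the region
enclosing `z`. -/
theorem probes_of_lt (h : BurlingRel lt arr) (hO : Orients adj arr)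
    (hs : ∀ u v, adj u v → adj v u) (hz : SinkRoot lt arr R z) (hc : Covers adj R x c z l)
    (hL : ∀ u, Part adj x c z l u → lt u z) :
    Probes lt arr (fun u => Part adj x c z l u ∨ Att adj x c z l u) (Att adj x c z l) := by
  intro y v hy _ hv
  have hyz := arr_of_att hO hz hs hc hy
  have hyR := hc.2 y (.inr hy)
  have hnz : ¬ lt y z := fun h1 => h.irrefl _ (h.arr_lt _ _ _ hyz h1)
  have noup : ∀ a b, Att adj x c z l a → Part adj x c z l b ∨ Att adj x c z l b → ¬ lt a b := by
    intro a b ha hb hab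
    have haz := arr_of_att hO hz hs hc ha
    exact (hz b (hc.2 b hb)).1 (h.arr_lt _ _ _ haz hab)
  have excl : ¬ (y = z ∨ lt y z ∨ lt z y) := by
    rintro (h1 | h1 | h1)
    · exact hy.ne hs h1
    · exact hnz h1
    · exact (hz y hyR).1 h1
  refine ⟨noup y v hy hv, fun h1 => ?_, fun h1 => ?_⟩
  · rcases hv with hv | hv
    · exact excl (h.lt_lt _ _ _ h1 (hL v hv))
    · exact noup v y hv (.inr hy) h1
  · rcases hv with hv | hv
    · exact hnz (h.arr_lt _ _ _ h1 (hL v hv))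
    · exact excl (h.arr_arr _ _ _ h1 (arr_of_att hO hz hs hc hv))

theorem part_lt (h : BurlingRel lt arr) (hO : Orients adj arr) (hs : ∀ u v, adj u v → adj v u)
    {a b : V} (ha : Part adj x c z l a) (hb : Part adj x c z l b) (haz : lt a z) : lt b z :=
  Comp.lt_of_lt h hs hO ha hb (fun _ hv => (Part.far hv).2) haz

/-- An out-neighbour of `w` is comparable with `z`, so arrows between `w` and a part outside `z`
point to `w`. Hence the part enters the branch of `w` and, being connected, stays in it. A further
attachment would belong to the branch as well and have an arrow to `z`, so `Branch.eq_of_arr`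
identifies it with `w`. -/
theorem att_unique (h : BurlingRel lt arr) (hO : Orients adj arr) (hs : ∀ u v, adj u v → adj v u)
    (hz : SinkRoot lt arr R z) (hc : Covers adj R x c z l)
    (hL : ∀ u, Part adj x c z l u → ¬ lt u z) {w : V} (hw : Att adj x c z l w) :
    (∀ u, Part adj x c z l u → ¬ lt w u ∧ ¬ arr w u) ∧ (∃ u, Part adj x c z l u ∧ arr u w) ∧
      ∀ v, Att adj x c z l v → v = w := by
  have hwR := hc.2 w (.inr hw)
  have hwz := arr_of_att hO hz hs hc hw
  have hroot : ∀ t, R t → ¬ lt w t := fun t ht h1 => (hz t ht).1 (h.arr_lt _ _ _ hwz h1)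
  have hnarr : ∀ u, Part adj x c z l u → ¬ arr w u := by
    intro u hu h1
    rcases h.arr_arr _ _ _ h1 hwz with h2 | h2 | h2
    · exact hu.far.1 h2
    · exact hL u hu h2
    · exact (hz u (hc.2 u (.inl hu))).1 h2
  obtain ⟨u, hu, hwu⟩ := hw.2.2
  have huw : arr u w := ((hO _ _).1 hwu).resolve_left (hnarr u hu)
  have hcl : ∀ a b, Part adj x c z l a → R b → Branch lt arr R w a → adj a b →
      Branch lt arr R w b := by
    intro a b ha hb hBa hab
    rcases (hO a b).1 hab with h1 | h1
    · exact hBa.of_arr h hroot (fun e => hw.2.1 (e ▸ ha)) hb h1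
    · exact hBa.of_arr_rev h hroot hwR hb h1
  have hBu : Branch lt arr R w u :=
    (Branch.base hwR (.inl rfl)).of_arr_rev h hroot hwR (hc.2 u (.inl hu)) huw
  refine ⟨fun a ha => ⟨hroot a (hc.2 a (.inl ha)), hnarr a ha⟩, ⟨u, hu, huw⟩, fun v hv => ?_⟩
  obtain ⟨a, ha, hva⟩ := hv.2.2
  have hBa : Branch lt arr R w a := Comp.closed_of (Q := Branch lt arr R w) hs hu ha hBu
    fun a b ha hb hBa hab => hcl a b ha (hc.2 b (.inl hb)) hBa hab
  exact (hcl a v ha (hc.2 v (.inr hv)) hBa (hs _ _ hva)).eq_of_arr h hz hwR hwz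
    (arr_of_att hO hz hs hc hv)

/-- No edge joins different parts, so by `Comp.lt_of_lt` a vertex that encloses one vertex of
another part encloses all of it. If an attachment of `l` sees `b` in the other part, then `b`
encloses the part of `l`, and `lt_arr` lets every attachment of `l` see `b`. -/
theorem nestIn_of_lt (h : BurlingRel lt arr) (hO : Orients adj arr)
    (hs : ∀ u v, adj u v → adj v u) (hz : SinkRoot lt arr R z) {l' : V}
    (hc : Covers adj R x c z l) (hc' : Covers adj R x c z l')
    (hL : ∀ u, Part adj x c z l u → lt u z) (hL' : ∀ u, Part adj x c z l' u → lt u z)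
    (hne : ∀ u, Part adj x c z l u → ¬ Part adj x c z l' u) {y k k' : V} (hy : Att adj x c z l y)
    (hk : Part adj x c z l k) (hk' : Part adj x c z l' k') (hyk' : adj y k') (hkk : lt k k') :
    NestIn adj (Part adj x c z) (Att adj x c z) l l' := by
  have hna : ∀ a b, Part adj x c z l a → Part adj x c z l' b → ¬ adj a b := fun a b ha hb hab =>
    hne b (.step ha hab (Part.mem hb)) hb
  have below : ∀ a a' b, Part adj x c z l a → Part adj x c z l a' → Part adj x c z l' b →
      lt a b → lt a' b := fun a a' b ha ha' hb hab =>
    Comp.lt_of_lt h hs hO ha ha' (fun v hv => hna v b hv hb) hab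
  have below' : ∀ a a' b, Part adj x c z l' a → Part adj x c z l' a' → Part adj x c z l b →
      lt a b → lt a' b := fun a a' b ha ha' hb hab =>
    Comp.lt_of_lt h hs hO ha ha' (fun v hv h' => hna b v hb hv (hs _ _ h')) hab
  refine ⟨⟨y, k', hy, hk', hyk'⟩, fun y1 y2 b hy1 hy2 hb hy1b => ?_⟩
  have hP := probes_of_lt h hO hs hz hc hL
  have hP' := probes_of_lt h hO hs hz hc' hL'
  have out : ∀ a t, Att adj x c z l a → Part adj x c z l t → adj a t → arr a t :=
    fun a t ha ht hat =>
      ((hO _ _).1 hat).resolve_right (hP a t ha (.inr ha) (.inl ht)).2.2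
  have hy1' : Att adj x c z l' y1 := ⟨hy1.1, fun h1 => h1.far.2 (hy1.adj_top hs), b, hb, hy1b⟩
  have hy1b' : arr y1 b :=
    ((hO _ _).1 hy1b).resolve_right (hP' y1 b hy1' (.inr hy1') (.inl hb)).2.2
  obtain ⟨a1, ha1, hya1⟩ := hy1.2.2
  have hlt : lt a1 b := by
    rcases h.arr_arr _ _ _ (out _ _ hy1 ha1 hya1) hy1b' with h1 | h1 | h1
    · exact absurd (h1 ▸ hb) (hne a1 ha1)
    · exact h1
    · exact absurd (h.trans _ _ _ (below' _ _ _ hb hk' ha1 h1) (below _ _ _ hk ha1 hk' hkk))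
        (h.irrefl _)
  obtain ⟨a2, ha2, hya2⟩ := hy2.2.2
  have hlt2 := below _ _ _ ha1 ha2 hb hlt
  rcases h.lt_arr _ _ _ (out _ _ hy2 ha2 hya2) hlt2 with h1 | h1
  · exact (hO _ _).2 (.inl h1)
  · have hyz := arr_of_att hO hz hs hc hy2
    exact absurd (h.arr_lt _ _ _ hyz (h.trans _ _ _ h1 (hL' b hb))) (h.irrefl _)

theorem nestIn_of_unique {adj part att : V → V → Prop} {l l' y k : V} (hu : ∀ v, att l v → v = y)
    (hy : att l y) (hk : part l' k) (hyk : adj y k) : NestIn adj part att l l' :=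
  ⟨⟨y, k, hy, hk, hyk⟩, fun a b t ha hb _ hat => by rwa [hu b hb, ← hu a ha]⟩

/-- If both parts lie inside `z`, a common attachment has arrows into both, and the targets are
nested. A part that is not inside `z` has only one attachment, for which `NestIn` is immediate. -/
theorem compat_of_burlingRel (h : BurlingRel lt arr) (hO : Orients adj arr)
    (hs : ∀ u v, adj u v → adj v u) (hz : SinkRoot lt arr R z) {l' : V}
    (hc : Covers adj R x c z l) (hc' : Covers adj R x c z l')
    (hne : ∀ u, Part adj x c z l u → ¬ Part adj x c z l' u) :
    Compat adj (Part adj x c z) (Att adj x c z) l l' := by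
  rintro ⟨y, hy, hy'⟩
  obtain ⟨k, hk, hyk⟩ := hy.2.2
  obtain ⟨k', hk', hyk'⟩ := hy'.2.2
  by_cases hL : ∃ u, Part adj x c z l u ∧ lt u z
  · obtain ⟨u, hu, huz⟩ := hL
    have hL : ∀ v, Part adj x c z l v → lt v z := fun v hv => part_lt h hO hs hu hv huz
    by_cases hL' : ∃ u, Part adj x c z l' u ∧ lt u z
    · obtain ⟨u', hu', huz'⟩ := hL'
      have hL' : ∀ v, Part adj x c z l' v → lt v z := fun v hv => part_lt h hO hs hu' hv huz'
      have h1 := ((hO _ _).1 hyk).resolve_right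
        (probes_of_lt h hO hs hz hc hL y k hy (.inr hy) (.inl hk)).2.2
      have h2 := ((hO _ _).1 hyk').resolve_right
        (probes_of_lt h hO hs hz hc' hL' y k' hy' (.inr hy') (.inl hk')).2.2
      rcases h.arr_arr _ _ _ h1 h2 with h3 | h3 | h3
      · exact absurd (h3 ▸ hk') (hne k hk)
      · exact .inl (nestIn_of_lt h hO hs hz hc hc' hL hL' hne hy hk hk' hyk' h3)
      · exact .inr (nestIn_of_lt h hO hs hz hc' hc hL' hL (fun u h1 h2 => hne u h2 h1)
          hy' hk' hk hyk h3)
    · push Not at hL'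
      exact .inr (nestIn_of_unique (att_unique h hO hs hz hc' hL' hy').2.2 hy' hk hyk)
  · push Not at hL
    exact .inl (nestIn_of_unique (att_unique h hO hs hz hc hL hy).2.2 hy hk' hyk')

/-- Among the vertices of a component there is one that is outermost and emits no edge. -/
theorem exists_sinkRoot [Finite V] (h : BurlingRel lt arr) {K : V → Prop}
    (hP : Probes lt arr (fun u => K u ∨ R u) R) (hc : K c) :
    ∃ ρ, K ρ ∧ SinkRoot lt arr (fun u => K u ∨ R u) ρ := by
  obtain ⟨f, hf⟩ := h.rank
  obtain ⟨r, hr, -, hroot⟩ := h.exists_root (W := {v | K v}) (Set.toFinite _) hc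
  -- Among the outermost vertices of `K` take one of least rank. If it sent an arrow to some `v` in
  -- `K`, then by `lt_arr` it would also send one to the outermost vertex around `v`, which would
  -- have smaller rank.
  obtain ⟨ρ, ⟨hρ, hρr⟩, hmin⟩ := Set.exists_min_image {v | K v ∧ ∀ t, K t → ¬ lt v t} f
    (Set.toFinite _) ⟨r, hr, hroot⟩
  refine ⟨ρ, hρ, fun v hv => ?_⟩
  rcases em (R v) with hv' | hv'
  · exact (hP v ρ hv' (.inr hv') (.inl hρ)).2
  have hv := hv.resolve_right hv'
  refine ⟨hρr v hv, fun h1 => ?_⟩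
  obtain ⟨t, ht, hvt, htr⟩ := h.exists_root (W := {v | K v}) (Set.toFinite _) hv
  have h2 : arr ρ t := by
    rcases hvt with h2 | h2
    · exact h2 ▸ h1
    · exact (h.lt_arr _ _ _ h1 h2).resolve_right (hρr t ht)
  exact absurd (hf _ _ h2) (not_lt.2 (hmin t ⟨ht, htr⟩))

end Completeness

/-- The boundary of the component of `c`. -/
def Rim {V : Type*} (adj : V → V → Prop) (x c u : V) : Prop := Hood adj x c u ∧ ¬ Kern adj x c u

theorem kern_or_rim {V : Type*} {adj : V → V → Prop} {x c u : V} :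
    Kern adj x c u ∨ Rim adj x c u ↔ Hood adj x c u := by
  unfold Rim
  by_cases h : Kern adj x c u
  · simp [h, Hood]
  · simp [h]

/-! ### Descent of the recursion and necessity of admissibility. -/

section Measure

variable {V : Type*} [Finite V] {adj : V → V → Prop} {x c z l : V}

/-- The measure of the recursion. -/
noncomputable def partRank {V : Type*} (adj : V → V → Prop) (x c z l : V) : ℕ :=
  {u | Kern adj x c u}.ncard * (Nat.card V + 1) + {u | Part adj x c z l u}.ncard

/-- The new component is the old part, which lacks `z`. The factor `Nat.card V + 1` makes this loss
outweigh any growth of the second term. -/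
theorem partRank_inner (hz : Kern adj x c z) (hK : ∀ u, Part adj x c z l u → Kern adj x c u)
    (hl : Part adj x c z l l) (ρ l' : V) : partRank adj z l ρ l' < partRank adj x c z l := by
  have h1 : {u | Kern adj z l u}.ncard < {u | Kern adj x c u}.ncard := by
    refine Set.ncard_lt_ncard ⟨fun u hu => ?_, fun h => ?_⟩ (Set.toFinite _)
    · rw [Set.mem_ofPred_eq, kern_of_part hK hl] at hu
      exact hK u hu
    · exact (Comp.mem (h hz)).1 rfl
  have h2 : {u | Part adj z l ρ l' u}.ncard ≤ Nat.card V := Set.ncard_le_card _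
  unfold partRank
  have := Nat.mul_le_mul_right (Nat.card V + 1) (Nat.succ_le_of_lt h1)
  rw [Nat.succ_mul] at this
  omega

/-- The component stays the same, and the new part misses the neighbour of `w` through which the old
part was attached. -/
theorem partRank_hangs (hs : ∀ u v, adj u v → adj v u) {w l' : V}
    (hw : ∀ v, Att adj x c z l v ↔ v = w) (hl' : Part adj x c z l l') :
    partRank adj x c w l' < partRank adj x c z l := by
  refine Nat.add_lt_add_left (Set.ncard_lt_ncard ⟨fun u hu => ?_, fun h => ?_⟩ (Set.toFinite _)) _
  · exact part_subset hs (fun v hv => (hw v).1 hv) hl' hu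
  · obtain ⟨_, _, u, hu, hwu⟩ := (hw w).2 rfl
    exact (Part.far (h hu)).2 (hs _ _ hwu)

end Measure

section Admissible

variable {V : Type*} [LinearOrder V] {adj lt arr : V → V → Prop} {R : V → Prop}
  {x c z l : V} {A : V → V → V → V → Prop}

theorem good_of_covers (h : BurlingRel lt arr) (hO : Orients adj arr)
    (hs : ∀ u v, adj u v → adj v u) (hz : SinkRoot lt arr R z) {S : V → Prop}
    (hS : ∀ l, Part adj x c z l l → S l → Covers adj R x c z l ∧ A x c z l) :
    Good adj A x c z S := by
  intro l hl hSl
  refine ⟨(hS l hl.1 hSl).2, fun l' hl' hSl' hne => ?_⟩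
  exact compat_of_burlingRel h hO hs hz (hS l hl.1 hSl).1 (hS l' hl'.1 hSl').1
    fun u hu hu' => hne (rep_eq hs hl hl' hu hu')

variable [Finite V]

theorem exists_isTop (h : BurlingRel lt arr) (hO : Orients adj arr)
    (hs : ∀ u v, adj u v → adj v u) (hc : Kern adj x c c)
    (hP : Probes lt arr (Hood adj x c) (Rim adj x c))
    (hA : ∀ ρ l, Kern adj x c ρ → SinkRoot lt arr (Hood adj x c) ρ → Part adj x c ρ l l →
      A x c ρ l) : ∃ ρ, IsTop adj A x c ρ := by
  have e : (fun u => Kern adj x c u ∨ Rim adj x c u) = Hood adj x c :=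
    funext fun u => propext kern_or_rim
  obtain ⟨ρ, hρ, hsink⟩ := exists_sinkRoot h (K := Kern adj x c) (R := Rim adj x c)
    (by rwa [e]) hc
  rw [e] at hsink
  refine ⟨ρ, hρ, good_of_covers h hO hs hsink fun l hl _ => ⟨⟨hl, fun u hu => ?_⟩, ?_⟩⟩
  · exact hu.elim Part.hood And.left
  · exact hA ρ l hρ hsink hl

/-- If one vertex of the part lies inside `z`, all do, and the attachments become the probes of a
new component. Otherwise `att_unique` supplies the vertex `w`. The region `R` has to vary in the
induction: `w` emits an arrow to `z`, so it is a sink only relative to the part together with `w`.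
-/
theorem admissible_of_burlingRel (h : BurlingRel lt arr) (hO : Orients adj arr)
    (hs : ∀ u v, adj u v → adj v u)
    (hA : ∀ x c z l, (Inner adj A x c z l ∨ ∃ w, Hangs adj A x c z l w) → A x c z l)
    (hxz : Kern adj x c z) (hzR : R z) (hz : SinkRoot lt arr R z) (hc : Covers adj R x c z l)
    (hP : Probes lt arr R (Rim adj x c)) : A x c z l := by
  induction hm : partRank adj x c z l using Nat.strong_induction_on generalizing x c z l R with
  | _ m ih =>
  subst hm
  refine hA _ _ _ _ ?_
  by_cases hL : ∃ u, Part adj x c z l u ∧ lt u z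
  · left
    obtain ⟨u, hu, huz⟩ := hL
    have hL : ∀ v, Part adj x c z l v → lt v z := fun v hv => part_lt h hO hs hu hv huz
    have hK : ∀ v, Part adj x c z l v → Kern adj x c v := by
      intro v hv
      by_contra hn
      exact (hP v z ⟨Part.hood hv, hn⟩ (hc.2 v (.inl hv)) hzR).1 (hL v hv)
    have hHood : ∀ v, Hood adj z l v ↔ Part adj x c z l v ∨ Att adj x c z l v := fun v =>
      hood_of_part hs hK hc.1
    have eH : Hood adj z l = fun v => Part adj x c z l v ∨ Att adj x c z l v :=
      funext fun v => propext (hHood v)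
    have hP' : Probes lt arr (Hood adj z l) (Rim adj z l) := by
      have := probes_of_lt h hO hs hz hc hL
      rw [eH]
      refine fun y v hy => this y v (((hHood y).1 hy.1).resolve_left fun h1 => hy.2 ?_)
      rwa [kern_of_part hK hc.1]
    refine ⟨hK, exists_isTop h hO hs (.base (Part.far hc.1)) hP' fun ρ l' hρ hsink hl' => ?_⟩
    refine ih _ (partRank_inner hxz hK hc.1 ρ l') hρ (.inl hρ) hsink ⟨hl', fun u hu => ?_⟩ hP' rfl
    exact hu.elim Part.hood And.left
  · right
    push Not at hL
    obtain ⟨w, hw⟩ := exists_att hs hxz hc.1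
    obtain ⟨h1, ⟨u, hu, huw⟩, h2⟩ := att_unique h hO hs hz hc hL hw
    have hw' : ∀ v, Att adj x c z l v ↔ v = w := fun v => ⟨h2 v, fun e => e ▸ hw⟩
    have hwR := hc.2 w (.inr hw)
    have hwK : Kern adj x c w := by
      by_contra hn
      exact (hP w u ⟨hw.1, hn⟩ hwR (hc.2 u (.inl hu))).2.2 huw
    have hsink : SinkRoot lt arr (fun v => Part adj x c z l v ∨ v = w) w := by
      rintro v (hv | rfl)
      · exact h1 v hv
      · refine ⟨h.irrefl _, fun h3 => ?_⟩
        obtain ⟨f, hf⟩ := h.rank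
        exact lt_irrefl _ (hf _ _ h3)
    have hsub : ∀ v, Part adj x c z l v ∨ v = w → R v := by
      rintro v (hv | rfl)
      · exact hc.2 v (.inl hv)
      · exact hwR
    refine ⟨w, hwK, hw', good_of_covers h hO hs hsink fun l' hl' hS => ?_⟩
    have hcov : Covers adj (fun v => Part adj x c z l v ∨ v = w) x c w l' := by
      refine ⟨hl', ?_⟩
      rintro v (hv | hv)
      · exact .inl (part_subset hs h2 hS hv)
      · by_cases h3 : Part adj x c z l v
        · exact .inl h3
        · obtain ⟨a, ha, hva⟩ := hv.2.2
          exact .inr (h2 v ⟨hv.1, h3, a, part_subset hs h2 hS ha, hva⟩)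
    refine ⟨hcov, ih _ (partRank_hangs hs hw' hS) hwK (.inr rfl) hsink hcov (fun y v hy hyR hvR => ?_) rfl⟩
    exact hP y v hy (hsub y hyR) (hsub v hvR)

end Admissible

/-! ### Combining Burling relations of the parts -/

/-- `lt` and `arr` are a Burling relation of the graph induced on `H` in which the members of `Y`
are outermost, contain nothing, and receive no edge. -/
structure Solves {V : Type*} (adj : V → V → Prop) (H Y : V → Prop) (lt arr : V → V → Prop) :
    Prop where
  rel : BurlingRel lt arr
  lt_mem : ∀ u v, lt u v → H u ∧ H v
  arr_mem : ∀ u v, arr u v → H u ∧ H v ∧ adj u v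
  orient : ∀ u v, H u → H v → adj u v → arr u v ∨ arr v u
  probe : ∀ y v, Y y → ¬ lt y v ∧ ¬ lt v y ∧ ¬ arr v y

/-- Nesting that is put together from the parts. -/
def CombLt {V : Type*} [LT V] (adj : V → V → Prop) (D F : V → Prop) (part att : V → V → Prop)
    (z : V) (lts : V → V → V → Prop) (u v : V) : Prop :=
  (v = z ∧ ∃ l, D l ∧ F l ∧ part l u) ∨ (∃ l, D l ∧ lts l u v) ∨
    ∃ l l', (D l ∧ D l' ∧ F l ∧ F l' ∧ Below adj part att l l') ∧ part l u ∧ part l' v ∧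
      ∃ y, att l y ∧ adj y v

/-- The orientation that is put together from the parts. -/
def CombArr {V : Type*} (adj : V → V → Prop) (H D : V → Prop) (z : V)
    (arrs : V → V → V → Prop) (u v : V) : Prop :=
  (v = z ∧ H u ∧ adj u z) ∨ ∃ l, D l ∧ arrs l u v

/-- Burling relations of the parts of the graph induced on `H` with respect to `z`. The parts in
`F` are to be nested in `z`, each of the others hangs at a single vertex. -/
structure Pieces {V : Type*} [LT V] (adj : V → V → Prop) (H Y D F : V → Prop)
    (part att : V → V → Prop) (z : V) (lts arrs : V → V → V → Prop) : Prop where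
  mem : H z
  not_probe : ¬ Y z
  part_mem : ∀ l u, D l → part l u → H u ∧ Far adj z u
  disj : ∀ l l' u, D l → D l' → part l u → part l' u → l = l'
  cover : ∀ u, H u → Far adj z u → ∃ l, D l ∧ part l u
  closed : ∀ l u v, D l → part l u → H v → Far adj z v → adj u v → part l v
  att_iff : ∀ l w, D l → (att l w ↔ H w ∧ ¬ part l w ∧ ∃ u, part l u ∧ adj w u)
  inner : ∀ l, D l → F l → (∀ u, part l u → ¬ Y u) ∧
    Solves adj (fun u => part l u ∨ att l u) (att l) (lts l) (arrs l)
  hangs : ∀ l, D l → ¬ F l → ∃ w, ¬ Y w ∧ (∀ v, att l v ↔ v = w) ∧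
    Solves adj (fun u => part l u ∨ att l u) (fun u => Y u ∧ part l u) (lts l) (arrs l) ∧
    ∀ v, ¬ lts l w v ∧ ¬ arrs l w v
  compat : ∀ l l', D l → D l' → l ≠ l' → Compat adj part att l l'

namespace Pieces

variable {V : Type*} [LinearOrder V] {adj : V → V → Prop} {H Y D F : V → Prop}
  {part att : V → V → Prop} {z : V} {lts arrs : V → V → V → Prop}

theorem solves (P : Pieces adj H Y D F part att z lts arrs) {l : V} (hl : D l) :
    ∃ Y', Solves adj (fun u => part l u ∨ att l u) Y' (lts l) (arrs l) := by
  by_cases hF : F l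
  · exact ⟨_, (P.inner l hl hF).2⟩
  · obtain ⟨w, -, -, h, -⟩ := P.hangs l hl hF
    exact ⟨_, h⟩

theorem lt_src (P : Pieces adj H Y D F part att z lts arrs) {l u v : V} (hl : D l)
    (h : lts l u v) : part l u := by
  obtain ⟨Y', hS⟩ := P.solves hl
  refine (hS.lt_mem _ _ h).1.resolve_right fun hu => ?_
  by_cases hF : F l
  · exact ((P.inner l hl hF).2.probe u v hu).1 h
  · obtain ⟨w, -, hw, -, hsink⟩ := P.hangs l hl hF
    exact (hsink v).1 ((hw u).1 hu ▸ h)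

theorem lt_tgt (P : Pieces adj H Y D F part att z lts arrs) {l u v : V} (hl : D l) (hF : F l)
    (h : lts l u v) : part l v := by
  have hS := (P.inner l hl hF).2
  exact (hS.lt_mem _ _ h).2.resolve_right fun hu => (hS.probe v u hu).2.1 h

theorem arr_tgt (P : Pieces adj H Y D F part att z lts arrs) {l u v : V} (hl : D l) (hF : F l)
    (h : arrs l u v) : part l v := by
  have hS := (P.inner l hl hF).2
  exact (hS.arr_mem _ _ h).2.1.resolve_right fun hu => (hS.probe v u hu).2.2 h

theorem arr_src (P : Pieces adj H Y D F part att z lts arrs) {l u v : V} (hl : D l) (hF : ¬ F l)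
    (h : arrs l u v) : part l u := by
  obtain ⟨w, -, hw, hS, hsink⟩ := P.hangs l hl hF
  exact (hS.arr_mem _ _ h).1.resolve_right fun hu => (hsink v).2 ((hw u).1 hu ▸ h)

theorem att_adj (hs : ∀ u v, adj u v → adj v u) (P : Pieces adj H Y D F part att z lts arrs)
    {l w : V} (hl : D l) (h : att l w) : adj w z := by
  obtain ⟨h1, h2, u, hu, hwu⟩ := (P.att_iff l w hl).1 h
  by_contra hn
  refine h2 (P.closed l u w hl hu h1 ⟨?_, hn⟩ (hs _ _ hwu))
  rintro rfl
  exact (P.part_mem l u hl hu).2.2 (hs _ _ hwu)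

theorem att_not_part (hs : ∀ u v, adj u v → adj v u) (P : Pieces adj H Y D F part att z lts arrs)
    {l l' w : V} (hl : D l) (hl' : D l') (h : att l w) : ¬ part l' w := fun h' =>
  (P.part_mem l' w hl' h').2.2 (P.att_adj hs hl h)

theorem eq_of_mem (hs : ∀ u v, adj u v → adj v u) (P : Pieces adj H Y D F part att z lts arrs)
    {l l' w : V} (hl : D l) (hl' : D l') (h : part l w ∨ att l w) (h' : part l' w) : l = l' :=
  P.disj l l' w hl hl' (h.resolve_right fun h => P.att_not_part hs hl hl' h h') h'

theorem att_of_adj (hs : ∀ u v, adj u v → adj v u) (P : Pieces adj H Y D F part att z lts arrs)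
    {l l' y k : V} (hl : D l) (hl' : D l') (hy : att l y) (hk : part l' k) (hyk : adj y k) :
    att l' y :=
  (P.att_iff l' y hl').2 ⟨((P.att_iff l y hl).1 hy).1, P.att_not_part hs hl hl' hy, k, hk, hyk⟩

theorem att_subset (hs : ∀ u v, adj u v → adj v u) (P : Pieces adj H Y D F part att z lts arrs)
    {l l' y : V} (hl : D l) (hl' : D l') (hN : NestIn adj part att l l') (hy : att l y) :
    att l' y := by
  obtain ⟨⟨y0, k, hy0, hk, hyk⟩, hN⟩ := hN
  exact P.att_of_adj hs hl hl' hy hk (hN y0 y k hy0 hy hk hyk)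

theorem nestIn_trans (hs : ∀ u v, adj u v → adj v u) (P : Pieces adj H Y D F part att z lts arrs)
    {l l' l'' : V} (hl : D l) (hl' : D l') (h : NestIn adj part att l l')
    (h' : NestIn adj part att l' l'') : NestIn adj part att l l'' := by
  have hsub := fun y => P.att_subset hs (y := y) hl hl' h
  obtain ⟨⟨y0, k0, hy0, hk0, hyk0⟩, -⟩ := h
  obtain ⟨⟨y, k, hy, hk, hyk⟩, h'⟩ := h'
  exact ⟨⟨y0, k, hy0, hk, h' y y0 k hy (hsub _ hy0) hk hyk⟩, fun a b t ha hb ht hat =>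
    h' a b t (hsub _ ha) (hsub _ hb) ht hat⟩

/-- `NestIn` is only transitive. Of two parts that could be nested in each other, the tie-break puts
the one with the smaller representative outside. -/
theorem below_trans (hs : ∀ u v, adj u v → adj v u) (P : Pieces adj H Y D F part att z lts arrs)
    {l l' l'' : V} (hl : D l) (hl' : D l') (hl'' : D l'') (h : Below adj part att l l')
    (h' : Below adj part att l' l'') : Below adj part att l l'' := by
  obtain ⟨h1, h2, h3⟩ := h
  obtain ⟨h1', h2', h3'⟩ := h'
  refine ⟨?_, P.nestIn_trans hs hl hl' h2 h2', fun h4 => ?_⟩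
  · rintro rfl
    exact lt_asymm (h3 h2') (h3' h2)
  · exact (h3' (P.nestIn_trans hs hl'' hl h4 h2)).trans (h3 (P.nestIn_trans hs hl' hl'' h2' h4))

theorem below_or (P : Pieces adj H Y D F part att z lts arrs) {l l' y : V} (hl : D l) (hl' : D l')
    (hne : l ≠ l') (hy : att l y) (hy' : att l' y) :
    Below adj part att l l' ∨ Below adj part att l' l := by
  by_cases h1 : NestIn adj part att l l' <;> by_cases h2 : NestIn adj part att l' l
  · rcases lt_or_gt_of_ne hne with h | h
    · exact .inr ⟨hne.symm, h2, fun _ => h⟩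
    · exact .inl ⟨hne, h1, fun _ => h⟩
  · exact .inl ⟨hne, h1, fun h => absurd h h2⟩
  · exact .inr ⟨hne.symm, h2, fun h => absurd h h1⟩
  · rcases P.compat l l' hl hl' hne ⟨y, hy, hy'⟩ with h | h
    · exact absurd h h1
    · exact absurd h h2

theorem combLt_src (P : Pieces adj H Y D F part att z lts arrs) {u v : V}
    (h : CombLt adj D F part att z lts u v) : ∃ l, D l ∧ part l u := by
  rcases h with ⟨_, l, hl, _, hu⟩ | ⟨l, hl, hu⟩ | ⟨l, _, ⟨hl, _⟩, hu, _⟩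
  · exact ⟨l, hl, hu⟩
  · exact ⟨l, hl, P.lt_src hl hu⟩
  · exact ⟨l, hl, hu⟩

/-- The cases of the combined nesting, when the part of the inner vertex is known. -/
theorem combLt_iff (P : Pieces adj H Y D F part att z lts arrs) {l u v : V}
    (hl : D l) (hu : part l u) : CombLt adj D F part att z lts u v ↔
      (v = z ∧ F l) ∨ lts l u v ∨ ∃ l', D l' ∧ F l ∧ F l' ∧ Below adj part att l l' ∧ part l' v ∧
        ∃ y, att l y ∧ adj y v := by
  constructor
  · rintro (⟨e, l1, hl1, hF, hu1⟩ | ⟨l1, hl1, h⟩ | ⟨l1, l', ⟨hl1, hl', hF, hF', hb⟩, hu1, h⟩)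
    · obtain rfl := P.disj _ _ _ hl hl1 hu hu1
      exact .inl ⟨e, hF⟩
    · obtain rfl := P.disj _ _ _ hl hl1 hu (P.lt_src hl1 h)
      exact .inr (.inl h)
    · obtain rfl := P.disj _ _ _ hl hl1 hu hu1
      exact .inr (.inr ⟨l', hl', hF, hF', hb, h⟩)
  · rintro (⟨e, hF⟩ | h | ⟨l', hl', hF, hF', hb, h⟩)
    · exact .inl ⟨e, l, hl, hF, hu⟩
    · exact .inr (.inl ⟨l, hl, h⟩)
    · exact .inr (.inr ⟨l, l', ⟨hl, hl', hF, hF', hb⟩, hu, h⟩)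

/-- In the essential case `v` lies in another part than `u` and is seen by an attachment `y` of the
part of `u`, while `w` encloses `v` within its part. As `y` is a probe there, `lt_arr` turns its
arrow to `v` into an arrow to `w`. -/
theorem combLt_trans (hs : ∀ u v, adj u v → adj v u) (P : Pieces adj H Y D F part att z lts arrs)
    (u v w : V) (h : CombLt adj D F part att z lts u v) (h' : CombLt adj D F part att z lts v w) :
    CombLt adj D F part att z lts u w := by
  obtain ⟨l, hl, hu⟩ := P.combLt_src h
  obtain ⟨l', hl', hv⟩ := P.combLt_src h'
  obtain ⟨_, hS⟩ := P.solves hl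
  obtain ⟨_, hS'⟩ := P.solves hl'
  rw [P.combLt_iff hl hu] at h ⊢
  rw [P.combLt_iff hl' hv] at h'
  rcases h with ⟨rfl, _⟩ | h | ⟨l1, hl1, hF, hF1, hb, hv1, y, hy, hyv⟩
  · exact absurd rfl (P.part_mem _ _ hl' hv).2.1
  · obtain rfl := P.eq_of_mem hs hl hl' (hS.lt_mem _ _ h).2 hv
    rcases h' with ⟨e, hF⟩ | h' | h'
    · exact .inl ⟨e, hF⟩
    · exact .inr (.inl (hS.rel.trans _ _ _ h h'))
    · exact .inr (.inr h')
  · obtain rfl := P.disj _ _ _ hl' hl1 hv hv1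
    have hyl := P.att_of_adj hs hl hl' hy hv hyv
    have hI := (P.inner _ hl' hF1).2
    rcases h' with ⟨e, _⟩ | h' | ⟨l2, hl2, -, hF2, hb2, hw, y', hy', hyw⟩
    · exact .inl ⟨e, hF⟩
    · refine .inr (.inr ⟨l', hl', hF, hF1, hb, P.lt_tgt hl' hF1 h', y, hy, ?_⟩)
      have h1 := (hI.orient y v (.inr hyl) (.inl hv) hyv).resolve_right (hI.probe y v hyl).2.2
      have h2 := (hI.rel.lt_arr _ _ _ h1 h').resolve_right (hI.probe y w hyl).1
      exact (hI.arr_mem _ _ h2).2.2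
    · exact .inr (.inr ⟨l2, hl2, hF, hF2, P.below_trans hs hl hl' hl2 hb hb2, hw, y, hy,
        hb2.2.1.2 y' y w hy' hyl hw hyw⟩)

theorem combLt_of_adj {l l' x y w : V} (hl : D l)
    (hl' : D l') (hF : F l) (hF' : F l') (hb : Below adj part att l l') (hy : part l y)
    (hw : part l' w) (hx : att l x) (hxw : adj x w) : CombLt adj D F part att z lts y w :=
  .inr (.inr ⟨l, l', ⟨hl, hl', hF, hF', hb⟩, hy, hw, x, hx, hxw⟩)

theorem comb_compare (hs : ∀ u v, adj u v → adj v u) (P : Pieces adj H Y D F part att z lts arrs)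
    {l l' x y w : V} (hl : D l) (hl' : D l') (hF : F l) (hF' : F l') (hne : l ≠ l')
    (hx : att l x) (hx' : att l' x) (hy : part l y) (hw : part l' w) (hxy : adj x y)
    (hxw : adj x w) :
    CombLt adj D F part att z lts y w ∨ CombLt adj D F part att z lts w y :=
  (P.below_or hl hl' hne hx hx').imp
    (fun h => combLt_of_adj hl hl' hF hF' h hy hw hx hxw)
    (fun h => combLt_of_adj hl' hl hF' hF h hw hy hx' hxy)

/-- If `y` and `w` both lie outside the part of `x`, then `NestIn` provides an attachment that sees
both. Within one part they are compared by `arr_arr` for the arrows of this probe; in different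
parts `Below` decides. -/
theorem combLt_lt (hs : ∀ u v, adj u v → adj v u) (P : Pieces adj H Y D F part att z lts arrs)
    (x y w : V) (h : CombLt adj D F part att z lts x y) (h' : CombLt adj D F part att z lts x w) :
    y = w ∨ CombLt adj D F part att z lts y w ∨ CombLt adj D F part att z lts w y := by
  obtain ⟨l, hl, hx⟩ := P.combLt_src h
  obtain ⟨_, hS⟩ := P.solves hl
  rw [P.combLt_iff hl hx] at h h'
  have below_z : ∀ l' v, D l' → F l' → part l' v → CombLt adj D F part att z lts v z :=
    fun l' v hl' hF hv => .inl ⟨rfl, l', hl', hF, hv⟩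
  have mixed : ∀ a b, lts l x a → (∃ l', D l' ∧ F l ∧ F l' ∧ Below adj part att l l' ∧ part l' b ∧
      ∃ y, att l y ∧ adj y b) → CombLt adj D F part att z lts a b := by
    rintro a b ha ⟨l', hl', hF, hF', hb, hbp, y, hy, hyb⟩
    exact combLt_of_adj hl hl' hF hF' hb (P.lt_tgt hl hF ha) hbp hy hyb
  rcases h with ⟨rfl, hF⟩ | h | ⟨l1, hl1, hF, hF1, hb1, hy, y1, hy1, hyy⟩
  · rcases h' with ⟨rfl, -⟩ | h' | ⟨l2, hl2, -, hF2, hb2, hw, -⟩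
    · exact .inl rfl
    · exact .inr (.inr (below_z l _ hl hF (P.lt_tgt hl hF h')))
    · exact .inr (.inr (below_z l2 _ hl2 hF2 hw))
  · rcases h' with ⟨rfl, hF⟩ | h' | h'
    · exact .inr (.inl (below_z l _ hl hF (P.lt_tgt hl hF h)))
    · exact (hS.rel.lt_lt _ _ _ h h').imp id
        (Or.imp (fun h => .inr (.inl ⟨l, hl, h⟩)) fun h => .inr (.inl ⟨l, hl, h⟩))
    · exact .inr (.inl (mixed _ _ h h'))
  · rcases h' with ⟨rfl, -⟩ | h' | ⟨l2, hl2, -, hF2, hb2, hw, y2, hy2, hyw⟩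
    · exact .inr (.inl (below_z l1 _ hl1 hF1 hy))
    · exact .inr (.inr (mixed _ _ h' ⟨l1, hl1, hF, hF1, hb1, hy, y1, hy1, hyy⟩))
    · have hy2y := hb1.2.1.2 y1 y2 y hy1 hy2 hy hyy
      have ha1 := P.att_of_adj hs hl hl1 hy2 hy hy2y
      have ha2 := P.att_of_adj hs hl hl2 hy2 hw hyw
      by_cases hne : l1 = l2
      · subst hne
        have hI := (P.inner _ hl1 hF1).2
        have h1 := (hI.orient y2 y (.inr ha1) (.inl hy) hy2y).resolve_right
          (hI.probe y2 y ha1).2.2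
        have h2 := (hI.orient y2 w (.inr ha1) (.inl hw) hyw).resolve_right
          (hI.probe y2 w ha1).2.2
        exact (hI.rel.arr_arr _ _ _ h1 h2).imp id
          (Or.imp (fun h => .inr (.inl ⟨l1, hl1, h⟩)) fun h => .inr (.inl ⟨l1, hl1, h⟩))
      · exact .inr (P.comb_compare hs hl1 hl2 hF1 hF2 hne ha1 ha2 hy hw hy2y hyw)

theorem combArr_arr (hs : ∀ u v, adj u v → adj v u) (P : Pieces adj H Y D F part att z lts arrs)
    (x y w : V) (h : CombArr adj H D z arrs x y) (h' : CombArr adj H D z arrs x w) :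
    y = w ∨ CombLt adj D F part att z lts y w ∨ CombLt adj D F part att z lts w y := by
  have mixed : ∀ l b, adj x z → D l → arrs l x b → CombLt adj D F part att z lts b z := by
    intro l b hxz hl hb
    by_cases hF : F l
    · exact .inl ⟨rfl, l, hl, hF, P.arr_tgt hl hF hb⟩
    · exact absurd hxz (P.part_mem l x hl (P.arr_src hl hF hb)).2.2
  rcases h with ⟨rfl, _, hxz⟩ | ⟨l, hl, h⟩ <;> rcases h' with ⟨rfl, _, hxz'⟩ | ⟨l', hl', h'⟩
  · exact .inl rfl
  · exact .inr (.inr (mixed l' w hxz hl' h'))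
  · exact .inr (.inl (mixed l y hxz' hl h))
  · obtain ⟨_, hS⟩ := P.solves hl
    obtain ⟨_, hS'⟩ := P.solves hl'
    by_cases hne : l = l'
    · subst hne
      exact (hS.rel.arr_arr _ _ _ h h').imp id
        (Or.imp (fun h => .inr (.inl ⟨l, hl, h⟩)) fun h => .inr (.inl ⟨l, hl, h⟩))
    · have hm := hS.arr_mem _ _ h
      have hm' := hS'.arr_mem _ _ h'
      have hx : att l x := hm.1.resolve_left fun hx =>
        hne (P.eq_of_mem hs hl' hl hm'.1 hx).symm
      have hx' : att l' x := hm'.1.resolve_left fun hx' => hne (P.eq_of_mem hs hl hl' hm.1 hx')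
      have hF : F l := by
        by_contra hF
        exact P.att_not_part hs hl hl hx (P.arr_src hl hF h)
      have hF' : F l' := by
        by_contra hF
        exact P.att_not_part hs hl' hl' hx' (P.arr_src hl' hF h')
      exact .inr (P.comb_compare hs hl hl' hF hF' hne hx hx' (P.arr_tgt hl hF h)
        (P.arr_tgt hl' hF' h') hm.2.2 hm'.2.2)

theorem combArr_lt (hs : ∀ u v, adj u v → adj v u) (P : Pieces adj H Y D F part att z lts arrs)
    (x y w : V) (h : CombArr adj H D z arrs x y) (h' : CombLt adj D F part att z lts x w) :
    CombLt adj D F part att z lts y w := by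
  obtain ⟨l', hl', hx⟩ := P.combLt_src h'
  rw [P.combLt_iff hl' hx] at h'
  rcases h with ⟨rfl, _, hxz⟩ | ⟨l, hl, h⟩
  · exact absurd hxz (P.part_mem l' x hl' hx).2.2
  · obtain ⟨_, hS⟩ := P.solves hl
    obtain rfl := P.eq_of_mem hs hl hl' (hS.arr_mem _ _ h).1 hx
    rcases h' with ⟨rfl, hF⟩ | h' | ⟨l1, hl1, hF, hF1, hb1, hw, y1, hy1, hyw⟩
    · exact .inl ⟨rfl, l, hl, hF, P.arr_tgt hl hF h⟩
    · exact .inr (.inl ⟨l, hl, hS.rel.arr_lt _ _ _ h h'⟩)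
    · exact combLt_of_adj hl hl1 hF hF1 hb1 (P.arr_tgt hl hF h) hw hy1 hyw

/-- The delicate case is an attachment `x` of the part of `y` when `w` lies in a part further out.
By `NestIn` all attachments see the same vertices there, so `x` sees `w`, and as a probe it emits
the arrow. -/
theorem combLt_arr (hs : ∀ u v, adj u v → adj v u) (P : Pieces adj H Y D F part att z lts arrs)
    (x y w : V) (h : CombArr adj H D z arrs x y) (h' : CombLt adj D F part att z lts y w) :
    CombArr adj H D z arrs x w ∨ CombLt adj D F part att z lts x w := by
  obtain ⟨l', hl', hy⟩ := P.combLt_src h'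
  rw [P.combLt_iff hl' hy] at h'
  rcases h with ⟨rfl, _, hxz⟩ | ⟨l, hl, h⟩
  · exact absurd rfl (P.part_mem l' y hl' hy).2.1
  · obtain ⟨_, hS⟩ := P.solves hl
    have hm := hS.arr_mem _ _ h
    obtain rfl := P.eq_of_mem hs hl hl' hm.2.1 hy
    rcases h' with ⟨rfl, hF⟩ | h' | ⟨l1, hl1, hF, hF1, hb1, hw, y1, hy1, hyw⟩
    · rcases hm.1 with hx | hx
      · exact .inr (.inl ⟨rfl, l, hl, hF, hx⟩)
      · exact .inl (.inl ⟨rfl, ((P.att_iff l x hl).1 hx).1, P.att_adj hs hl hx⟩)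
    · exact (hS.rel.lt_arr _ _ _ h h').imp (fun h => .inr ⟨l, hl, h⟩)
        fun h => .inr (.inl ⟨l, hl, h⟩)
    · rcases hm.1 with hx | hx
      · exact .inr (combLt_of_adj hl hl1 hF hF1 hb1 hx hw hy1 hyw)
      · have hxw := hb1.2.1.2 y1 x w hy1 hx hw hyw
        have hx1 := P.att_of_adj hs hl hl1 hx hw hxw
        have hI := (P.inner _ hl1 hF1).2
        exact .inl (.inr ⟨l1, hl1, (hI.orient x w (.inr hx1) (.inl hw) hxw).resolve_right
          (hI.probe x w hx1).2.2⟩)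

/-- Arrows descend through the levels of hanging parts, neighbours of `z`, parts nested in `z`, and
`z` itself. The offset `M` exceeds all ranks inside the parts. -/
theorem combArr_rank [Finite V] (hs : ∀ u v, adj u v → adj v u) (hirr : ∀ u, ¬ adj u u)
    (P : Pieces adj H Y D F part att z lts arrs) :
    ∃ f : V → ℕ, ∀ x y, CombArr adj H D z arrs x y → f y < f x := by
  classical
  cases nonempty_fintype V
  have hr : ∀ l, ∃ f : V → ℕ, D l → ∀ x y, arrs l x y → f y < f x := by
    intro l
    by_cases hl : D l
    · obtain ⟨_, hS⟩ := P.solves hl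
      obtain ⟨f, hf⟩ := hS.rel.rank
      exact ⟨f, fun _ => hf⟩
    · exact ⟨fun _ => 0, fun h => absurd h hl⟩
  choose f hf using hr
  let M := 2 + ∑ l, ∑ v, f l v
  have hM : ∀ l v, 1 + f l v < M := by
    intro l v
    have h1 := Finset.single_le_sum (f := fun v => f l v) (fun _ _ => Nat.zero_le _)
      (Finset.mem_univ v)
    have h2 := Finset.single_le_sum (f := fun l => ∑ v, f l v) (fun _ _ => Nat.zero_le _)
      (Finset.mem_univ l)
    omega
  let g : V → ℕ := fun u => if u = z then 0 else
    if h : ∃ l, D l ∧ part l u then (if F h.choose then 1 else M + 1) + f h.choose u else M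
  have gz : g z = 0 := by simp [g]
  have gp : ∀ l u, D l → part l u → g u = (if F l then 1 else M + 1) + f l u := by
    intro l u hl hu
    have h : ∃ l, D l ∧ part l u := ⟨l, hl, hu⟩
    have e : h.choose = l := P.disj _ _ _ h.choose_spec.1 hl h.choose_spec.2 hu
    simp only [g, if_neg (P.part_mem l u hl hu).2.1, dif_pos h, e]
  have gn : ∀ u, adj u z → g u = M := by
    intro u hu
    have h1 : u ≠ z := by
      rintro rfl
      exact hirr u hu
    have h2 : ¬ ∃ l, D l ∧ part l u := fun ⟨l, hl, h⟩ => (P.part_mem l u hl h).2.2 hu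
    simp only [g, if_neg h1, dif_neg h2]
  refine ⟨g, ?_⟩
  rintro x y (⟨rfl, _, hxz⟩ | ⟨l, hl, h⟩)
  · rw [gz, gn x hxz]
    omega
  · obtain ⟨_, hS⟩ := P.solves hl
    have hm := hS.arr_mem _ _ h
    have hfl := hf l hl x y h
    by_cases hF : F l
    · rw [gp l y hl (P.arr_tgt hl hF h), if_pos hF]
      rcases hm.1 with hx | hx
      · rw [gp l x hl hx, if_pos hF]
        omega
      · rw [gn x (P.att_adj hs hl hx)]
        exact hM l y
    · rw [gp l x hl (P.arr_src hl hF h), if_neg hF]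
      rcases hm.2.1 with hy | hy
      · rw [gp l y hl hy, if_neg hF]
        omega
      · rw [gn y (P.att_adj hs hl hy)]
        omega

theorem combLt_irrefl (P : Pieces adj H Y D F part att z lts arrs) (x : V) :
    ¬ CombLt adj D F part att z lts x x := by
  intro h
  obtain ⟨l, hl, hx⟩ := P.combLt_src h
  obtain ⟨_, hS⟩ := P.solves hl
  rw [P.combLt_iff hl hx] at h
  rcases h with ⟨rfl, _⟩ | h | ⟨l', hl', _, _, hb, hx', _⟩
  · exact (P.part_mem l x hl hx).2.1 rfl
  · exact hS.rel.irrefl _ h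
  · exact hb.1 (P.disj _ _ _ hl hl' hx hx')

theorem not_combLt (P : Pieces adj H Y D F part att z lts arrs) (v : V) :
    ¬ CombLt adj D F part att z lts z v := fun h => by
  obtain ⟨l, hl, hx⟩ := P.combLt_src h
  exact (P.part_mem l z hl hx).2.1 rfl

theorem not_combArr (hs : ∀ u v, adj u v → adj v u) (hirr : ∀ u, ¬ adj u u)
    (P : Pieces adj H Y D F part att z lts arrs) (v : V) : ¬ CombArr adj H D z arrs z v := by
  rintro (⟨rfl, _, h⟩ | ⟨l, hl, h⟩)
  · exact hirr _ h
  · obtain ⟨_, hS⟩ := P.solves hl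
    rcases (hS.arr_mem _ _ h).1 with h | h
    · exact (P.part_mem l z hl h).2.1 rfl
    · exact hirr _ (P.att_adj hs hl h)

/-- The combined relations are a Burling relation. -/
theorem solves_comb [Finite V] (hs : ∀ u v, adj u v → adj v u) (hirr : ∀ u, ¬ adj u u)
    (htri : ∀ a b c, adj a b → adj b c → ¬ adj a c)
    (P : Pieces adj H Y D F part att z lts arrs) :
    Solves adj H Y (CombLt adj D F part att z lts) (CombArr adj H D z arrs) where
  rel := ⟨P.combLt_irrefl, P.combLt_trans hs, P.combLt_lt hs, P.combArr_arr hs, P.combArr_lt hs,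
    P.combLt_arr hs, P.combArr_rank hs hirr⟩
  lt_mem u v h := by
    rcases h with ⟨rfl, l, hl, _, hu⟩ | ⟨l, hl, h⟩ | ⟨l, l', ⟨hl, hl', _⟩, hu, hv, _⟩
    · exact ⟨(P.part_mem l u hl hu).1, P.mem⟩
    · obtain ⟨_, hS⟩ := P.solves hl
      have hm := hS.lt_mem _ _ h
      exact ⟨hm.1.elim (fun h => (P.part_mem l _ hl h).1) fun h => ((P.att_iff l _ hl).1 h).1,
        hm.2.elim (fun h => (P.part_mem l _ hl h).1) fun h => ((P.att_iff l _ hl).1 h).1⟩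
    · exact ⟨(P.part_mem l u hl hu).1, (P.part_mem l' v hl' hv).1⟩
  arr_mem u v h := by
    rcases h with ⟨rfl, h1, h2⟩ | ⟨l, hl, h⟩
    · exact ⟨h1, P.mem, h2⟩
    · obtain ⟨_, hS⟩ := P.solves hl
      have hm := hS.arr_mem _ _ h
      exact ⟨hm.1.elim (fun h => (P.part_mem l _ hl h).1) fun h => ((P.att_iff l _ hl).1 h).1,
        hm.2.1.elim (fun h => (P.part_mem l _ hl h).1) fun h => ((P.att_iff l _ hl).1 h).1,
        hm.2.2⟩
  orient u v hu hv huv := by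
    have key : ∀ a b l, D l → part l a → H b → adj a b →
        CombArr adj H D z arrs a b ∨ CombArr adj H D z arrs b a := by
      intro a b l hl ha hb hab
      obtain ⟨_, hS⟩ := P.solves hl
      have hb' : part l b ∨ att l b := by
        by_cases h : part l b
        · exact .inl h
        · exact .inr ((P.att_iff l b hl).2 ⟨hb, h, a, ha, hs _ _ hab⟩)
      exact (hS.orient a b (.inl ha) hb' hab).imp (fun h => .inr ⟨l, hl, h⟩)
        fun h => .inr ⟨l, hl, h⟩
    by_cases hfu : Far adj z u
    · obtain ⟨l, hl, hul⟩ := P.cover u hu hfu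
      exact key u v l hl hul hv huv
    by_cases hfv : Far adj z v
    · obtain ⟨l, hl, hvl⟩ := P.cover v hv hfv
      exact (key v u l hl hvl hu (hs _ _ huv)).symm
    by_cases huz : u = z
    · exact .inr (.inl ⟨huz, hv, by simpa [huz] using hs _ _ huv⟩)
    by_cases hvz : v = z
    · exact .inl (.inl ⟨hvz, hu, by simpa [hvz] using huv⟩)
    have h1 : adj u z := by
      by_contra h
      exact hfu ⟨huz, h⟩
    have h2 : adj v z := by
      by_contra h
      exact hfv ⟨hvz, h⟩
    -- The only edges not covered by `z` or a part would join two neighbours of `z`; they are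
    -- excluded by triangle-freeness.
    exact absurd h1 (htri u v z huv h2)
  probe y v hy := by
    have hyz : y ≠ z := by
      rintro rfl
      exact P.not_probe hy
    have hnF : ∀ l, D l → F l → ¬ part l y := fun l hl hF h => (P.inner l hl hF).1 y h hy
    refine ⟨?_, ?_, ?_⟩
    · rintro (⟨_, l, hl, hF, h⟩ | ⟨l, hl, h⟩ | ⟨l, l', ⟨hl, _, hF, _⟩, h, _⟩)
      · exact hnF l hl hF h
      · by_cases hF : F l
        · exact hnF l hl hF (P.lt_src hl h)
        · obtain ⟨w, -, -, hS, -⟩ := P.hangs l hl hF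
          exact (hS.probe y v ⟨hy, P.lt_src hl h⟩).1 h
      · exact hnF l hl hF h
    · rintro (⟨h, _⟩ | ⟨l, hl, h⟩ | ⟨l, l', ⟨_, hl', _, hF, _⟩, _, h, _⟩)
      · exact hyz h
      · by_cases hF : F l
        · exact hnF l hl hF (P.lt_tgt hl hF h)
        · obtain ⟨w, hw, hw', hS, -⟩ := P.hangs l hl hF
          rcases (hS.lt_mem _ _ h).2 with h1 | h1
          · exact (hS.probe y v ⟨hy, h1⟩).2.1 h
          · exact hw ((hw' y).1 h1 ▸ hy)
      · exact hnF l' hl' hF h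
    · rintro (⟨h, _⟩ | ⟨l, hl, h⟩)
      · exact hyz h
      · by_cases hF : F l
        · exact hnF l hl hF (P.arr_tgt hl hF h)
        · obtain ⟨w, hw, hw', hS, -⟩ := P.hangs l hl hF
          rcases (hS.arr_mem _ _ h).2.1 with h1 | h1
          · exact (hS.probe y v ⟨hy, h1⟩).2.2 h
          · exact hw ((hw' y).1 h1 ▸ hy)

end Pieces

theorem Solves.mono_probe {V : Type*} {adj : V → V → Prop} {H Y Y' : V → Prop}
    {lt arr : V → V → Prop} (h : Solves adj H Y lt arr) (hY : ∀ y, Y' y → Y y) :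
    Solves adj H Y' lt arr :=
  ⟨h.rel, h.lt_mem, h.arr_mem, h.orient, fun y v hy => h.probe y v (hY y hy)⟩

theorem hood_of_isolated {V : Type*} {x : V} {adj : V → V → Prop} (hx : ∀ u, ¬ adj u x) {c : V} :
    Hood adj x c = Kern adj x c := by
  funext u
  refine propext ⟨?_, .inl⟩
  rintro (h | ⟨v, hv, hvu⟩)
  · exact h
  · refine .step hv hvu ⟨?_, hx u⟩
    rintro rfl
    exact hx v hvu

/-! ### The recursive solution and its correctness. -/

section Recursion

variable {V : Type*} [LinearOrder V] {adj : V → V → Prop}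
  {A : V → V → V → V → Prop} {Rel Arr : V → V → V → V → V → V → Prop} {x c z l : V}

/-- The least possible outermost vertex. -/
def IsLeastTop (adj : V → V → Prop) (A : V → V → V → V → Prop) (x c ρ : V) : Prop :=
  IsTop adj A x c ρ ∧ ∀ ρ', IsTop adj A x c ρ' → ρ ≤ ρ'

/-- The nesting that `Rel` provides for the parts inside `S`. -/
def PartLt (adj : V → V → Prop) (A : V → V → V → V → Prop) (Rel : V → V → V → V → V → V → Prop)
    (x c z : V) (S : V → Prop) : V → V → Prop :=
  CombLt adj (fun l => Rep adj x c z l ∧ S l) (Inner adj A x c z) (Part adj x c z) (Att adj x c z) z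
    (Rel x c z)

/-- The orientation that `Arr` provides for the parts inside `S`. -/
def PartArr (adj : V → V → Prop) (Arr : V → V → V → V → V → V → Prop) (H : V → Prop)
    (x c z : V) (S : V → Prop) : V → V → Prop :=
  CombArr adj H (fun l => Rep adj x c z l ∧ S l) z (Arr x c z)

/-- The recursion of `Rel`. -/
def RelStep (adj : V → V → Prop) (A : V → V → V → V → Prop) (Rel : V → V → V → V → V → V → Prop)
    (x c z l u v : V) : Prop :=
  (Inner adj A x c z l ∧ ∃ ρ, IsLeastTop adj A z l ρ ∧
    PartLt adj A Rel z l ρ (fun _ => True) u v) ∨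
  (¬ Inner adj A x c z l ∧ ∃ w, Hangs adj A x c z l w ∧
    PartLt adj A Rel x c w (Part adj x c z l) u v)

/-- The recursion of `Arr`. -/
def ArrStep (adj : V → V → Prop) (A : V → V → V → V → Prop) (Arr : V → V → V → V → V → V → Prop)
    (x c z l u v : V) : Prop :=
  (Inner adj A x c z l ∧ ∃ ρ, IsLeastTop adj A z l ρ ∧
    PartArr adj Arr (Hood adj z l) z l ρ (fun _ => True) u v) ∨
  (¬ Inner adj A x c z l ∧ ∃ w, Hangs adj A x c z l w ∧
    PartArr adj Arr (fun t => Part adj x c z l t ∨ t = w) x c w (Part adj x c z l) u v)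

/-- `Rel` and `Arr` are a solution for the part of `l`. -/
def PartSolved (adj : V → V → Prop) (A : V → V → V → V → Prop)
    (Rel Arr : V → V → V → V → V → V → Prop) (x c z l : V) : Prop :=
  (Inner adj A x c z l → Solves adj (fun u => Part adj x c z l u ∨ Att adj x c z l u)
    (Att adj x c z l) (Rel x c z l) (Arr x c z l)) ∧
  (¬ Inner adj A x c z l → ∃ w, Kern adj x c w ∧ (∀ v, Att adj x c z l v ↔ v = w) ∧
    Solves adj (fun u => Part adj x c z l u ∨ Att adj x c z l u)
      (fun u => Rim adj x c u ∧ Part adj x c z l u) (Rel x c z l) (Arr x c z l) ∧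
    ∀ v, ¬ Rel x c z l w v ∧ ¬ Arr x c z l w v)

/-- The set `H` is kept general for two uses: the whole surroundings of a component in `solves_top`,
and a hanging part together with its attachment in `partSolved`. -/
theorem pieces_of_good (hs : ∀ u v, adj u v → adj v u) {H Y S : V → Prop} (hz : Kern adj x c z)
    (hHz : H z) (hH : ∀ u, H u → Hood adj x c u) (hY : ∀ u, Y u → Rim adj x c u)
    (hS : ∀ l u, S l → Part adj x c z l l → Part adj x c z l u ∨ Att adj x c z l u → H u)
    (hcov : ∀ u, H u → Far adj z u → ∃ l, (Rep adj x c z l ∧ S l) ∧ Part adj x c z l u)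
    (hG : Good adj A x c z S)
    (hsol : ∀ l, Rep adj x c z l → S l → PartSolved adj A Rel Arr x c z l) :
    Pieces adj H Y (fun l => Rep adj x c z l ∧ S l) (Inner adj A x c z) (Part adj x c z)
      (Att adj x c z) z (Rel x c z) (Arr x c z) where
  mem := hHz
  not_probe h := (hY z h).2 hz
  part_mem l u hl hu := ⟨hS l u hl.2 hl.1.1 (.inl hu), Part.far hu⟩
  disj l l' u hl hl' hu hu' := rep_eq hs hl.1 hl'.1 hu hu'
  cover := hcov
  closed l u v _ hu hv hfar huv := .step hu huv ⟨hH v hv, hfar⟩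
  att_iff l w hl := ⟨fun h => ⟨hS l w hl.2 hl.1.1 (.inr h), h.2⟩, fun h => ⟨hH w h.1, h.2⟩⟩
  inner l hl hF := ⟨fun u hu hYu => (hY u hYu).2 (hF.1 u hu), (hsol l hl.1 hl.2).1 hF⟩
  hangs l hl hF := by
    obtain ⟨w, hw, h1, h2, h3⟩ := (hsol l hl.1 hl.2).2 hF
    exact ⟨w, fun h => (hY w h).2 hw, h1, h2.mono_probe fun y hy => ⟨hY y hy.1, hy.2⟩, h3⟩
  compat l l' hl hl' hne := (hG l hl.1 hl.2).2 l' hl'.1 hl'.2 hne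

variable [Finite V]

theorem exists_isLeastTop (h : ∃ ρ, IsTop adj A x c ρ) : ∃ ρ, IsLeastTop adj A x c ρ := by
  obtain ⟨ρ, hρ⟩ := h
  obtain ⟨r, hr, hmin⟩ := Set.exists_min_image {ρ | IsTop adj A x c ρ} id (Set.toFinite _) ⟨ρ, hρ⟩
  exact ⟨r, hr, hmin⟩

theorem solves_top (hs : ∀ u v, adj u v → adj v u) (hirr : ∀ u, ¬ adj u u)
    (htri : ∀ a b c, adj a b → adj b c → ¬ adj a c) {ρ : V} (hρ : IsTop adj A x c ρ)
    (hsol : ∀ l, Rep adj x c ρ l → PartSolved adj A Rel Arr x c ρ l) :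
    Solves adj (Hood adj x c) (Rim adj x c) (PartLt adj A Rel x c ρ fun _ => True)
      (PartArr adj Arr (Hood adj x c) x c ρ fun _ => True) := by
  refine (pieces_of_good hs hρ.1 (.inl hρ.1) (fun _ h => h) (fun _ h => h) (fun l u _ _ hu => ?_)
    (fun u hu hfar => ?_) hρ.2 fun l hl _ => hsol l hl).solves_comb hs hirr htri
  · exact hu.elim Part.hood And.left
  · obtain ⟨l, hl, hlu⟩ := exists_rep hs hu hfar
    exact ⟨l, ⟨hl, trivial⟩, hlu⟩

/-- The equations for `Rel` and `Arr` suffice because the recursion decreases `partRank`. Taking the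
least top makes the relations come from a single decomposition and not from a union over all tops;
the attachment of a hanging part is unique anyway. -/
theorem partSolved (hs : ∀ u v, adj u v → adj v u) (hirr : ∀ u, ¬ adj u u)
    (htri : ∀ a b c, adj a b → adj b c → ¬ adj a c)
    (hA : ∀ x c z l, A x c z l → Inner adj A x c z l ∨ ∃ w, Hangs adj A x c z l w)
    (hRel : ∀ x c z l u v, Rel x c z l u v ↔ RelStep adj A Rel x c z l u v)
    (hArr : ∀ x c z l u v, Arr x c z l u v ↔ ArrStep adj A Arr x c z l u v)
    (hz : Kern adj x c z) (hl : Part adj x c z l l) (hAl : A x c z l) :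
    PartSolved adj A Rel Arr x c z l := by
  induction hm : partRank adj x c z l using Nat.strong_induction_on generalizing x c z l with
  | _ m ih =>
  subst hm
  constructor
  · intro hI
    obtain ⟨ρ, hρ⟩ := exists_isLeastTop hI.2
    have huniq : ∀ ρ', IsLeastTop adj A z l ρ' → ρ' = ρ := fun ρ' h =>
      le_antisymm (h.2 _ hρ.1) (hρ.2 _ h.1)
    have eR : Rel x c z l = PartLt adj A Rel z l ρ fun _ => True := by
      funext u v
      rw [hRel, RelStep]
      refine propext ⟨?_, fun h => .inl ⟨hI, ρ, hρ, h⟩⟩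
      rintro (⟨_, ρ', h, h'⟩ | ⟨h, _⟩)
      · exact huniq ρ' h ▸ h'
      · exact absurd hI h
    have eA : Arr x c z l = PartArr adj Arr (Hood adj z l) z l ρ fun _ => True := by
      funext u v
      rw [hArr, ArrStep]
      refine propext ⟨?_, fun h => .inl ⟨hI, ρ, hρ, h⟩⟩
      rintro (⟨_, ρ', h, h'⟩ | ⟨h, _⟩)
      · exact huniq ρ' h ▸ h'
      · exact absurd hI h
    have hS := solves_top (Rel := Rel) (Arr := Arr) hs hirr htri hρ.1 fun l' hl' =>
      ih _ (partRank_inner hz hI.1 hl ρ l') hρ.1.1 hl'.1 (hρ.1.2 l' hl' trivial).1 rfl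
    rw [eR, eA]
    have eH : Hood adj z l = fun v => Part adj x c z l v ∨ Att adj x c z l v :=
      funext fun v => propext (hood_of_part hs hI.1 hl)
    rw [← eH]
    refine hS.mono_probe fun y hy => ⟨(hood_of_part hs hI.1 hl).2 (.inr hy), ?_⟩
    rw [kern_of_part hI.1 hl]
    exact hy.2.1
  · intro hI
    obtain ⟨w, hw⟩ := (hA _ _ _ _ hAl).resolve_left hI
    have huniq : ∀ w', Hangs adj A x c z l w' → w' = w := fun w' h => (hw.2.1 w').1 ((h.2.1 w').2 rfl)
    have eR : Rel x c z l = PartLt adj A Rel x c w (Part adj x c z l) := by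
      funext u v
      rw [hRel, RelStep]
      refine propext ⟨?_, fun h => .inr ⟨hI, w, hw, h⟩⟩
      rintro (⟨h, _⟩ | ⟨_, w', h, h'⟩)
      · exact absurd h hI
      · exact huniq w' h ▸ h'
    have eA : Arr x c z l =
        PartArr adj Arr (fun t => Part adj x c z l t ∨ t = w) x c w (Part adj x c z l) := by
      funext u v
      rw [hArr, ArrStep]
      refine propext ⟨?_, fun h => .inr ⟨hI, w, hw, h⟩⟩
      rintro (⟨h, _⟩ | ⟨_, w', h, h'⟩)
      · exact absurd h hI
      · exact huniq w' h ▸ h'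
    have hsub : ∀ v, Att adj x c z l v → v = w := fun v => (hw.2.1 v).1
    have eH : (fun u => Part adj x c z l u ∨ Att adj x c z l u) =
        fun u => Part adj x c z l u ∨ u = w := by
      funext u
      rw [hw.2.1]
    have P := pieces_of_good (H := fun u => Part adj x c z l u ∨ u = w)
      (Y := fun u => Rim adj x c u ∧ Part adj x c z l u) (S := Part adj x c z l) (Rel := Rel)
      (Arr := Arr) (A := A) (z := w) (x := x) (c := c) hs
      hw.1 (.inr rfl) ?_ (fun u hu => hu.1) ?_ ?_ hw.2.2 ?_
    · refine ⟨w, hw.1, hw.2.1, ?_⟩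
      rw [eR, eA, eH]
      exact ⟨P.solves_comb hs hirr htri, fun v => ⟨P.not_combLt v, P.not_combArr hs hirr v⟩⟩
    · rintro u (hu | rfl)
      · exact Part.hood hu
      · exact .inl hw.1
    · rintro l' u hl' - (hu | hu)
      · exact .inl (part_subset hs hsub hl' hu)
      · by_cases h : Part adj x c z l u
        · exact .inl h
        · obtain ⟨a, ha, hua⟩ := hu.2.2
          exact .inr (hsub u ⟨hu.1, h, a, part_subset hs hsub hl' ha, hua⟩)
    · rintro u (hu | rfl) hfar
      · obtain ⟨l', hl', hu'⟩ := exists_rep hs (Part.hood hu) hfar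
        exact ⟨l', ⟨hl', part_subset hs hsub hu (Comp.symm hs hu')⟩, hu'⟩
      · exact absurd rfl hfar.1
    · intro l' hl' hS
      exact ih _ (partRank_hangs hs hw.2.1 hS) hw.1 hl'.1 (hw.2.2 l' hl' hS).1 rfl

/-- The final nesting, for an isolated vertex `x`. -/
def TotalLt (adj : V → V → Prop) (A : V → V → V → V → Prop)
    (Rel : V → V → V → V → V → V → Prop) (x u v : V) : Prop :=
  (v = x ∧ u ≠ x) ∨ ∃ c ρ, Kern adj x c c ∧ (∀ t, Kern adj x c t → c ≤ t) ∧
    IsLeastTop adj A x c ρ ∧ PartLt adj A Rel x c ρ (fun _ => True) u v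

/-- The final orientation, for an isolated vertex `x`. -/
def TotalArr (adj : V → V → Prop) (A : V → V → V → V → Prop)
    (Arr : V → V → V → V → V → V → Prop) (x u v : V) : Prop :=
  ∃ c ρ, Kern adj x c c ∧ (∀ t, Kern adj x c t → c ≤ t) ∧
    IsLeastTop adj A x c ρ ∧ PartArr adj Arr (Hood adj x c) x c ρ (fun _ => True) u v

end Recursion

/-! ### The decision procedure -/

/-- The decision procedure for a graph with an isolated vertex `x`. -/
def Accepts {V : Type*} [LE V] (adj : V → V → Prop) (A : V → V → V → V → Prop) (x : V) : Prop :=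
  (∀ a b c, adj a b → adj b c → ¬ adj a c) ∧
    ∀ c, Kern adj x c c → (∀ t, Kern adj x c t → c ≤ t) → ∃ ρ, IsTop adj A x c ρ

section Decision

variable {V : Type*} {adj lt arr : V → V → Prop} {x : V} {A : V → V → V → V → Prop}

theorem BurlingRel.not_fork (h : BurlingRel lt arr) {a b c : V} (hab : arr a b) (hac : arr a c)
    (hbc : arr b c) : False := by
  obtain ⟨f, hf⟩ := h.rank
  rcases h.arr_arr _ _ _ hab hac with rfl | h1 | h1
  · exact lt_irrefl _ (hf _ _ hbc)
  · exact h.irrefl _ (h.arr_lt _ _ _ hbc h1)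
  · rcases h.lt_arr _ _ _ hbc h1 with h2 | h2
    · exact lt_irrefl _ (hf _ _ h2)
    · exact h.irrefl _ h2

theorem BurlingRel.triangle_free (h : BurlingRel lt arr) (hO : Orients adj arr) (a b c : V)
    (hab : adj a b) (hbc : adj b c) : ¬ adj a c := by
  intro hac
  obtain ⟨f, hf⟩ := h.rank
  rw [hO] at hab hbc hac
  rcases hab with h1 | h1 <;> rcases hbc with h2 | h2 <;> rcases hac with h3 | h3
  · exact h.not_fork h1 h3 h2
  · have := hf _ _ h1
    have := hf _ _ h2
    have := hf _ _ h3
    omega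
  · exact h.not_fork h3 h1 h2
  · exact h.not_fork h3 h2 h1
  · exact h.not_fork h1 h2 h3
  · exact h.not_fork h2 h1 h3
  · have := hf _ _ h1
    have := hf _ _ h2
    have := hf _ _ h3
    omega
  · exact h.not_fork h2 h3 h1

variable [Finite V] [LinearOrder V]

/-- Around an isolated `x` the components have empty rims, so the recursion starts without any
condition on probes. -/
theorem accepts_of_burlingRel (h : BurlingRel lt arr) (hO : Orients adj arr)
    (hs : ∀ u v, adj u v → adj v u)
    (hA : ∀ x c z l, (Inner adj A x c z l ∨ ∃ w, Hangs adj A x c z l w) → A x c z l)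
    (hx : ∀ u, ¬ adj u x) : Accepts adj A x := by
  refine ⟨h.triangle_free hO, fun c hc _ => ?_⟩
  have hP : Probes lt arr (Hood adj x c) (Rim adj x c) := by
    intro y v hy
    exact absurd (by rw [← hood_of_isolated hx]; exact hy.1) hy.2
  refine exists_isTop h hO hs hc hP fun ρ l hρ hsink hl => ?_
  exact admissible_of_burlingRel h hO hs hA hρ (.inl hρ) hsink
    ⟨hl, fun u hu => hu.elim Part.hood And.left⟩ hP

variable {Rel Arr : V → V → V → V → V → V → Prop}

/-- The gluing is applied once more, with `x` as outermost vertex and the components of the rest as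
parts nested in it. They have no attachments, so compatibility is void. -/
theorem burlingRel_of_accepts (hs : ∀ u v, adj u v → adj v u) (hirr : ∀ u, ¬ adj u u)
    (hA : ∀ x c z l, A x c z l → Inner adj A x c z l ∨ ∃ w, Hangs adj A x c z l w)
    (hRel : ∀ x c z l u v, Rel x c z l u v ↔ RelStep adj A Rel x c z l u v)
    (hArr : ∀ x c z l u v, Arr x c z l u v ↔ ArrStep adj A Arr x c z l u v)
    (hx : ∀ u, ¬ adj u x) (hacc : Accepts adj A x) :
    BurlingRel (TotalLt adj A Rel x) (TotalArr adj A Arr x) ∧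
      Orients adj (TotalArr adj A Arr x) := by
  let D : V → Prop := fun c => Kern adj x c c ∧ ∀ t, Kern adj x c t → c ≤ t
  let lts : V → V → V → Prop := fun c u v =>
    ∃ ρ, IsLeastTop adj A x c ρ ∧ PartLt adj A Rel x c ρ (fun _ => True) u v
  let arrs : V → V → V → Prop := fun c u v =>
    ∃ ρ, IsLeastTop adj A x c ρ ∧ PartArr adj Arr (Hood adj x c) x c ρ (fun _ => True) u v
  have hcover : ∀ u, u ≠ x → ∃ c, D c ∧ Kern adj x c u := by
    intro u hu
    have hu' : Kern adj x u u := .base ⟨hu, hx u⟩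
    obtain ⟨l, hl, hmin⟩ := Set.exists_min_image {v | Kern adj x u v} id (Set.toFinite _) ⟨u, hu'⟩
    have e := Comp.symm hs hl
    exact ⟨l, ⟨Comp.trans e hl, fun v hv => hmin v (Comp.trans hl hv)⟩, e⟩
  have P : Pieces adj (fun _ => True) (fun _ => False) D (fun _ => True) (Kern adj x)
      (fun _ _ => False) x lts arrs := by
    refine ⟨trivial, id, fun l u _ hu => ⟨trivial, Comp.mem hu⟩, fun l l' u hl hl' hu hu' => ?_,
      fun u _ hu => hcover u hu.1, fun l u v _ hu _ hv huv => .step hu huv hv,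
      fun l w hl => ⟨False.elim, ?_⟩, fun l hl _ => ⟨fun _ _ => id, ?_⟩,
      fun l _ h => absurd trivial h, ?_⟩
    · have e : Kern adj x l l' := Comp.trans hu (Comp.symm hs hu')
      exact le_antisymm (hl.2 _ e) (hl'.2 _ (Comp.symm hs e))
    · rintro ⟨-, h, u, hu, hwu⟩
      refine h (.step hu (hs _ _ hwu) ⟨?_, hx w⟩)
      rintro rfl
      exact hx u (hs _ _ hwu)
    · obtain ⟨ρ, hρ⟩ := exists_isLeastTop (hacc.2 l hl.1 hl.2)
      have huniq : ∀ ρ', IsLeastTop adj A x l ρ' → ρ' = ρ := fun ρ' h =>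
        le_antisymm (h.2 _ hρ.1) (hρ.2 _ h.1)
      have hS := solves_top (Rel := Rel) (Arr := Arr) hs hirr hacc.1 hρ.1 fun l' hl' =>
        partSolved hs hirr hacc.1 hA hRel hArr hρ.1.1 hl'.1 (hρ.1.2 l' hl' trivial).1
      have eL : lts l = PartLt adj A Rel x l ρ fun _ => True := by
        funext u v
        refine propext ⟨?_, fun h => ⟨ρ, hρ, h⟩⟩
        rintro ⟨ρ', h, h'⟩
        exact huniq ρ' h ▸ h'
      have eA : arrs l = PartArr adj Arr (Hood adj x l) x l ρ fun _ => True := by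
        funext u v
        refine propext ⟨?_, fun h => ⟨ρ, hρ, h⟩⟩
        rintro ⟨ρ', h, h'⟩
        exact huniq ρ' h ▸ h'
      rw [eL, eA]
      have hS' := hS.mono_probe (Y' := fun _ => False) fun _ => False.elim
      rw [hood_of_isolated hx] at hS' ⊢
      simpa using hS'
    · rintro l l' _ _ _ ⟨_, h, _⟩
      exact h.elim
  have hS := P.solves_comb hs hirr hacc.1
  have eL : CombLt adj D (fun _ => True) (Kern adj x) (fun _ _ => False) x lts =
      TotalLt adj A Rel x := by
    funext u v
    refine propext ⟨?_, ?_⟩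
    · rintro (⟨rfl, l, _, _, hu⟩ | ⟨l, hl, ρ, h⟩ | ⟨_, _, _, _, _, _, h, _⟩)
      · exact .inl ⟨rfl, (Comp.mem hu).1⟩
      · exact .inr ⟨l, ρ, hl.1, hl.2, h⟩
      · exact h.elim
    · rintro (⟨rfl, hu⟩ | ⟨l, ρ, h1, h2, h⟩)
      · obtain ⟨l, hl, hlu⟩ := hcover u hu
        exact .inl ⟨rfl, l, hl, trivial, hlu⟩
      · exact .inr (.inl ⟨l, ⟨h1, h2⟩, ρ, h⟩)
  have eA : CombArr adj (fun _ => True) D x arrs = TotalArr adj A Arr x := by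
    funext u v
    refine propext ⟨?_, ?_⟩
    · rintro (⟨rfl, _, h⟩ | ⟨l, hl, ρ, h⟩)
      · exact absurd h (hx u)
      · exact ⟨l, ρ, hl.1, hl.2, h⟩
    · rintro ⟨l, ρ, h1, h2, h⟩
      exact .inr ⟨l, ⟨h1, h2⟩, ρ, h⟩
  rw [eL, eA] at hS
  refine ⟨hS.rel, fun u v => ⟨hS.orient u v trivial trivial, ?_⟩⟩
  rintro (h | h)
  · exact (hS.arr_mem _ _ h).2.2
  · exact hs _ _ (hS.arr_mem _ _ h).2.2

end Decision

/-! ### The tables of the decision procedure -/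

def Fm.imp (φ ψ : Fm) : Fm := .or (.not φ) ψ
def Fm.iff (φ ψ : Fm) : Fm := .and (φ.imp ψ) (ψ.imp φ)

theorem Fm.tr_imp {N : ℕ} {I : ℕ → List (Fin N) → Prop} {φ ψ : Fm} {env : ℕ → Fin N} :
    (φ.imp ψ).tr I env ↔ (φ.tr I env → ψ.tr I env) := by
  simp only [Fm.imp, Fm.tr]
  tauto

theorem Fm.tr_iff {N : ℕ} {I : ℕ → List (Fin N) → Prop} {φ ψ : Fm} {env : ℕ → Fin N} :
    (φ.iff ψ).tr I env ↔ (φ.tr I env ↔ ψ.tr I env) := by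
  simp only [Fm.iff, Fm.tr, Fm.tr_imp]
  tauto

theorem Stage.Holds.interp_iff {N : ℕ} [NeZero N] {A : ℕ → ℕ → ℕ} {a k : ℕ} {φ : Fm}
    (h : (Stage.fill a k φ.tm).Holds N A) (hA : HasMultiples N A) (hφ : φ.short = true)
    (l : List (Fin N)) (hl : l.length = k) :
    interp N A a l ↔ φ.tr (interp N A) (tupleEnv l) := by
  classical
  have := h l hl
  rw [Fm.eval_tm hA φ hφ] at this
  rw [interp, this]
  split_ifs with h <;> simp [h]

/-- The arrays hold: `10` adjacency, `11` `Kern`, `12` `Hood`, `13` `Part`, `14` `Att`, `15` `Rep`,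
`16` `NestIn`, `17` `Compat`, `18` admissibility, `19` `IsTop`, `20` `IsLeastTop`, `21` `Inner`,
`22` `Hangs`, `23` `Below`, `24` and `25` the recursive relations, `26` and `27` the final ones,
`28` the vertical order, `29` `LeftOf`, `30` the order of the sides, `31` the answer. The arguments
of a table are the first variables; `.eq 0 0` stands for truth. -/
def adjFm (u v : ℕ) : Fm := .rel 10 [u, v]
def farFm (x u : ℕ) : Fm := .and (.not (.eq u x)) (.not (adjFm u x))
def kernFm : Fm := .and (farFm 0 2) (.or (.eq 2 1) (.ex 3 (.and (.rel 11 [0, 1, 3]) (adjFm 3 2))))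
def hoodFm : Fm := .or (.rel 11 [0, 1, 2]) (.ex 3 (.and (.rel 11 [0, 1, 3]) (adjFm 3 2)))
def partFm : Fm := .and (.and (.rel 12 [0, 1, 4]) (farFm 2 4))
  (.or (.eq 4 3) (.ex 5 (.and (.rel 13 [0, 1, 2, 3, 5]) (adjFm 5 4))))
def attFm : Fm := .and (.rel 12 [0, 1, 4]) (.and (.not (.rel 13 [0, 1, 2, 3, 4]))
  (.ex 5 (.and (.rel 13 [0, 1, 2, 3, 5]) (adjFm 4 5))))
def repFm : Fm := .and (.rel 13 [0, 1, 2, 3, 3])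
  (.all 4 (.imp (.rel 13 [0, 1, 2, 3, 4]) (.not (.lt 4 3))))
def nestFm : Fm :=
  .and (.ex 5 (.ex 6 (.and (.rel 14 [0, 1, 2, 3, 5]) (.and (.rel 13 [0, 1, 2, 4, 6]) (adjFm 5 6)))))
    (.all 5 (.all 6 (.all 7 (.imp (.rel 14 [0, 1, 2, 3, 5]) (.imp (.rel 14 [0, 1, 2, 3, 6])
      (.imp (.rel 13 [0, 1, 2, 4, 7]) (.imp (adjFm 5 7) (adjFm 6 7))))))))
def compatFm : Fm := .imp (.ex 5 (.and (.rel 14 [0, 1, 2, 3, 5]) (.rel 14 [0, 1, 2, 4, 5])))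
  (.or (.rel 16 [0, 1, 2, 3, 4]) (.rel 16 [0, 1, 2, 4, 3]))
def goodFm (x c z : ℕ) (S : ℕ → Fm) (l l' : ℕ) : Fm :=
  .all l (.imp (.rel 15 [x, c, z, l]) (.imp (S l) (.and (.rel 18 [x, c, z, l])
    (.all l' (.imp (.rel 15 [x, c, z, l']) (.imp (S l') (.imp (.not (.eq l l'))
      (.rel 17 [x, c, z, l, l']))))))))
def isTopFm (x c ρ l l' : ℕ) : Fm :=
  .and (.rel 11 [x, c, ρ]) (goodFm x c ρ (fun _ => .eq 0 0) l l')
-- The formula for tops is a parameter: inside the fixed point it must be expanded in terms of array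
-- `18`, afterwards it can be read from array `19`.
def innerFm (top : ℕ → Fm) : Fm :=
  .and (.all 4 (.imp (.rel 13 [0, 1, 2, 3, 4]) (.rel 11 [0, 1, 4]))) (.ex 4 (top 4))
def hangsFm : Fm := .and (.rel 11 [0, 1, 4]) (.and
  (.all 5 (.iff (.rel 14 [0, 1, 2, 3, 5]) (.eq 5 4)))
  (goodFm 0 1 4 (fun l => .rel 13 [0, 1, 2, 3, l]) 5 6))
def admissibleFm : Fm := .or (innerFm fun ρ => isTopFm 2 3 ρ 5 6) (.ex 4 hangsFm)
def leastTopFm : Fm := .and (.rel 19 [0, 1, 2]) (.all 3 (.imp (.rel 19 [0, 1, 3]) (.not (.lt 3 2))))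
def belowFm : Fm := .and (.not (.eq 3 4)) (.and (.rel 16 [0, 1, 2, 3, 4])
  (.imp (.rel 16 [0, 1, 2, 4, 3]) (.lt 4 3)))
def repIn (x c z : ℕ) (S : ℕ → Fm) (l : ℕ) : Fm := .and (.rel 15 [x, c, z, l]) (S l)
def partLtFm (x c z : ℕ) (S : ℕ → Fm) (u v a b y : ℕ) : Fm :=
  .or (.and (.eq v z) (.ex a (.and (repIn x c z S a)
    (.and (.rel 21 [x, c, z, a]) (.rel 13 [x, c, z, a, u]))))) <|
  .or (.ex a (.and (repIn x c z S a) (.rel 24 [x, c, z, a, u, v]))) <|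
  .ex a (.ex b (.and (.and (repIn x c z S a) (.and (repIn x c z S b)
      (.and (.rel 21 [x, c, z, a]) (.and (.rel 21 [x, c, z, b]) (.rel 23 [x, c, z, a, b])))))
    (.and (.rel 13 [x, c, z, a, u]) (.and (.rel 13 [x, c, z, b, v])
      (.ex y (.and (.rel 14 [x, c, z, a, y]) (adjFm y v)))))))
def partArrFm (H : Fm) (x c z : ℕ) (S : ℕ → Fm) (u v a : ℕ) : Fm :=
  .or (.and (.eq v z) (.and H (adjFm u z)))
    (.ex a (.and (repIn x c z S a) (.rel 25 [x, c, z, a, u, v])))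
def relFm : Fm :=
  .or (.and (.rel 21 [0, 1, 2, 3]) (.ex 6 (.and (.rel 20 [2, 3, 6])
      (partLtFm 2 3 6 (fun _ => .eq 0 0) 4 5 7 8 9))))
    (.and (.not (.rel 21 [0, 1, 2, 3])) (.ex 6 (.and (.rel 22 [0, 1, 2, 3, 6])
      (partLtFm 0 1 6 (fun l => .rel 13 [0, 1, 2, 3, l]) 4 5 7 8 9))))
def arrFm : Fm :=
  .or (.and (.rel 21 [0, 1, 2, 3]) (.ex 6 (.and (.rel 20 [2, 3, 6])
      (partArrFm (.rel 12 [2, 3, 4]) 2 3 6 (fun _ => .eq 0 0) 4 5 7))))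
    (.and (.not (.rel 21 [0, 1, 2, 3])) (.ex 6 (.and (.rel 22 [0, 1, 2, 3, 6])
      (partArrFm (.or (.rel 13 [0, 1, 2, 3, 4]) (.eq 4 6)) 0 1 6
        (fun l => .rel 13 [0, 1, 2, 3, l]) 4 5 7))))
def leastFm (c t : ℕ) : Fm :=
  .and (.rel 11 [2, c, c]) (.all t (.imp (.rel 11 [2, c, t]) (.not (.lt t c))))
def totalLtFm : Fm :=
  .ex 2 (.and (.top 2) (.or (.and (.eq 1 2) (.not (.eq 0 2)))
    (.ex 3 (.ex 4 (.and (leastFm 3 5) (.and (.rel 20 [2, 3, 4])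
      (partLtFm 2 3 4 (fun _ => .eq 0 0) 0 1 7 8 9)))))))
def totalArrFm : Fm :=
  .ex 2 (.and (.top 2) (.ex 3 (.ex 4 (.and (leastFm 3 5) (.and (.rel 20 [2, 3, 4])
    (partArrFm (.rel 12 [2, 3, 0]) 2 3 4 (fun _ => .eq 0 0) 0 1 7))))))
def vertFm : Fm :=
  .or (.or (.rel 26 [0, 1]) (.rel 27 [0, 1]))
    (.ex 2 (.and (.rel 28 [0, 2]) (.or (.rel 26 [2, 1]) (.rel 27 [2, 1]))))
def leftFm : Fm :=
  .ex 2 (.ex 3 (.and (.or (.eq 0 2) (.rel 28 [0, 2])) (.and (.or (.eq 1 3) (.rel 28 [1, 3]))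
    (.and (.lt 2 3) (.all 4 (.iff (.rel 28 [2, 4]) (.rel 28 [3, 4])))))))
def sideFm (k u k' u' : ℕ) : Fm :=
  .or (.and (.zero k) (.and (.zero k') (.rel 28 [u', u]))) <|
  .or (.and (.not (.zero k)) (.and (.zero k') (.and (.rel 28 [u', u])
    (.and (.not (.rel 26 [u', u])) (.not (.rel 27 [u', u])))))) <|
  .or (.and (.not (.zero k)) (.and (.not (.zero k')) (.or (.rel 26 [u, u']) (.rel 27 [u', u])))) <|
  .and (.zero k) (.and (.not (.zero k')) (.or (.rel 27 [u, u']) (.eq u u')))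
def sidesFm : Fm :=
  .or (sideFm 0 1 2 3) (.ex 4 (.ex 5 (.and (.rel 30 [0, 1, 4, 5]) (sideFm 4 5 2 3))))
def acceptFm : Fm :=
  .and (.all 0 (.all 1 (.all 2 (.imp (adjFm 0 1) (.imp (adjFm 1 2) (.not (adjFm 0 2)))))))
    (.ex 2 (.and (.top 2) (.all 3 (.imp (leastFm 3 4) (.ex 4 (.rel 19 [2, 3, 4]))))))

def leftSideFm : Fm := .ex 3 (.and (.zero 3) (.rel 30 [1, 2, 3, 0]))
-- Every nonzero kind denotes right sides. The last element is singled out as the only one that is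
-- neither below nor equal to `N - 2`.
def rightSideFm : Fm := .ex 3 (.and (.not (.small 3)) (.and (.not (.top 3)) (.rel 30 [1, 2, 3, 0])))

def bottomTm : Tm :=
  .add (Fm.rel 28 [0, 1]).tm (.add (Fm.rel 29 [1, 0]).tm (Fm.rel 29 [1, 0]).tm)
def topTm : Tm :=
  .add bottomTm (.add (Fm.rel 28 [1, 0]).tm (.add (Fm.rel 28 [1, 0]).tm (Fm.eq 1 0).tm))

/-- The adjacency matrix in base `N`. -/
def adjTm : Tm :=
  .sub (.tab 0 (.add (.tab 5 (.var 0)) (.var 1))) (Fm.not (.and (.small 0) (.small 1))).tm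

/-- The steps of the program. -/
def stages : List Stage :=
  [.fill 10 2 adjTm, .lfp 11 3 kernFm, .fill 12 3 hoodFm.tm, .lfp 13 5 partFm, .fill 14 5 attFm.tm,
    .fill 15 4 repFm.tm, .fill 16 5 nestFm.tm, .fill 17 5 compatFm.tm, .lfp 18 4 admissibleFm,
    .fill 19 3 (isTopFm 0 1 2 3 4).tm, .fill 20 3 leastTopFm.tm,
    .fill 21 4 (innerFm fun ρ => .rel 19 [2, 3, ρ]).tm, .fill 22 5 hangsFm.tm,
    .fill 23 5 belowFm.tm, .lfp 24 6 relFm, .lfp 25 6 arrFm, .fill 26 2 totalLtFm.tm,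
    .fill 27 2 totalArrFm.tm, .lfp 28 2 vertFm, .fill 29 2 leftFm.tm, .lfp 30 4 sidesFm,
    .fill 31 0 acceptFm.tm, .fill 1 1 (.sum 1 (.sum 2 leftSideFm.tm)),
    .fill 2 1 (.sum 1 (.sum 2 rightSideFm.tm)), .fill 3 1 (.sum 1 bottomTm),
    .fill 4 1 (.sum 1 topTm)]

set_option maxRecDepth 100000 in
theorem stagesOk_stages : stagesOk stages = true := by
  decide +kernel

/-! ### The meaning of the tables. -/

section Tables

variable {N : ℕ} [NeZero N] {A : ℕ → ℕ → ℕ}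

/-- The adjacency that is stored in array `10`. -/
def tabAdj (A : ℕ → ℕ → ℕ) (u v : Fin N) : Prop := interp N A 10 [u, v]

/-- The admissible parts according to array `18`. -/
def tabAdm (A : ℕ → ℕ → ℕ) (x c z l : Fin N) : Prop := interp N A 18 [x, c, z, l]

def tabRel (A : ℕ → ℕ → ℕ) (x c z l u v : Fin N) : Prop := interp N A 24 [x, c, z, l, u, v]
def tabArr (A : ℕ → ℕ → ℕ) (x c z l u v : Fin N) : Prop := interp N A 25 [x, c, z, l, u, v]

/-- All steps of the program have been carried out. -/
structure Filled (N : ℕ) [NeZero N] (A : ℕ → ℕ → ℕ) : Prop where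
  mult : HasMultiples N A
  holds : ∀ s ∈ stages, s.Holds N A

/-- Leastness of the fixed point gives the induction from the table to paths, and the fixed-point
equation the converse. -/
theorem Filled.kern (F : Filled N A) (x c u : Fin N) :
    interp N A 11 [x, c, u] ↔ Kern (tabAdj A) x c u := by
  obtain ⟨h1, h2⟩ := F.holds (.lfp 11 3 kernFm) (List.mem_of_getElem? (i := 1) rfl)
  constructor
  · intro h
    refine h2 (fun l => ∀ x c u, l = [x, c, u] → Kern (tabAdj A) x c u) ?_ _ rfl h x c u rfl
    rintro l hl hφ x c u rfl
    simp [kernFm, farFm, adjFm, Fm.tr, tupleEnv, Function.update] at hφ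
    obtain ⟨hf, rfl | ⟨v, hv, hvu⟩⟩ := hφ
    · exact .base hf
    · exact .step hv hvu hf
  · intro h
    induction h with
    | base h =>
      rw [h1 _ rfl]
      simp [kernFm, farFm, adjFm, Fm.tr, tupleEnv, Function.update]
      exact h
    | @step v u _ hvu h ih =>
      rw [h1 _ rfl]
      simp [kernFm, farFm, adjFm, Fm.tr, tupleEnv, Function.update]
      exact ⟨h, .inr ⟨v, ih, hvu⟩⟩

theorem Filled.hood (F : Filled N A) (x c u : Fin N) :
    interp N A 12 [x, c, u] ↔ Hood (tabAdj A) x c u := by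
  have h := F.holds (.fill 12 3 hoodFm.tm) (List.mem_of_getElem? (i := 2) rfl)
  rw [h.interp_iff F.mult rfl _ rfl]
  simp [hoodFm, adjFm, Fm.tr, tupleEnv, Function.update, Hood, F.kern, tabAdj]

theorem Filled.part (F : Filled N A) (x c z l u : Fin N) :
    interp N A 13 [x, c, z, l, u] ↔ Part (tabAdj A) x c z l u := by
  obtain ⟨h1, h2⟩ := F.holds (.lfp 13 5 partFm) (List.mem_of_getElem? (i := 3) rfl)
  constructor
  · intro h
    refine h2 (fun t => ∀ x c z l u, t = [x, c, z, l, u] → Part (tabAdj A) x c z l u) ?_ _ rfl h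
      x c z l u rfl
    rintro l hl hφ x c z l u rfl
    simp [partFm, farFm, adjFm, Fm.tr, tupleEnv, Function.update, F.hood] at hφ
    obtain ⟨hf, rfl | ⟨v, hv, hvu⟩⟩ := hφ
    · exact .base hf
    · exact .step (hv _ _ _ _ _ rfl rfl rfl rfl rfl) hvu hf
  · intro h
    induction h with
    | base h =>
      rw [h1 _ rfl]
      simp [partFm, farFm, adjFm, Fm.tr, tupleEnv, Function.update, F.hood]
      exact h
    | @step v u _ hvu h ih =>
      rw [h1 _ rfl]
      simp [partFm, farFm, adjFm, Fm.tr, tupleEnv, Function.update, F.hood]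
      exact ⟨h, .inr ⟨v, ih, hvu⟩⟩

theorem Filled.att (F : Filled N A) (x c z l u : Fin N) :
    interp N A 14 [x, c, z, l, u] ↔ Att (tabAdj A) x c z l u := by
  have h := F.holds (.fill 14 5 attFm.tm) (List.mem_of_getElem? (i := 4) rfl)
  rw [h.interp_iff F.mult rfl _ rfl]
  simp [attFm, adjFm, Fm.tr, tupleEnv, Function.update, Att, F.hood, F.part, tabAdj]

theorem Filled.rep (F : Filled N A) (x c z l : Fin N) :
    interp N A 15 [x, c, z, l] ↔ Rep (tabAdj A) x c z l := by
  have h := F.holds (.fill 15 4 repFm.tm) (List.mem_of_getElem? (i := 5) rfl)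
  rw [h.interp_iff F.mult rfl _ rfl]
  simp [repFm, Fm.tr, Fm.tr_imp, tupleEnv, Function.update, Rep, F.part]

theorem Filled.nest (F : Filled N A) (x c z l l' : Fin N) :
    interp N A 16 [x, c, z, l, l'] ↔
      NestIn (tabAdj A) (Part (tabAdj A) x c z) (Att (tabAdj A) x c z) l l' := by
  have h := F.holds (.fill 16 5 nestFm.tm) (List.mem_of_getElem? (i := 6) rfl)
  rw [h.interp_iff F.mult rfl _ rfl]
  simp [nestFm, adjFm, Fm.tr, Fm.tr_imp, tupleEnv, Function.update, NestIn, F.part, F.att, tabAdj]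

theorem Filled.compat (F : Filled N A) (x c z l l' : Fin N) :
    interp N A 17 [x, c, z, l, l'] ↔
      Compat (tabAdj A) (Part (tabAdj A) x c z) (Att (tabAdj A) x c z) l l' := by
  have h := F.holds (.fill 17 5 compatFm.tm) (List.mem_of_getElem? (i := 7) rfl)
  rw [h.interp_iff F.mult rfl _ rfl]
  simp [compatFm, Fm.tr, Fm.tr_imp, tupleEnv, Function.update, Compat, F.att, F.nest]

/-- Only the fixed-point equation is used, here and in `Filled.rel` and `Filled.arr`: the recursion
decreases `partRank`, so any fixed point will do. -/
theorem Filled.admissible (F : Filled N A) (x c z l : Fin N) :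
    tabAdm A x c z l ↔ Inner (tabAdj A) (tabAdm A) x c z l ∨
      ∃ w, Hangs (tabAdj A) (tabAdm A) x c z l w := by
  have h := (F.holds (.lfp 18 4 admissibleFm) (List.mem_of_getElem? (i := 8) rfl)).1
  rw [tabAdm, h _ rfl]
  simp [admissibleFm, innerFm, hangsFm, isTopFm, goodFm, Fm.tr, Fm.tr_imp, Fm.tr_iff, tupleEnv,
    Function.update, Inner, Hangs, IsTop, Good, F.att, F.part, F.kern, F.rep, F.compat, tabAdm]

theorem Filled.isTop (F : Filled N A) (x c u : Fin N) :
    interp N A 19 [x, c, u] ↔ IsTop (tabAdj A) (tabAdm A) x c u := by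
  have h := F.holds (.fill 19 3 (isTopFm 0 1 2 3 4).tm) (List.mem_of_getElem? (i := 9) rfl)
  rw [h.interp_iff F.mult rfl _ rfl]
  simp [isTopFm, goodFm, Fm.tr, Fm.tr_imp, tupleEnv, Function.update, IsTop, Good, F.kern, F.rep,
    F.compat, tabAdm]

theorem Filled.leastTop (F : Filled N A) (x c u : Fin N) :
    interp N A 20 [x, c, u] ↔ IsLeastTop (tabAdj A) (tabAdm A) x c u := by
  have h := F.holds (.fill 20 3 leastTopFm.tm) (List.mem_of_getElem? (i := 10) rfl)
  rw [h.interp_iff F.mult rfl _ rfl]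
  simp [leastTopFm, Fm.tr, Fm.tr_imp, tupleEnv, Function.update, IsLeastTop, F.isTop]

theorem Filled.inner (F : Filled N A) (x c z l : Fin N) :
    interp N A 21 [x, c, z, l] ↔ Inner (tabAdj A) (tabAdm A) x c z l := by
  have h := F.holds (.fill 21 4 (innerFm fun ρ => .rel 19 [2, 3, ρ]).tm)
    (List.mem_of_getElem? (i := 11) rfl)
  rw [h.interp_iff F.mult rfl _ rfl]
  simp [innerFm, Fm.tr, Fm.tr_imp, tupleEnv, Function.update, Inner, F.isTop, F.part, F.kern]

theorem Filled.hangs (F : Filled N A) (x c z l w : Fin N) :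
    interp N A 22 [x, c, z, l, w] ↔ Hangs (tabAdj A) (tabAdm A) x c z l w := by
  have h := F.holds (.fill 22 5 hangsFm.tm) (List.mem_of_getElem? (i := 12) rfl)
  rw [h.interp_iff F.mult rfl _ rfl]
  simp [hangsFm, goodFm, Fm.tr, Fm.tr_imp, Fm.tr_iff, tupleEnv, Function.update, Hangs, Good,
    F.att, F.part, F.kern, F.rep, F.compat, tabAdm]

theorem Filled.below (F : Filled N A) (x c z l l' : Fin N) :
    interp N A 23 [x, c, z, l, l'] ↔
      Below (tabAdj A) (Part (tabAdj A) x c z) (Att (tabAdj A) x c z) l l' := by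
  have h := F.holds (.fill 23 5 belowFm.tm) (List.mem_of_getElem? (i := 13) rfl)
  rw [h.interp_iff F.mult rfl _ rfl]
  simp [belowFm, Fm.tr, Fm.tr_imp, tupleEnv, Below, F.nest]

theorem Filled.rel (F : Filled N A) (x c z l u v : Fin N) :
    tabRel A x c z l u v ↔ RelStep (tabAdj A) (tabAdm A) (tabRel A) x c z l u v := by
  have h := (F.holds (.lfp 24 6 relFm) (List.mem_of_getElem? (i := 14) rfl)).1
  rw [tabRel, h _ rfl]
  simp [relFm, partLtFm, repIn, adjFm, Fm.tr, tupleEnv, Function.update, RelStep, PartLt, CombLt,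
    F.inner, F.hangs, F.leastTop, F.below, F.att, F.part, F.rep, tabRel, tabAdj]

theorem Filled.arr (F : Filled N A) (x c z l u v : Fin N) :
    tabArr A x c z l u v ↔ ArrStep (tabAdj A) (tabAdm A) (tabArr A) x c z l u v := by
  have h := (F.holds (.lfp 25 6 arrFm) (List.mem_of_getElem? (i := 15) rfl)).1
  rw [tabArr, h _ rfl]
  simp [arrFm, partArrFm, repIn, adjFm, Fm.tr, tupleEnv, Function.update, ArrStep, PartArr,
    CombArr, F.inner, F.hangs, F.leastTop, F.hood, F.part, F.rep, tabArr, tabAdj]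

theorem Filled.totalLt (F : Filled N A) {x : Fin N} (hx : (x : ℕ) = N - 2) (u v : Fin N) :
    interp N A 26 [u, v] ↔ TotalLt (tabAdj A) (tabAdm A) (tabRel A) x u v := by
  have h := F.holds (.fill 26 2 totalLtFm.tm) (List.mem_of_getElem? (i := 16) rfl)
  rw [h.interp_iff F.mult rfl _ rfl]
  have e : ∀ k : Fin N, (k : ℕ) = N - 2 ↔ k = x := fun k => by rw [Fin.ext_iff, hx]
  simp [totalLtFm, leastFm, partLtFm, repIn, adjFm, Fm.tr, Fm.tr_imp, tupleEnv, Function.update,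
    TotalLt, PartLt, CombLt, e,
    F.inner, F.kern, F.leastTop, F.below, F.att, F.part, F.rep, tabRel, tabAdj, and_assoc]

theorem Filled.totalArr (F : Filled N A) {x : Fin N} (hx : (x : ℕ) = N - 2) (u v : Fin N) :
    interp N A 27 [u, v] ↔ TotalArr (tabAdj A) (tabAdm A) (tabArr A) x u v := by
  have h := F.holds (.fill 27 2 totalArrFm.tm) (List.mem_of_getElem? (i := 17) rfl)
  rw [h.interp_iff F.mult rfl _ rfl]
  have e : ∀ k : Fin N, (k : ℕ) = N - 2 ↔ k = x := fun k => by rw [Fin.ext_iff, hx]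
  simp [totalArrFm, leastFm, partArrFm, repIn, adjFm, Fm.tr, Fm.tr_imp, tupleEnv, Function.update,
    TotalArr, PartArr, CombArr, e, F.kern, F.leastTop, F.hood, F.rep, tabArr, tabAdj, and_assoc]

theorem Filled.vert (F : Filled N A) (u v : Fin N) :
    interp N A 28 [u, v] ↔ VertOn (fun u v => interp N A 26 [u, v])
      (fun u v => interp N A 27 [u, v]) Set.univ u v := by
  obtain ⟨h1, h2⟩ := F.holds (.lfp 28 2 vertFm) (List.mem_of_getElem? (i := 18) rfl)
  constructor
  · intro h
    refine h2 (fun t => ∀ u v, t = [u, v] → VertOn (fun u v => interp N A 26 [u, v])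
      (fun u v => interp N A 27 [u, v]) Set.univ u v) ?_ _ rfl h u v rfl
    rintro l hl hφ u v rfl
    simp [vertFm, Fm.tr, tupleEnv, Function.update] at hφ
    rcases hφ with h | ⟨w, hw, h⟩
    · exact .single ⟨trivial, trivial, h⟩
    · exact .tail hw ⟨trivial, trivial, h⟩
  · intro h
    induction h with
    | single h =>
      rw [h1 _ rfl]
      simp [vertFm, Fm.tr, tupleEnv, Function.update]
      exact .inl h.2.2
    | tail _ h ih =>
      rw [h1 _ rfl]
      simp [vertFm, Fm.tr, tupleEnv, Function.update]
      exact .inr ⟨_, ih, h.2.2⟩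

theorem Filled.left (F : Filled N A) (u v : Fin N) :
    interp N A 29 [u, v] ↔ LeftOf (fun u v => interp N A 28 [u, v]) u v := by
  have h := F.holds (.fill 29 2 leftFm.tm) (List.mem_of_getElem? (i := 19) rfl)
  rw [h.interp_iff F.mult rfl _ rfl]
  simp [leftFm, Fm.tr, Fm.tr_iff, tupleEnv, Function.update, LeftOf]

theorem Filled.sides (F : Filled N A) (e f : Fin N × Fin N) :
    interp N A 30 [e.1, e.2, f.1, f.2] ↔ Relation.TransGen (SideStep (fun k : Fin N => k = 0)
      (fun u v => interp N A 26 [u, v]) (fun u v => interp N A 27 [u, v])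
      fun u v => interp N A 28 [u, v]) e f := by
  obtain ⟨h1, h2⟩ := F.holds (.lfp 30 4 sidesFm) (List.mem_of_getElem? (i := 20) rfl)
  constructor
  · intro h
    refine h2 (fun t => ∀ e f : Fin N × Fin N, t = [e.1, e.2, f.1, f.2] → Relation.TransGen _ e f)
      ?_ _ rfl h e f rfl
    rintro l hl hφ ⟨k, u⟩ ⟨k', u'⟩ rfl
    simp [sidesFm, sideFm, Fm.tr, tupleEnv, Function.update] at hφ
    rcases hφ with h | ⟨a, b, hw, h⟩
    · refine .single ?_
      simpa [SideStep] using h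
    · refine .tail (b := (a, b)) (hw _ _ _ _ rfl rfl rfl rfl) ?_
      simpa [SideStep] using h
  · intro h
    induction h with
    | single h =>
      rw [h1 _ rfl]
      simp [sidesFm, sideFm, Fm.tr, tupleEnv, Function.update]
      left
      simpa [SideStep] using h
    | @tail b c _ h ih =>
      rw [h1 _ rfl]
      simp [sidesFm, sideFm, Fm.tr, tupleEnv, Function.update]
      refine .inr ⟨b.1, b.2, ih, ?_⟩
      simpa [SideStep] using h

open Classical in
theorem Filled.accept (F : Filled N A) {x : Fin N} (hx : (x : ℕ) = N - 2) :
    A 31 0 = if Accepts (tabAdj A) (tabAdm A) x then 1 else 0 := by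
  have h := F.holds (.fill 31 0 acceptFm.tm) (List.mem_of_getElem? (i := 21) rfl) [] rfl
  rw [Fm.eval_tm F.mult _ rfl] at h
  refine h.trans ?_
  have e : ∀ k : Fin N, (k : ℕ) = N - 2 ↔ k = x := fun k => by rw [Fin.ext_iff, hx]
  have : acceptFm.tr (interp N A) (tupleEnv []) ↔ Accepts (tabAdj A) (tabAdm A) x := by
    simp [acceptFm, leastFm, adjFm, Fm.tr, Fm.tr_imp, Function.update, Accepts, e,
      F.kern, F.isTop, tabAdj]
  simp only [this]

end Tables

/-! ### The output coordinates. -/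

section Output

variable {N : ℕ} [NeZero N] {A : ℕ → ℕ → ℕ}

theorem Filled.left_side (F : Filled N A) (v : Fin N) :
    A 1 v = predCount (Relation.TransGen (SideStep (fun k : Fin N => k = 0)
      (fun u v => interp N A 26 [u, v]) (fun u v => interp N A 27 [u, v])
      fun u v => interp N A 28 [u, v])) (0, v) := by
  classical
  have h := F.holds (.fill 1 1 (.sum 1 (.sum 2 leftSideFm.tm))) (List.mem_of_getElem? (i := 22) rfl)
    [v] rfl
  have hc : code N ([v].map Fin.val) = v := by simp [code]
  rw [hc] at h
  refine h.trans ?_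
  rw [Tm.eval_sum]
  unfold predCount
  refine Finset.sum_congr rfl fun k _ => ?_
  rw [Tm.eval_sum]
  refine Finset.sum_congr rfl fun w _ => ?_
  rw [Fm.eval_tm F.mult _ rfl]
  congr 1
  rw [← F.sides]
  simp [leftSideFm, Fm.tr, tupleEnv, Function.update]

theorem Filled.right_side (F : Filled N A) {k₁ : Fin N} (hk : N ≤ k₁ + 1) (hN : 2 ≤ N)
    (v : Fin N) :
    A 2 v = predCount (Relation.TransGen (SideStep (fun k : Fin N => k = 0)
      (fun u v => interp N A 26 [u, v]) (fun u v => interp N A 27 [u, v])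
      fun u v => interp N A 28 [u, v])) (k₁, v) := by
  classical
  have h := F.holds (.fill 2 1 (.sum 1 (.sum 2 rightSideFm.tm)))
    (List.mem_of_getElem? (i := 23) rfl) [v] rfl
  have hc : code N ([v].map Fin.val) = v := by simp [code]
  rw [hc] at h
  refine h.trans ?_
  rw [Tm.eval_sum]
  unfold predCount
  refine Finset.sum_congr rfl fun k _ => ?_
  rw [Tm.eval_sum]
  refine Finset.sum_congr rfl fun w _ => ?_
  rw [Fm.eval_tm F.mult _ rfl]
  congr 1
  rw [← F.sides]
  have e : ∀ k : Fin N, (¬ (k : ℕ) < N - 2 ∧ ¬ (k : ℕ) = N - 2) ↔ k = k₁ := by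
    intro k
    rw [Fin.ext_iff]
    omega
  simp only [rightSideFm, Fm.tr, ← and_assoc, e, tupleEnv, Function.update]
  simp [tupleEnv]

theorem Filled.bottom (F : Filled N A) (v : Fin N) :
    A 3 v = intervalStart (fun u v => interp N A 28 [u, v]) v := by
  classical
  have h := F.holds (.fill 3 1 (.sum 1 bottomTm)) (List.mem_of_getElem? (i := 24) rfl) [v] rfl
  have hc : code N ([v].map Fin.val) = v := by simp [code]
  rw [hc] at h
  refine h.trans ?_
  rw [Tm.eval_sum]
  unfold intervalStart
  refine Finset.sum_congr rfl fun w _ => ?_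
  simp only [bottomTm, Tm.eval]
  rw [Fm.eval_tm F.mult _ rfl, Fm.eval_tm F.mult _ rfl]
  simp [Fm.tr, tupleEnv, Function.update, F.left]

theorem Filled.top (F : Filled N A) (v : Fin N) :
    A 4 v = intervalEnd (fun u v => interp N A 28 [u, v]) v := by
  classical
  have h := F.holds (.fill 4 1 (.sum 1 topTm)) (List.mem_of_getElem? (i := 25) rfl) [v] rfl
  have hc : code N ([v].map Fin.val) = v := by simp [code]
  rw [hc] at h
  refine h.trans ?_
  rw [Tm.eval_sum]
  unfold intervalEnd
  refine Finset.sum_congr rfl fun w _ => ?_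
  simp only [topTm, bottomTm, Tm.eval]
  rw [Fm.eval_tm F.mult _ rfl, Fm.eval_tm F.mult _ rfl, Fm.eval_tm F.mult _ rfl,
    Fm.eval_tm F.mult _ rfl]
  simp [Fm.tr, tupleEnv, Function.update, F.left]

end Output

/-! ### Passing to the extended graph and back, and the final assembly. -/

/-- The graph with two more vertices, which are isolated. -/
def extend {n : ℕ} (G : SimpleGraph (Fin n)) : SimpleGraph (Fin (n + 2)) :=
  G.map (Fin.castAddEmb 2)

theorem extend_adj {n : ℕ} {G : SimpleGraph (Fin n)} {u v : Fin (n + 2)} :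
    (extend G).Adj u v ↔ ∃ (hu : (u : ℕ) < n) (hv : (v : ℕ) < n), G.Adj ⟨u, hu⟩ ⟨v, hv⟩ := by
  constructor
  · rintro ⟨-, a, b, h, rfl, rfl⟩
    exact ⟨a.2, b.2, h⟩
  · rintro ⟨hu, hv, h⟩
    exact (SimpleGraph.map_adj _ _ _ _).2 ⟨_, _, h, rfl, rfl⟩

/-- The index `u * n + v` determines `u` and `v` only if `v` is below `n`. For other pairs the cell
may belong to a different entry of the matrix, and the subtracted formula of `adjTm` erases it. -/
theorem Filled.adj {n : ℕ} {G : SimpleGraph (Fin n)} {A : ℕ → ℕ → ℕ} (F : Filled (n + 2) A)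
    (h0 : A 0 = (inputMemory G).arr 0) (h5 : ∀ i < n + 2, A 5 i = i * n) (u v : Fin (n + 2)) :
    tabAdj A u v ↔ (extend G).Adj u v := by
  classical
  have h := F.holds (.fill 10 2 adjTm) (List.mem_of_getElem? (i := 0) rfl) [u, v] rfl
  rw [tabAdj, interp, h, extend_adj, adjTm, Tm.eval, Fm.eval_tm F.mult _ rfl]
  simp only [Tm.eval, h0, h5 _ (Fin.isLt _), Fm.tr, tupleEnv, List.getD_cons_zero,
    List.getD_cons_succ, inputMemory]
  by_cases hu : (u : ℕ) < n <;> by_cases hv : (v : ℕ) < n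
  · have e : (∃ a b : Fin n, (u : ℕ) * n + v = a * n + b ∧ G.Adj a b) ↔ G.Adj ⟨u, hu⟩ ⟨v, hv⟩ := by
      constructor
      · rintro ⟨a, b, hab, h⟩
        have hn : 0 < n := by omega
        have e1 : (u : ℕ) = a := by
          have := congrArg (· / n) hab
          simpa [Nat.mul_comm _ n, Nat.mul_add_div hn, Nat.div_eq_of_lt, hv, b.2] using this
        have e2 : (v : ℕ) = b := by
          rw [e1] at hab
          omega
        have e3 : (⟨u, hu⟩ : Fin n) = a := Fin.ext e1
        have e4 : (⟨v, hv⟩ : Fin n) = b := Fin.ext e2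
        rw [e3, e4]
        exact h
      · exact fun h => ⟨_, _, rfl, h⟩
    simp [e, hu, hv]
  all_goals
    simp [hu, hv]
    split_ifs <;> simp

theorem IsStrictFrameRep.comap {V W : Type*} {G : SimpleGraph V} {G' : SimpleGraph W}
    {l r b t : V → ℝ} (h : IsStrictFrameRep G l r b t) (f : G' ↪g G) :
    IsStrictFrameRep G' (l ∘ f) (r ∘ f) (b ∘ f) (t ∘ f) := by
  refine ⟨⟨fun v => h.1.left_lt_right _, fun v => h.1.bottom_lt_top _, fun u v huv =>
    h.1.corners _ _ (f.injective.ne huv), fun u v huv => ?_⟩, ⟨fun i j hij =>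
    h.2.pair _ _ (f.injective.ne hij), ?_⟩⟩
  · rw [← f.map_adj_iff]
    exact h.1.adj_iff _ _ (f.injective.ne huv)
  · rintro ⟨i, j, k, hh⟩
    exact h.2.triple ⟨f i, f j, f k, hh⟩

/-- Vertices outside the image stay unrelated to everything, which suits the isolated vertices of
`extend`. -/
theorem BurlingRel.map {V W : Type*} {lt arr : V → V → Prop} (h : BurlingRel lt arr) (f : V ↪ W) :
    BurlingRel (fun x y => ∃ a b, lt a b ∧ f a = x ∧ f b = y)
      (fun x y => ∃ a b, arr a b ∧ f a = x ∧ f b = y) where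
  irrefl := by
    rintro _ ⟨a, b, hab, rfl, e⟩
    exact h.irrefl _ (f.injective e ▸ hab)
  trans := by
    rintro _ _ _ ⟨a, b, h1, rfl, rfl⟩ ⟨b', c, h2, e, rfl⟩
    obtain rfl := f.injective e
    exact ⟨_, _, h.trans _ _ _ h1 h2, rfl, rfl⟩
  lt_lt := by
    rintro _ _ _ ⟨a, b, h1, rfl, rfl⟩ ⟨b', c, h2, e, rfl⟩
    obtain rfl := f.injective e
    exact (h.lt_lt _ _ _ h1 h2).imp (congrArg f)
      (Or.imp (fun h => ⟨_, _, h, rfl, rfl⟩) fun h => ⟨_, _, h, rfl, rfl⟩)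
  arr_arr := by
    rintro _ _ _ ⟨a, b, h1, rfl, rfl⟩ ⟨b', c, h2, e, rfl⟩
    obtain rfl := f.injective e
    exact (h.arr_arr _ _ _ h1 h2).imp (congrArg f)
      (Or.imp (fun h => ⟨_, _, h, rfl, rfl⟩) fun h => ⟨_, _, h, rfl, rfl⟩)
  arr_lt := by
    rintro _ _ _ ⟨a, b, h1, rfl, rfl⟩ ⟨b', c, h2, e, rfl⟩
    obtain rfl := f.injective e
    exact ⟨_, _, h.arr_lt _ _ _ h1 h2, rfl, rfl⟩
  lt_arr := by
    rintro _ _ _ ⟨a, b, h1, rfl, rfl⟩ ⟨b', c, h2, e, rfl⟩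
    obtain rfl := f.injective e
    exact (h.lt_arr _ _ _ h1 h2).imp (fun h => ⟨_, _, h, rfl, rfl⟩) fun h => ⟨_, _, h, rfl, rfl⟩
  rank := by
    obtain ⟨g, hg⟩ := h.rank
    refine ⟨fun x => Function.extend f g 0 x, ?_⟩
    rintro _ _ ⟨a, b, h1, rfl, rfl⟩
    simpa [f.injective.extend_apply] using hg _ _ h1

/-- A program that recognizes Burling graphs and represents them by frames. -/
theorem exists_recognition_program :
    ∃ (c : Program) (p : Polynomial ℕ),
      ∀ (n : ℕ) (G : SimpleGraph (Fin n)),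
        ∃ (s : Memory) (T : ℕ),
          Runs c (inputMemory G) s T ∧
          T ≤ p.eval n ∧
          (IsBurlingGraph G →
            s.reg 0 = 1 ∧
            IsStrictFrameRep G
              (fun v => (s.arr 1 v.1 : ℝ)) (fun v => (s.arr 2 v.1 : ℝ))
              (fun v => (s.arr 3 v.1 : ℝ)) (fun v => (s.arr 4 v.1 : ℝ))) ∧
          (¬ IsBurlingGraph G → s.reg 0 = 0) := by
  classical
  obtain ⟨c, p, hp⟩ := exists_program stages stagesOk_stages (by decide +kernel) 31
  refine ⟨c, p, fun n G => ?_⟩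
  obtain ⟨s, T, hrun, hT, hreg, hstages, hmult, h0, h5⟩ := hp n G
  refine ⟨s, T, hrun, hT, ?_⟩
  have F : Filled (n + 2) s.arr := ⟨hmult, hstages⟩
  have hadj : tabAdj s.arr = (extend G).Adj := by
    funext u v
    exact propext (F.adj h0 h5 u v)
  -- The first added vertex is the isolated one in which all components get nested.
  let x : Fin (n + 2) := ⟨n, by omega⟩
  have hx : (x : ℕ) = n + 2 - 2 := rfl
  have hiso : ∀ u, ¬ tabAdj s.arr u x := by
    intro u h
    rw [hadj, extend_adj] at h
    obtain ⟨-, h, -⟩ := h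
    exact lt_irrefl _ h
  have hs : ∀ u v, tabAdj (N := n + 2) s.arr u v → tabAdj s.arr v u := by
    rw [hadj]
    exact fun u v h => h.symm
  have hirr : ∀ u, ¬ tabAdj (N := n + 2) s.arr u u := by
    rw [hadj]
    exact fun u => (extend G).loopless.irrefl u
  let f : G ↪g extend G := ⟨(Fin.castAddEmb 2), by
    intro a b
    exact SimpleGraph.map_adj_apply⟩
  have hsound : Accepts (tabAdj s.arr) (tabAdm s.arr) x →
      BurlingRel (fun u v : Fin (n + 2) => interp (n + 2) s.arr 26 [u, v])
        (fun u v => interp (n + 2) s.arr 27 [u, v]) ∧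
      Orients (extend G).Adj fun u v => interp (n + 2) s.arr 27 [u, v] := by
    intro hacc
    have := burlingRel_of_accepts (A := tabAdm s.arr) (Rel := tabRel s.arr) (Arr := tabArr s.arr)
      hs hirr (fun x c z l => (F.admissible x c z l).1) F.rel F.arr hiso hacc
    rw [hadj] at this
    have e1 : (fun u v : Fin (n + 2) => interp (n + 2) s.arr 26 [u, v]) =
        TotalLt (extend G).Adj (tabAdm s.arr) (tabRel s.arr) x := by
      funext u v
      rw [F.totalLt hx, hadj]
    have e2 : (fun u v : Fin (n + 2) => interp (n + 2) s.arr 27 [u, v]) =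
        TotalArr (extend G).Adj (tabAdm s.arr) (tabArr s.arr) x := by
      funext u v
      rw [F.totalArr hx, hadj]
    rw [e1, e2]
    exact this
  rw [hreg, F.accept hx]
  constructor
  · intro hG
    obtain ⟨lt, arr, hB, hO⟩ := hG.exists_burlingRel
    have hacc : Accepts (tabAdj s.arr) (tabAdm s.arr) x := by
      refine accepts_of_burlingRel (hB.map (Fin.castAddEmb 2)) ?_ hs
        (fun x c z l => (F.admissible x c z l).2) hiso
      intro u v
      rw [hadj, extend, SimpleGraph.map_adj]
      constructor
      · rintro ⟨a, b, h, rfl, rfl⟩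
        exact ((hO a b).1 h).imp (fun h => ⟨_, _, h, rfl, rfl⟩) fun h => ⟨_, _, h, rfl, rfl⟩
      · rintro (⟨a, b, h, rfl, rfl⟩ | ⟨a, b, h, rfl, rfl⟩)
        · exact ⟨a, b, (hO a b).2 (.inl h), rfl, rfl⟩
        · exact ⟨b, a, (hO b a).2 (.inr h), rfl, rfl⟩
    refine ⟨if_pos hacc, ?_⟩
    obtain ⟨hB', hO'⟩ := hsound hacc
    have hvert : VertOn (fun u v : Fin (n + 2) => interp (n + 2) s.arr 26 [u, v])
        (fun u v => interp (n + 2) s.arr 27 [u, v]) Set.univ =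
        fun u v => interp (n + 2) s.arr 28 [u, v] := by
      funext u v
      exact propext (F.vert u v).symm
    -- The vertices themselves double as kinds of sides, with `0` for left and the last element for
    -- right. The second added vertex keeps these two distinct even if `n` is zero.
    have hH := hB'.horizontalOn_predCount (κ := Fin (n + 2)) (z := fun k => k = 0) (k₀ := 0)
      (k₁ := Fin.last (n + 1)) rfl (by simp [Fin.ext_iff])
    have hrep := hB'.isStrictFrameRep hO' hH
    rw [hvert] at hrep
    have := hrep.comap f
    simp only [← F.left_side, ← F.right_side (k₁ := Fin.last (n + 1)) (by simp) (by omega),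
      ← F.bottom, ← F.top] at this
    exact this
  · intro hG
    refine if_neg fun hacc => hG ?_
    obtain ⟨hB', hO'⟩ := hsound hacc
    refine (hB'.comap (φ := f) f.injective).isBurlingGraph fun u v => ?_
    rw [← f.map_adj_iff]
    exact hO' _ _

end BurlingRec

/-- There is one program and one polynomial such that on every graph `G` with `n` vertices the
program halts within polynomially many steps; if `G` is a Burling graph, register `0` finally holds
`1` and arrays `1`, `2`, `3`, `4` hold the left, right, bottom and top coordinates of a strict
frame representation of `G`; otherwise register `0` finally holds `0`. -/
theorem theorem1 :
    ∃ (c : BurlingRec.Program) (p : Polynomial ℕ),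
      ∀ (n : ℕ) (G : SimpleGraph (Fin n)),
        ∃ (s : BurlingRec.Memory) (T : ℕ),
          BurlingRec.Runs c (BurlingRec.inputMemory G) s T ∧
          T ≤ p.eval n ∧
          (BurlingRec.IsBurlingGraph G →
            s.reg 0 = 1 ∧
            BurlingRec.IsStrictFrameRep G
              (fun v => (s.arr 1 v.1 : ℝ)) (fun v => (s.arr 2 v.1 : ℝ))
              (fun v => (s.arr 3 v.1 : ℝ)) (fun v => (s.arr 4 v.1 : ℝ))) ∧
          (¬ BurlingRec.IsBurlingGraph G → s.reg 0 = 0) :=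
  BurlingRec.exists_recognition_program
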